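/- **Setting.** Let $\gamma,s\in(0,1]$ and $N\in\mathbb N$ with $N>2s$, $\gamma\ge s-\tfrac12$ and $N\ge N_{s,\gamma}$, where $N_{s,\gamma}=4s$ if $\gamma<2s$ and $N_{s,\gamma}=4s(1+\gamma)-\gamma$ if $\gamma\ge 2s$. Let $\Omega\subset\mathbb R^N$ be a bounded domain with $C^2$ boundary and $\delta(x)=\mathrm{dist}(x,\partial\Omega)$. Let $\mathcal L: C_c^\infty(\Omega)\subset L^2(\Omega)\to L^2(\Omega)$ be a linear, symmetric operator with $\mathcal B(u,u)\ge 0$, where $\mathcal B(u,v)=\int_\Omega u\,\mathcal L v\,dx$ for $u,v\in C_c^\infty(\Omega)$. Let $\mathbb H(\Omega)\subset L^2(\Omega)$ be the completion of $C_c^\infty(\Omega)$ with respect to the norm $\|u\|_{L^2(\Omega)}+\mathcal B(u,u)^{1/2}$, that is, the form domain of the self-adjoint (Friedrichs) extension of $\mathcal L$, again denoted $\mathcal L$. Extend $\mathcal B(u,u)$ to $\mathbb H(\Omega)$ by continuity and write $\|u\|_{\mathbb H(\Omega)}^2:=\mathcal B(u,u)$. Assume: * $\mathcal L$ has a Green function: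 a measurable, symmetric kernel $G^\Omega(x,y)>0$ ($x,y\in\Omega$, $x\ne y$) such that for some constants $0<c\le C$ $$c\,K(x,y)\le G^\Omega(x,y)\le C\,K(x,y),\qquad K(x,y)=\frac1{|x-y|^{N-2s}}\Big(\frac{\delta(x)}{|x-y|}\wedge1\Big)^{\gamma}\Big(\frac{\delta(y)}{|x-y|}\wedge1\Big)^{\gamma},$$ and such that for every $f\in C_c^\infty(\Omega)$ the equation $\mathcal Lu=f$ has a unique solution $u$ in the domain of the extended operator, namely $u=\mathbb G^\Omega[f]:=\int_\Omega G^\Omega(\cdot,y)f(y)\,dy$; * $\mathbb H(\Omega)=H^s_{00}(\Omega):=\{u\in H^s(\Omega): u/\delta^s\in L^2(\Omega)\}$, where $H^s(\Omega)$ is the fractional Sobolev space defined by the Gagliardo seminorm if $s<1$, and the usual Sobolev space $H^1(\Omega)$ if $s=1$. Let $1<p<p^*:=\frac{N+\gamma}{N+\gamma-2s}$ and let $\mu$ be a positive Radon measure on $\Omega$ with $\int_\Omega\delta^\gamma\,d\mu=1$. For $\lambda>0$, a positive weak-dual solution of $$\mathcal Lu=u^p+\lambda\mu\quad\text{in }\Omega\quad\text{(with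 homogeneous boundary condition)}\tag{$P_\lambda$}$$ is a measurable $u$ with $u>0$ a.e. in $\Omega$, $\int_\Omega u^p\delta^\gamma\,dx<\infty$ and $$\int_\Omega u\,\xi\,dx=\int_\Omega u^p\,\mathbb G^\Omega[\xi]\,dx+\lambda\int_\Omega\mathbb G^\Omega[\xi]\,d\mu\qquad\text{for all }\xi\in\delta^\gamma L^\infty(\Omega).$$ It is minimal if it is a.e. less than or equal to every positive weak-dual solution of $(P_\lambda)$. **Statement.** The number $\lambda^*:=\sup\{\lambda>0:(P_\lambda)\text{ has a positive weak-dual solution}\}$ is positive and finite, and $(P_{\lambda^*})$ has a minimal positive weak-dual solution $\underline u_{\lambda^*}$ (unique up to null sets). This solution is semi-stable, i.e. $$\|\xi\|_{\mathbb H(\Omega)}^2\ \ge\ p\int_\Omega(\underline u_{\lambda^*})^{p-1}\xi^2\,dx\qquad\text{for all }\xi\in\mathbb H(\Omega)\setminus\{0\}$$ (in particular the integral is finite). Moreover $\sigma(\lambda^*)=1$, where $$\sigma(\lambda^*):=\inf_{\xi\in\mathbb H(\Omega),\ \xi\ne0}\frac{\|\xi\|_{\mathbb H(\Omega)}^2}{\int_\Omega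 p\,(\underline u_{\lambda^*})^{p-1}\xi^2\,dx}.$$ -/

import Mathlib

open MeasureTheory Filter Topology TopologicalSpace Set
open scoped Distributions ENNReal

noncomputable section

/-- The Euclidean space `ℝ^N`. -/
abbrev Euc (N : ℕ) : Type := EuclideanSpace ℝ (Fin N)

/-- The real Hilbert space `L²(Ω)` (Lebesgue measure). -/
abbrev L2 {N : ℕ} (Ω : Opens (Euc N)) : Type :=
  Lp ℝ 2 (volume.restrict (Ω : Set (Euc N)))

/-! ### The domain -/

/-- `δ(x) = dist(x, ∂Ω)`. -/
def bdist {N : ℕ} (Ω : Opens (Euc N)) (x : Euc N) : ℝ :=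
  Metric.infDist x (frontier (Ω : Set (Euc N)))

/-- `Ω` has `C²` boundary: near each boundary point, `Ω` is the set where a `C²` function with
nonvanishing gradient is negative. -/
def HasC2Boundary {N : ℕ} (Ω : Opens (Euc N)) : Prop :=
  ∀ z ∈ frontier (Ω : Set (Euc N)), ∃ ρ : Euc N → ℝ,
    ContDiffAt ℝ 2 ρ z ∧ fderiv ℝ ρ z ≠ 0 ∧ ∀ᶠ y in 𝓝 z, (y ∈ Ω ↔ ρ y < 0)

/-- Bounded domain (nonempty connected open set) with `C²` boundary. -/
structure IsBoundedC2Domain {N : ℕ} (Ω : Opens (Euc N)) : Prop where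
  connected : IsConnected (Ω : Set (Euc N))
  bounded : Bornology.IsBounded (Ω : Set (Euc N))
  boundary : HasC2Boundary Ω

/-! ### The operator on `C_c^∞(Ω)`, its quadratic form and its self-adjoint extension -/

/-- An operator `𝓛 : C_c^∞(Ω) ⊂ L²(Ω) → L²(Ω)`. -/
abbrev TestOperator {N : ℕ} (Ω : Opens (Euc N)) : Type := 𝓓(Ω, ℝ) →ₗ[ℝ] L2 Ω

/-- `B(φ, ψ) = ∫_Ω φ 𝓛ψ dx` for `φ, ψ ∈ C_c^∞(Ω)`. -/
def testForm {N : ℕ} {Ω : Opens (Euc N)} (L : TestOperator Ω) (φ ψ : 𝓓(Ω, ℝ)) : ℝ :=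
  ∫ x in (Ω : Set (Euc N)), φ x * L ψ x

/-- `𝓛` is a positive, symmetric operator on `C_c^∞(Ω)`. -/
def IsPositiveSymmetric {N : ℕ} {Ω : Opens (Euc N)} (L : TestOperator Ω) : Prop :=
  (∀ φ ψ : 𝓓(Ω, ℝ), testForm L φ ψ = testForm L ψ φ) ∧ ∀ φ : 𝓓(Ω, ℝ), 0 ≤ testForm L φ φ

/-- The test functions `φ n` converge to `u` in `L²(Ω)` and form a Cauchy sequence for the
quadratic form `B`. -/
def IsFormApprox {N : ℕ} {Ω : Opens (Euc N)} (L : TestOperator Ω) (φ : ℕ → 𝓓(Ω, ℝ))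
    (u : L2 Ω) : Prop :=
  Tendsto (fun n => eLpNorm (fun x => φ n x - u x) 2 (volume.restrict (Ω : Set (Euc N))))
    atTop (𝓝 0) ∧
  ∀ ε : ℝ, 0 < ε → ∃ k : ℕ, ∀ m ≥ k, ∀ n ≥ k, testForm L (φ m - φ n) (φ m - φ n) < ε

/-- `ℍ(Ω)`: the completion of `C_c^∞(Ω)` for the norm `‖u‖_{L²} + B(u,u)^{1/2}`, realized
inside `L²(Ω)`. -/
def formDomain {N : ℕ} {Ω : Opens (Euc N)} (L : TestOperator Ω) : Set (L2 Ω) :=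
  {u | ∃ φ : ℕ → 𝓓(Ω, ℝ), IsFormApprox L φ u}

/-- `B(u,u)`, the squared norm of `u` in `ℍ(Ω)`, extended from `C_c^∞(Ω)` to `ℍ(Ω)` by
continuity: the limit of `B(φ n, φ n)` along sequences as in `IsFormApprox`. By
`energy_eq_of_tendsto` below, the set here is a singleton for `u ∈ ℍ(Ω)`. -/
def energy {N : ℕ} {Ω : Opens (Euc N)} (L : TestOperator Ω) (u : L2 Ω) : ℝ :=
  sInf {q : ℝ | ∃ φ : ℕ → 𝓓(Ω, ℝ), IsFormApprox L φ u ∧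
    Tendsto (fun n => testForm L (φ n) (φ n)) atTop (𝓝 q)}

/-- `u` belongs to the domain of the self-adjoint (Friedrichs) extension of `𝓛`, and that
extension maps `u` to `f`. The extension is the restriction of the adjoint `𝓛*` to the elements
of its domain which lie in the form domain `ℍ(Ω)`. -/
def IsSolution {N : ℕ} {Ω : Opens (Euc N)} (L : TestOperator Ω) (f : 𝓓(Ω, ℝ)) (u : L2 Ω) : Prop :=
  u ∈ formDomain L ∧ ∀ ψ : 𝓓(Ω, ℝ),
    ∫ x in (Ω : Set (Euc N)), u x * L ψ x = ∫ x in (Ω : Set (Euc N)), f x * ψ x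

/-! ### The Green function -/

/-- `𝔾[f](x) = ∫_Ω G(x,y) f(y) dy`. -/
def greenOp {N : ℕ} (Ω : Opens (Euc N)) (G : Euc N → Euc N → ℝ) (f : Euc N → ℝ) (x : Euc N) : ℝ :=
  ∫ y in (Ω : Set (Euc N)), G x y * f y

/-- `|x-y|^{2s-N} (δ(x)/|x-y| ∧ 1)^γ (δ(y)/|x-y| ∧ 1)^γ`. -/
def greenProfile {N : ℕ} (Ω : Opens (Euc N)) (s γ : ℝ) (x y : Euc N) : ℝ :=
  1 / ‖x - y‖ ^ ((N : ℝ) - 2 * s) *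
    (min (bdist Ω x / ‖x - y‖) 1) ^ γ * (min (bdist Ω y / ‖x - y‖) 1) ^ γ

/-- `𝓛` admits the Green function `G`: a symmetric positive kernel off the diagonal of `Ω × Ω`,
with two-sided estimates by `greenProfile`, such that for `f ∈ C_c^∞(Ω)` the problem `𝓛u = f`
with homogeneous condition has a unique solution, namely `𝔾[f]`. The values of `G` on the diagonal
and off `Ω × Ω` are irrelevant. -/
structure IsGreenFunction {N : ℕ} {Ω : Opens (Euc N)} (L : TestOperator Ω) (s γ : ℝ)
    (G : Euc N → Euc N → ℝ) : Prop where
  measurable : Measurable fun q : Ω × Ω => G q.1 q.2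
  symm : ∀ x ∈ Ω, ∀ y ∈ Ω, x ≠ y → G x y = G y x
  pos : ∀ x ∈ Ω, ∀ y ∈ Ω, x ≠ y → 0 < G x y
  estimate : ∃ c C : ℝ, 0 < c ∧ 0 < C ∧ ∀ x ∈ Ω, ∀ y ∈ Ω, x ≠ y →
    c * greenProfile Ω s γ x y ≤ G x y ∧ G x y ≤ C * greenProfile Ω s γ x y
  solves : ∀ f : 𝓓(Ω, ℝ), ∃ u : L2 Ω,
    u =ᵐ[volume.restrict (Ω : Set (Euc N))] greenOp Ω G f ∧
    ∀ v : L2 Ω, IsSolution L f v ↔ v = u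

/-! ### Fractional Sobolev spaces -/

/-- `u ∈ H^s(Ω)`: finite Gagliardo seminorm if `s < 1`, and weak first derivatives in `L²(Ω)` if
`s = 1` (used for `0 < s ≤ 1` only). -/
def MemHs {N : ℕ} (Ω : Opens (Euc N)) (s : ℝ) (u : L2 Ω) : Prop :=
  (s < 1 →
    ∫⁻ x in (Ω : Set (Euc N)), ∫⁻ y in (Ω : Set (Euc N)),
      ENNReal.ofReal ((u x - u y) ^ 2 / ‖x - y‖ ^ ((N : ℝ) + 2 * s)) < ∞) ∧
  (s = 1 → ∃ g : Fin N → L2 Ω, ∀ (i : Fin N) (φ : 𝓓(Ω, ℝ)),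
    ∫ x in (Ω : Set (Euc N)), u x * fderiv ℝ φ x (EuclideanSpace.single i 1) =
      -∫ x in (Ω : Set (Euc N)), g i x * φ x)

/-- `H^s_{00}(Ω) = {u ∈ H^s(Ω) : u / δ^s ∈ L²(Ω)}`. -/
def Hs00 {N : ℕ} (Ω : Opens (Euc N)) (s : ℝ) : Set (L2 Ω) :=
  {u | MemHs Ω s u ∧
    MemLp (fun x => u x / bdist Ω x ^ s) 2 (volume.restrict (Ω : Set (Euc N)))}

/-! ### The semilinear problem -/

/-- The critical exponent `p^* = (N+γ)/(N+γ-2s)`. -/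
def critExp (N : ℕ) (s γ : ℝ) : ℝ := ((N : ℝ) + γ) / ((N : ℝ) + γ - 2 * s)

/-- The dimension bound `N_{s,γ}`. -/
def dimBound (s γ : ℝ) : ℝ := if γ < 2 * s then 4 * s else 4 * s * (1 + γ) - γ

/-- `ξ ∈ δ^γ L^∞(Ω)`. -/
def MemWeightedLinfty {N : ℕ} (Ω : Opens (Euc N)) (γ : ℝ) (ξ : Euc N → ℝ) : Prop :=
  ∃ v : Euc N → ℝ, MemLp v ∞ (volume.restrict (Ω : Set (Euc N))) ∧
    ∀ x ∈ Ω, ξ x = bdist Ω x ^ γ * v x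

/-- `u` is a positive weak-dual solution of `𝓛u = u^p + lam μ` in `Ω` with homogeneous boundary
condition: `u > 0` a.e. in `Ω`, `u ∈ L^p(Ω, δ^γ)`, and
`∫_Ω u ξ dx = ∫_Ω u^p 𝔾[ξ] dx + lam ∫_Ω 𝔾[ξ] dμ` for all `ξ ∈ δ^γ L^∞(Ω)`. -/
structure IsPositiveWeakDualSolution {N : ℕ} (Ω : Opens (Euc N)) (γ : ℝ)
    (G : Euc N → Euc N → ℝ) (μ : Measure (Euc N)) (p lam : ℝ) (u : Euc N → ℝ) : Prop where
  pos : ∀ᵐ x ∂volume.restrict (Ω : Set (Euc N)), 0 < u x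
  aestronglyMeasurable : AEStronglyMeasurable u (volume.restrict (Ω : Set (Euc N)))
  integrable : IntegrableOn (fun x => |u x| ^ p * bdist Ω x ^ γ) (Ω : Set (Euc N))
  eqn : ∀ ξ : Euc N → ℝ, MemWeightedLinfty Ω γ ξ →
    ∫ x in (Ω : Set (Euc N)), u x * ξ x =
      (∫ x in (Ω : Set (Euc N)), u x ^ p * greenOp Ω G ξ x) +
        lam * ∫ x in (Ω : Set (Euc N)), greenOp Ω G ξ x ∂μ

/-- `u` is a minimal positive weak-dual solution. -/
def IsMinimalSolution {N : ℕ} (Ω : Opens (Euc N)) (γ : ℝ)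
    (G : Euc N → Euc N → ℝ) (μ : Measure (Euc N)) (p lam : ℝ) (u : Euc N → ℝ) : Prop :=
  IsPositiveWeakDualSolution Ω γ G μ p lam u ∧
  ∀ v : Euc N → ℝ, IsPositiveWeakDualSolution Ω γ G μ p lam v →
    ∀ᵐ x ∂volume.restrict (Ω : Set (Euc N)), u x ≤ v x

/-- The parameters `lam > 0` for which there is a positive weak-dual solution. -/
def solvableParams {N : ℕ} (Ω : Opens (Euc N)) (γ : ℝ)
    (G : Euc N → Euc N → ℝ) (μ : Measure (Euc N)) (p : ℝ) : Set ℝ :=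
  {lam | 0 < lam ∧ ∃ u : Euc N → ℝ, IsPositiveWeakDualSolution Ω γ G μ p lam u}

/-- Semi-stability: `‖ξ‖²_ℍ ≥ p ∫_Ω u^{p-1} ξ² dx` for all `ξ ∈ ℍ(Ω) \ {0}`; in particular the
integral is finite. -/
def IsSemistable {N : ℕ} {Ω : Opens (Euc N)} (L : TestOperator Ω) (p : ℝ)
    (u : Euc N → ℝ) : Prop :=
  ∀ ξ ∈ formDomain L, ξ ≠ 0 →
    IntegrableOn (fun x => u x ^ (p - 1) * ξ x ^ 2) (Ω : Set (Euc N)) ∧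
    p * ∫ x in (Ω : Set (Euc N)), u x ^ (p - 1) * ξ x ^ 2 ≤ energy L ξ

/-- `σ = inf { ‖ξ‖²_ℍ / ∫_Ω p u^{p-1} ξ² dx : ξ ∈ ℍ(Ω), ξ ≠ 0 }`. -/
def weightedEigenvalue {N : ℕ} {Ω : Opens (Euc N)} (L : TestOperator Ω) (p : ℝ)
    (u : Euc N → ℝ) : ℝ :=
  sInf {t : ℝ | ∃ ξ ∈ formDomain L, ξ ≠ 0 ∧
    t = energy L ξ / ∫ x in (Ω : Set (Euc N)), p * u x ^ (p - 1) * ξ x ^ 2}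

/-! ### The energy is well defined -/

theorem testFunction_memLp {N : ℕ} {Ω : Opens (Euc N)} (φ : 𝓓(Ω, ℝ)) :
    MemLp φ 2 (volume.restrict (Ω : Set (Euc N))) :=
  (φ.continuous.memLp_of_hasCompactSupport φ.hasCompactSupport).restrict _

theorem testForm_integrable {N : ℕ} {Ω : Opens (Euc N)} (L : TestOperator Ω) (φ ψ : 𝓓(Ω, ℝ)) :
    Integrable (fun x => φ x * L ψ x) (volume.restrict (Ω : Set (Euc N))) :=
  (testFunction_memLp φ).integrable_mul (Lp.memLp (L ψ))

theorem testForm_add_left {N : ℕ} {Ω : Opens (Euc N)} (L : TestOperator Ω) (φ φ' ψ : 𝓓(Ω, ℝ)) :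
    testForm L (φ + φ') ψ = testForm L φ ψ + testForm L φ' ψ := by
  unfold testForm
  rw [← integral_add (testForm_integrable L φ ψ) (testForm_integrable L φ' ψ)]
  congr 1; ext x
  have : (φ + φ') x = φ x + φ' x := rfl
  rw [this]; ring

theorem testForm_smul_left {N : ℕ} {Ω : Opens (Euc N)} (L : TestOperator Ω) (c : ℝ)
    (φ ψ : 𝓓(Ω, ℝ)) : testForm L (c • φ) ψ = c * testForm L φ ψ := by
  unfold testForm
  rw [← integral_const_mul]
  congr 1; ext x
  have : (c • φ) x = c * φ x := rfl
  rw [this]; ring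

/-- The form `B` as a pre-inner product on `C_c^∞(Ω)`. -/
@[reducible] def testCore {N : ℕ} {Ω : Opens (Euc N)} (L : TestOperator Ω) (hL : IsPositiveSymmetric L) :
    PreInnerProductSpace.Core ℝ 𝓓(Ω, ℝ) where
  inner φ ψ := testForm L φ ψ
  conj_inner_symm φ ψ := by simpa using hL.1 ψ φ
  re_inner_nonneg φ := by simpa using hL.2 φ
  add_left φ φ' ψ := testForm_add_left L φ φ' ψ
  smul_left φ ψ c := by simpa using testForm_smul_left L c φ ψ

theorem testForm_cauchySchwarz {N : ℕ} {Ω : Opens (Euc N)} (L : TestOperator Ω)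
    (hL : IsPositiveSymmetric L) (φ ψ : 𝓓(Ω, ℝ)) :
    |testForm L φ ψ| ≤ √(testForm L φ φ) * √(testForm L ψ ψ) := by
  have h := @InnerProductSpace.Core.norm_inner_le_norm ℝ 𝓓(Ω, ℝ) _ _ _ (testCore L hL) φ ψ
  exact h

theorem testForm_sqrt_sub {N : ℕ} {Ω : Opens (Euc N)} (L : TestOperator Ω)
    (hL : IsPositiveSymmetric L) (φ ψ : 𝓓(Ω, ℝ)) :
    |√(testForm L φ φ) - √(testForm L ψ ψ)| ≤ √(testForm L (φ - ψ) (φ - ψ)) := by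
  let _ := @InnerProductSpace.Core.toSeminormedAddCommGroup ℝ 𝓓(Ω, ℝ) _ _ _ (testCore L hL)
  exact abs_norm_sub_norm_le φ ψ

theorem testForm_sqrt_add {N : ℕ} {Ω : Opens (Euc N)} (L : TestOperator Ω)
    (hL : IsPositiveSymmetric L) (φ ψ : 𝓓(Ω, ℝ)) :
    √(testForm L (φ - ψ) (φ - ψ)) ≤ √(testForm L φ φ) + √(testForm L ψ ψ) := by
  let _ := @InnerProductSpace.Core.toSeminormedAddCommGroup ℝ 𝓓(Ω, ℝ) _ _ _ (testCore L hL)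
  exact norm_sub_le φ ψ

theorem IsFormApprox.sqrt_cauchy {N : ℕ} {Ω : Opens (Euc N)} {L : TestOperator Ω}
    {φ : ℕ → 𝓓(Ω, ℝ)} {u : L2 Ω} (h : IsFormApprox L φ u) {ε : ℝ} (hε : 0 < ε) :
    ∃ k : ℕ, ∀ m ≥ k, ∀ n ≥ k, √(testForm L (φ m - φ n) (φ m - φ n)) < ε := by
  obtain ⟨k, hk⟩ := h.2 (ε ^ 2) (by positivity)
  exact ⟨k, fun m hm n hn => (Real.sqrt_lt' hε).2 (hk m hm n hn)⟩

/-- Closability of the form. -/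
theorem IsFormApprox.tendsto_sub {N : ℕ} {Ω : Opens (Euc N)} {L : TestOperator Ω}
    (hL : IsPositiveSymmetric L) {φ ψ : ℕ → 𝓓(Ω, ℝ)} {u : L2 Ω}
    (hφ : IsFormApprox L φ u) (hψ : IsFormApprox L ψ u) :
    Tendsto (fun n => √(testForm L (φ n - ψ n) (φ n - ψ n))) atTop (𝓝 0) := by
  set μ := volume.restrict (Ω : Set (Euc N)) with hμ
  set d : ℕ → 𝓓(Ω, ℝ) := fun n => φ n - ψ n with hd
  have hdL : Tendsto (fun n => eLpNorm (d n) 2 μ) atTop (𝓝 0) := by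
    have hs : Tendsto (fun n => eLpNorm (fun x => φ n x - u x) 2 μ +
        eLpNorm (fun x => ψ n x - u x) 2 μ) atTop (𝓝 0) := by
      simpa using hφ.1.add hψ.1
    refine tendsto_of_tendsto_of_tendsto_of_le_of_le tendsto_const_nhds hs
      (fun _ => by simp) (fun n => ?_)
    have hfun : (d n : Euc N → ℝ) = (fun x => φ n x - u x) - (fun x => ψ n x - u x) := by
      ext x
      have : d n x = φ n x - ψ n x := rfl
      simp [this]
    rw [hfun]
    exact eLpNorm_sub_le (((testFunction_memLp (φ n)).sub (Lp.memLp u)).1)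
      (((testFunction_memLp (ψ n)).sub (Lp.memLp u)).1) (by norm_num)
  have hdC : ∀ ε : ℝ, 0 < ε → ∃ k, ∀ m ≥ k, ∀ n ≥ k,
      √(testForm L (d m - d n) (d m - d n)) < ε := by
    intro ε hε
    obtain ⟨k₁, h₁⟩ := hφ.sqrt_cauchy (half_pos hε)
    obtain ⟨k₂, h₂⟩ := hψ.sqrt_cauchy (half_pos hε)
    refine ⟨max k₁ k₂, fun m hm n hn => ?_⟩
    have e : d m - d n = (φ m - φ n) - (ψ m - ψ n) := by simp only [hd]; abel
    rw [e]
    have a := h₁ m (le_trans (le_max_left _ _) hm) n (le_trans (le_max_left _ _) hn)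
    have b := h₂ m (le_trans (le_max_right _ _) hm) n (le_trans (le_max_right _ _) hn)
    linarith [testForm_sqrt_add L hL (φ m - φ n) (ψ m - ψ n)]
  -- for fixed `m`, `B(d n, d m) → 0`
  have hlim : ∀ m, Tendsto (fun n => testForm L (d n) (d m)) atTop (𝓝 0) := by
    intro m
    have hb : Tendsto (fun n => (eLpNorm (d n) 2 μ * eLpNorm (L (d m)) 2 μ).toReal)
        atTop (𝓝 0) := by
      have h0 : Tendsto (fun n => eLpNorm (d n) 2 μ * eLpNorm (L (d m)) 2 μ) atTop (𝓝 0) := by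
        have := ENNReal.Tendsto.mul_const (b := eLpNorm (L (d m)) 2 μ) hdL
          (Or.inr (Lp.memLp (L (d m))).2.ne)
        simpa using this
      exact (ENNReal.tendsto_toReal (by simp : (0 : ℝ≥0∞) ≠ ∞)).comp h0
    refine squeeze_zero_norm (fun n => ?_) hb
    have hfin : eLpNorm (d n) 2 μ * eLpNorm (L (d m)) 2 μ ≠ ∞ :=
      ENNReal.mul_ne_top (testFunction_memLp (d n)).2.ne (Lp.memLp (L (d m))).2.ne
    have h1 : ‖testForm L (d n) (d m)‖ₑ ≤ eLpNorm (d n) 2 μ * eLpNorm (L (d m)) 2 μ := by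
      refine (enorm_integral_le_lintegral_enorm _).trans ?_
      rw [← eLpNorm_one_eq_lintegral_enorm]
      have := eLpNorm_smul_le_mul_eLpNorm (p := 2) (q := 2) (r := 1)
        (Lp.memLp (L (d m))).1 (testFunction_memLp (d n)).1
      exact this
    have := ENNReal.toReal_mono hfin h1
    simpa using this
  rw [Metric.tendsto_atTop]
  intro ε hε
  obtain ⟨k, hk⟩ := hdC (ε / 4) (by positivity)
  obtain ⟨k', hk'⟩ := (Metric.tendsto_atTop.1 (hlim k)) (ε ^ 2 / 4) (by positivity)
  refine ⟨max k k', fun n hn => ?_⟩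
  have hnk := le_trans (le_max_left _ _) hn
  have a := hk n hnk k le_rfl
  have b := hk' n (le_trans (le_max_right _ _) hn)
  rw [Real.dist_eq, sub_zero] at b ⊢
  have hsplit : testForm L (d n) (d n) = testForm L (d n) (d n - d k) + testForm L (d n) (d k) := by
    rw [hL.1 (d n) (d n), hL.1 (d n) (d n - d k), hL.1 (d n) (d k), ← testForm_add_left]
    congr 1; abel
  have hcs := testForm_cauchySchwarz L hL (d n) (d n - d k)
  set t := √(testForm L (d n) (d n)) with ht
  have ht0 : 0 ≤ t := Real.sqrt_nonneg _
  have htt : t ^ 2 = testForm L (d n) (d n) := Real.sq_sqrt (hL.2 _)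
  rw [abs_of_nonneg ht0]
  by_contra hcon
  push Not at hcon
  have h3 : t * √(testForm L (d n - d k) (d n - d k)) ≤ t * (ε / 4) :=
    mul_le_mul_of_nonneg_left a.le ht0
  have h4 := le_abs_self (testForm L (d n) (d n - d k))
  have h5 := le_abs_self (testForm L (d n) (d k))
  nlinarith

/-- `B(φ n, φ n)` converges to `energy L u` along every approximating sequence. -/
theorem energy_eq_of_tendsto {N : ℕ} {Ω : Opens (Euc N)} {L : TestOperator Ω}
    (hL : IsPositiveSymmetric L) {φ : ℕ → 𝓓(Ω, ℝ)} {u : L2 Ω} (hφ : IsFormApprox L φ u) :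
    Tendsto (fun n => testForm L (φ n) (φ n)) atTop (𝓝 (energy L u)) := by
  have hc : CauchySeq fun n => √(testForm L (φ n) (φ n)) := by
    rw [Metric.cauchySeq_iff]
    intro ε hε
    obtain ⟨k, hk⟩ := hφ.sqrt_cauchy hε
    exact ⟨k, fun m hm n hn => lt_of_le_of_lt (testForm_sqrt_sub L hL _ _) (hk m hm n hn)⟩
  obtain ⟨t, ht⟩ := cauchySeq_tendsto_of_complete hc
  have hB : ∀ χ : 𝓓(Ω, ℝ), √(testForm L χ χ) ^ 2 = testForm L χ χ :=
    fun χ => Real.sq_sqrt (hL.2 χ)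
  have hq : Tendsto (fun n => testForm L (φ n) (φ n)) atTop (𝓝 (t ^ 2)) := by
    simpa only [hB] using ht.pow 2
  have hset : {q : ℝ | ∃ ψ : ℕ → 𝓓(Ω, ℝ), IsFormApprox L ψ u ∧
      Tendsto (fun n => testForm L (ψ n) (ψ n)) atTop (𝓝 q)} = {t ^ 2} := by
    ext q
    constructor
    · rintro ⟨ψ, hψ, hψq⟩
      have hz : Tendsto (fun n => √(testForm L (φ n) (φ n)) - √(testForm L (ψ n) (ψ n)))
          atTop (𝓝 0) :=
        squeeze_zero_norm (fun n => testForm_sqrt_sub L hL _ _)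
          (IsFormApprox.tendsto_sub hL hφ hψ)
      have hψt : Tendsto (fun n => √(testForm L (ψ n) (ψ n))) atTop (𝓝 t) := by
        simpa using ht.sub hz
      have := hψt.pow 2
      simp only [hB] at this
      exact tendsto_nhds_unique hψq this
    · rintro rfl
      exact ⟨φ, hφ, hq⟩
  have : energy L u = t ^ 2 := by unfold energy; rw [hset, csInf_singleton]
  rw [this]; exact hq

/-- On test functions the energy is the original quadratic form. -/
theorem energy_toLp {N : ℕ} {Ω : Opens (Euc N)} {L : TestOperator Ω}
    (hL : IsPositiveSymmetric L) (φ : 𝓓(Ω, ℝ)) :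
    (testFunction_memLp φ).toLp φ ∈ formDomain L ∧
      energy L ((testFunction_memLp φ).toLp φ) = testForm L φ φ := by
  have h : IsFormApprox L (fun _ => φ) ((testFunction_memLp φ).toLp φ) := by
    constructor
    · have : eLpNorm (fun x => φ x - (testFunction_memLp φ).toLp φ x) 2
          (volume.restrict (Ω : Set (Euc N))) = 0 := by
        rw [eLpNorm_congr_ae (g := 0)]
        · simp
        · filter_upwards [(testFunction_memLp φ).coeFn_toLp] with x hx
          simp [hx]
      simp only [this]
      exact tendsto_const_nhds
    · intro ε hε
      refine ⟨0, fun m _ n _ => ?_⟩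
      have : testForm L (φ - φ) (φ - φ) = 0 := by simp [testForm]
      rw [this]; exact hε
  exact ⟨⟨_, h⟩, tendsto_nhds_unique (energy_eq_of_tendsto hL h) tendsto_const_nhds⟩

end

/-! The problem is recast as the integral equation `u = 𝔾[u^p] + λ h`, `h = 𝔾[μ]`, for functions
with values in `[0,∞]`. Testing with `δ^γ 1_E` shows that positive weak-dual solutions are, up to
null sets, the solutions of this equation with finite mass `∫ u^p δ^γ`
(`IsPositiveWeakDualSolution.exists_eq`, `isPositiveWeakDualSolution_of_eq`). Monotone iteration
from `0` stays below every supersolution, so `λ` is solvable exactly when its limit `minSol` has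
finite mass (`mem_solvableParams_iff`).

After division by `δ(x)^γ δ(y)^γ` the Green function is comparable with a kernel `k` such that `1/k`
is a quasi-metric, and `p < p^*` leaves room for a uniform integrability bound with exponent
slightly above `p` (`IsGreenFunction.exists_isGreenKernel`). Hence potentials lie in `L^p(δ^γ)` and
small `λ` are solvable. Conversely `g ≥ c δ^γ ⊗ δ^γ` forces `u ≥ c δ^γ (mass + λ)`, and `p > 1` then
bounds mass and `λ` together (`mass_le_of_super`). So `λ^*` is positive and finite, and since the
mass bound is uniform, the increasing limit `W` of the minimal solutions for `λ ↑ λ^*` is the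
minimal solution at `λ^*` (`iSup_minSol`).

Semi-stability: let `U ≤ U'` be the minimal solutions for parameters `l < l'`. By convexity `U' - U`
is a strict supersolution of the equation linearized at `U`. Schur's test with this supersolution
gives `∫ f 𝔾f ≤ ∫ f²/V`, `V = p U^(p-1)` (`lintegral_mul_kerOp_self_le_of_lt`). The duality `(∫ f
ξ)² ≤ ‖ξ‖² ∫ |f| 𝔾|f|`, with `f = V ξ`, turns this into `∫ V ξ² ≤ ‖ξ‖²` on the energy space
(`lintegral_mul_enorm_sq_le_energy`). Monotone convergence carries the inequality to `W`.

Optimality: suppose the inequality at `W` held with an extra factor `θ < 1`. Dualizing back, `f ↦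
𝔾[V f]`, now with `V = p W^(p-1)`, contracts `L²(V)` by the factor `θ`
(`lintegral_mul_kerOp_sq_le_of_energy`). To make this pointwise, note that `V` satisfies a Kato
condition (`kato`), and with the quasi-metric inequality each application removes a power `1/m` of
the singularity (`iterKer_le`). After `m` applications a potential is bounded by a multiple of
`δ^γ`, hence of `h`. So the iterates of `h` decay geometrically relative to `h`, and a Neumann
series solves `φ = h + τ 𝔾[V φ]` for some `τ > 1` with `φ ≤ C h`. For small `e > 0`, `W + e φ` is
then a supersolution for `λ^* + e`, contradicting the definition of `λ^*`
(`exists_mass_minSol_lt_top_of_contraction`). -/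

/-! ### Integral operators with nonnegative kernels -/

section KernelOperators

variable {X : Type*} [MeasurableSpace X]

/-- The potential `x ↦ ∫ g(x,y) dπ(y)` of a measure. -/
noncomputable def kerPot (g : X → X → ℝ≥0∞) (π : Measure X) (x : X) : ℝ≥0∞ := ∫⁻ y, g x y ∂π

/-- The integral operator `f ↦ ∫ g(·,y) f(y) dν(y)`. -/
noncomputable def kerOp (ν : Measure X) (g : X → X → ℝ≥0∞) (f : X → ℝ≥0∞) (x : X) : ℝ≥0∞ :=
  ∫⁻ y, g x y * f y ∂ν

variable {ν : Measure X} {g : X → X → ℝ≥0∞}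

theorem kerOp_mono_ae {f f' : X → ℝ≥0∞} (h : f ≤ᵐ[ν] f') (x : X) :
    kerOp ν g f x ≤ kerOp ν g f' x :=
  lintegral_mono_ae (h.mono fun _ hy => by gcongr)

theorem measurable_kerPot {π : Measure X} [SFinite π] (hg : Measurable (Function.uncurry g)) :
    Measurable (kerPot g π) :=
  hg.lintegral_prod_right'

theorem measurable_kerOp [SFinite ν] (hg : Measurable (Function.uncurry g)) {f : X → ℝ≥0∞}
    (hf : Measurable f) : Measurable (kerOp ν g f) :=
  (hg.mul (hf.comp measurable_snd)).lintegral_prod_right'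

theorem kerOp_eq_kerPot (hg : Measurable (Function.uncurry g)) {f : X → ℝ≥0∞} (hf : Measurable f)
    (x : X) : kerOp ν g f x = kerPot g (ν.withDensity f) x := by
  have h := lintegral_withDensity_eq_lintegral_mul ν hf (hg.of_uncurry_left (x := x))
  rw [kerPot, h]
  simp only [kerOp, Pi.mul_apply, mul_comm]

theorem kerOp_const_mul (hg : Measurable (Function.uncurry g)) {f : X → ℝ≥0∞} (hf : Measurable f)
    (c : ℝ≥0∞) (x : X) : kerOp ν g (fun y => c * f y) x = c * kerOp ν g f x := by
  have h := lintegral_const_mul (μ := ν) c (f := fun y => g x y * f y)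
    ((hg.of_uncurry_left (x := x)).mul hf)
  rw [kerOp, kerOp, ← h]
  congr 1; ext y; ring

theorem kerOp_add (hg : Measurable (Function.uncurry g)) {f f' : X → ℝ≥0∞} (hf : Measurable f)
    (x : X) : kerOp ν g (fun y => f y + f' y) x = kerOp ν g f x + kerOp ν g f' x := by
  unfold kerOp
  simp only [mul_add]
  exact lintegral_add_left ((hg.of_uncurry_left (x := x)).mul hf) _

theorem kerOp_iSup (hg : Measurable (Function.uncurry g)) {f : ℕ → X → ℝ≥0∞}
    (hf : ∀ n, Measurable (f n)) (hm : Monotone f) (x : X) :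
    kerOp ν g (fun y => ⨆ n, f n y) x = ⨆ n, kerOp ν g (f n) x := by
  unfold kerOp
  simp only [ENNReal.mul_iSup]
  exact lintegral_iSup (fun n => (hg.of_uncurry_left (x := x)).mul (hf n))
    (fun i j hij y => mul_le_mul_right (hm hij y) _)

theorem kerOp_tsum (hg : Measurable (Function.uncurry g)) {f : ℕ → X → ℝ≥0∞}
    (hf : ∀ n, Measurable (f n)) (x : X) :
    kerOp ν g (fun y => ∑' n, f n y) x = ∑' n, kerOp ν g (f n) x := by
  unfold kerOp
  simp only [← ENNReal.tsum_mul_left]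
  exact lintegral_tsum (fun n => ((hg.of_uncurry_left (x := x)).mul (hf n)).aemeasurable)

theorem lintegral_mul_kerOp_symm [SFinite ν] (hg : Measurable (Function.uncurry g))
    (hs : ∀ x y, g x y = g y x) {f φ : X → ℝ≥0∞} (hf : Measurable f) (hφ : Measurable φ) :
    ∫⁻ x, f x * kerOp ν g φ x ∂ν = ∫⁻ x, φ x * kerOp ν g f x ∂ν := by
  unfold kerOp
  have h1 : ∀ (a b : X → ℝ≥0∞), Measurable b → ∀ x,
      a x * ∫⁻ y, g x y * b y ∂ν = ∫⁻ y, a x * (g x y * b y) ∂ν :=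
    fun a b hb x => (lintegral_const_mul _ ((hg.of_uncurry_left (x := x)).mul hb)).symm
  simp only [h1 _ _ hf, h1 _ _ hφ]
  rw [lintegral_lintegral_swap]
  · congr 1; ext x; congr 1; ext y
    rw [hs y x]; ring
  · exact ((hf.comp measurable_fst).mul (hg.mul (hφ.comp measurable_snd))).aemeasurable

/-- Weighted Cauchy–Schwarz inequality. -/
theorem sq_lintegral_mul_le {a b w : X → ℝ≥0∞} (ha : Measurable a) (hb : Measurable b)
    (hw : Measurable w) (h0 : ∀ᵐ x ∂ν, w x ≠ 0) (ht : ∀ᵐ x ∂ν, w x ≠ ∞) :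
    (∫⁻ x, a x * b x ∂ν) ^ 2 ≤ (∫⁻ x, a x ^ 2 * w x ∂ν) * ∫⁻ x, b x ^ 2 * (w x)⁻¹ ∂ν := by
  have h := ENNReal.lintegral_mul_le_Lp_mul_Lq ν Real.HolderConjugate.two_two
    (f := fun x => a x * w x ^ (1 / 2 : ℝ)) (g := fun x => b x * (w x)⁻¹ ^ (1 / 2 : ℝ))
    (ha.mul (hw.pow_const _)).aemeasurable (hb.mul (hw.inv.pow_const _)).aemeasurable
  have e1 : ∫⁻ x, a x * b x ∂ν = ∫⁻ x, ((fun x => a x * w x ^ (1 / 2 : ℝ)) *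
      fun x => b x * (w x)⁻¹ ^ (1 / 2 : ℝ)) x ∂ν := by
    refine lintegral_congr_ae ?_
    filter_upwards [h0, ht] with x hx0 hxt
    simp only [Pi.mul_apply]
    have : w x ^ (1 / 2 : ℝ) * (w x)⁻¹ ^ (1 / 2 : ℝ) = 1 := by
      rw [← ENNReal.mul_rpow_of_nonneg _ _ (by norm_num), ENNReal.mul_inv_cancel hx0 hxt,
        ENNReal.one_rpow]
    calc a x * b x = a x * b x * (w x ^ (1 / 2 : ℝ) * (w x)⁻¹ ^ (1 / 2 : ℝ)) := by
          rw [this, mul_one]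
      _ = _ := by ring
  have e2 : ∀ c v : ℝ≥0∞, (c * v ^ (1 / 2 : ℝ)) ^ (2 : ℝ) = c ^ 2 * v := by
    intro c v
    rw [ENNReal.mul_rpow_of_nonneg _ _ (by norm_num), ← ENNReal.rpow_mul]
    norm_num
  have e3 : ∀ v : ℝ≥0∞, (v ^ (1 / 2 : ℝ)) ^ 2 = v := by
    intro v
    rw [← ENNReal.rpow_natCast, ← ENNReal.rpow_mul]
    norm_num
  rw [← e1] at h
  simp only [e2] at h
  calc _ ≤ _ := pow_le_pow_left' h 2
    _ = _ := by rw [mul_pow, e3, e3]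

/-- Weighted Cauchy–Schwarz for the measure `g(x,·) ν`, applied to `f · 1` with weight `1/φ`. This
is the pointwise half of Schur's test. -/
theorem kerOp_sq_le (hg : Measurable (Function.uncurry g))
    {f φ : X → ℝ≥0∞} (hf : Measurable f) (hφ : Measurable φ) (h0 : ∀ᵐ x ∂ν, φ x ≠ 0)
    (ht : ∀ᵐ x ∂ν, φ x ≠ ∞) (x : X) :
    kerOp ν g f x ^ 2 ≤ kerOp ν g (fun y => f y ^ 2 * (φ y)⁻¹) x * kerOp ν g φ x := by
  have hgx : Measurable (g x) := hg.of_uncurry_left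
  have hac := withDensity_absolutelyContinuous ν (g x)
  have key := sq_lintegral_mul_le (ν := ν.withDensity (g x)) (a := f) (b := fun _ => 1)
    (w := fun y => (φ y)⁻¹) hf measurable_const hφ.inv
    (hac.ae_le (ht.mono fun y hy => by simpa using hy))
    (hac.ae_le (h0.mono fun y hy => by simpa using hy))
  have e : ∀ F : X → ℝ≥0∞, Measurable F →
      ∫⁻ y, F y ∂(ν.withDensity (g x)) = kerOp ν g F x := fun F hF =>
    lintegral_withDensity_eq_lintegral_mul ν hgx hF
  simp only [mul_one, one_pow, one_mul, inv_inv] at key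
  have e' := e (fun y => f y ^ 2 * (φ y)⁻¹) ((hf.pow_const 2).mul hφ.inv)
  rwa [e _ hf, e', e _ hφ] at key

/-- Schur's test in weighted `L²` spaces. -/
theorem lintegral_mul_kerOp_sq_le [SFinite ν] (hg : Measurable (Function.uncurry g))
    (hs : ∀ x y, g x y = g y x) {f φ V : X → ℝ≥0∞} (hf : Measurable f) (hφ : Measurable φ)
    (h0 : ∀ᵐ x ∂ν, φ x ≠ 0) (ht : ∀ᵐ x ∂ν, φ x ≠ ∞)
    (hV0 : ∀ᵐ x ∂ν, V x ≠ 0) (hVt : ∀ᵐ x ∂ν, V x ≠ ∞)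
    (hφV : ∀ᵐ x ∂ν, V x * kerOp ν g φ x ≤ φ x) :
    ∫⁻ x, V x * kerOp ν g f x ^ 2 ∂ν ≤ ∫⁻ x, f x ^ 2 * (V x)⁻¹ ∂ν := by
  have hm : Measurable fun y => f y ^ 2 * (φ y)⁻¹ := (hf.pow_const 2).mul hφ.inv
  calc ∫⁻ x, V x * kerOp ν g f x ^ 2 ∂ν
      ≤ ∫⁻ x, φ x * kerOp ν g (fun y => f y ^ 2 * (φ y)⁻¹) x ∂ν := by
        refine lintegral_mono_ae ?_
        filter_upwards [hφV] with x hx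
        calc V x * kerOp ν g f x ^ 2
            ≤ V x * (kerOp ν g (fun y => f y ^ 2 * (φ y)⁻¹) x * kerOp ν g φ x) := by
              gcongr; exact kerOp_sq_le hg hf hφ h0 ht x
          _ = V x * kerOp ν g φ x * kerOp ν g (fun y => f y ^ 2 * (φ y)⁻¹) x := by ring
          _ ≤ _ := by gcongr
    -- Symmetry moves the operator onto `φ`, so that the supersolution property `V 𝔾φ ≤ φ` can be
    -- used a second time.
    _ = ∫⁻ x, f x ^ 2 * (φ x)⁻¹ * kerOp ν g φ x ∂ν := lintegral_mul_kerOp_symm hg hs hφ hm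
    _ ≤ _ := by
        refine lintegral_mono_ae ?_
        filter_upwards [hφV, h0, ht, hV0, hVt] with x hx hx0 hxt hv0 hvt
        have h1 : kerOp ν g φ x ≤ φ x * (V x)⁻¹ := by
          rw [← div_eq_mul_inv, ENNReal.le_div_iff_mul_le (Or.inl hv0) (Or.inl hvt), mul_comm]
          exact hx
        calc f x ^ 2 * (φ x)⁻¹ * kerOp ν g φ x ≤ f x ^ 2 * (φ x)⁻¹ * (φ x * (V x)⁻¹) := by gcongr
          _ = f x ^ 2 * (φ x * (φ x)⁻¹) * (V x)⁻¹ := by ring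
          _ = _ := by rw [ENNReal.mul_inv_cancel hx0 hxt, mul_one]

theorem ennreal_le_of_sq_le_mul {a b : ℝ≥0∞} (h : a ^ 2 ≤ b * b) : a ≤ b := by
  rw [← sq] at h
  exact (ENNReal.pow_le_pow_left_iff two_ne_zero).1 h

/-- Schur's test for the quadratic form. -/
theorem lintegral_mul_kerOp_self_le [SFinite ν] (hg : Measurable (Function.uncurry g))
    (hs : ∀ x y, g x y = g y x) {f φ V : X → ℝ≥0∞} (hf : Measurable f) (hφ : Measurable φ)
    (hV : Measurable V)
    (h0 : ∀ᵐ x ∂ν, φ x ≠ 0) (ht : ∀ᵐ x ∂ν, φ x ≠ ∞)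
    (hV0 : ∀ᵐ x ∂ν, V x ≠ 0) (hVt : ∀ᵐ x ∂ν, V x ≠ ∞)
    (hφV : ∀ᵐ x ∂ν, V x * kerOp ν g φ x ≤ φ x) :
    ∫⁻ x, f x * kerOp ν g f x ∂ν ≤ ∫⁻ x, f x ^ 2 * (V x)⁻¹ ∂ν := by
  -- Cauchy–Schwarz with weight `1/V` gives `(∫ f 𝔾f)² ≤ (∫ f²/V) (∫ V (𝔾f)²)`, and Schur's test
  -- bounds the second factor by the first. Infinite values do no harm.
  refine ennreal_le_of_sq_le_mul ?_
  have := sq_lintegral_mul_le (ν := ν) hf (measurable_kerOp (ν := ν) hg hf) hV.inv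
    (hVt.mono fun x hx => by simpa using hx) (hV0.mono fun x hx => by simpa using hx)
  refine this.trans (mul_le_mul_right (le_of_eq_of_le (lintegral_congr fun x => ?_)
    (lintegral_mul_kerOp_sq_le hg hs hf hφ h0 ht hV0 hVt hφV)) _)
  rw [Pi.inv_apply, inv_inv, mul_comm]

end KernelOperators

/-! ### Minimal solutions of `u = 𝔾[u^p] + λ h` -/

section MinimalSolution

variable {X : Type*} [MeasurableSpace X] {ν : Measure X} {g : X → X → ℝ≥0∞} {p : ℝ}
  {h : X → ℝ≥0∞}

/-- The monotone iteration for `u = 𝔾[u^p] + λ h`. -/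
noncomputable def minIter (ν : Measure X) (g : X → X → ℝ≥0∞) (p : ℝ) (h : X → ℝ≥0∞)
    (lam : ℝ≥0∞) : ℕ → X → ℝ≥0∞
  | 0 => fun _ => 0
  | n + 1 => fun x => kerOp ν g (fun y => minIter ν g p h lam n y ^ p) x + lam * h x

/-- The limit of the monotone iteration. -/
noncomputable def minSol (ν : Measure X) (g : X → X → ℝ≥0∞) (p : ℝ) (h : X → ℝ≥0∞)
    (lam : ℝ≥0∞) (x : X) : ℝ≥0∞ :=
  ⨆ n, minIter ν g p h lam n x

theorem measurable_minIter [SFinite ν] (hg : Measurable (Function.uncurry g)) (hh : Measurable h)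
    (lam : ℝ≥0∞) (n : ℕ) : Measurable (minIter ν g p h lam n) := by
  induction n with
  | zero => exact measurable_const
  | succ n ih => exact (measurable_kerOp hg (ih.pow_const p)).add (hh.const_mul lam)

theorem measurable_minSol [SFinite ν] (hg : Measurable (Function.uncurry g)) (hh : Measurable h)
    (lam : ℝ≥0∞) : Measurable (minSol ν g p h lam) :=
  Measurable.iSup fun n => measurable_minIter hg hh lam n

theorem monotone_minIter (hp : 0 ≤ p) (lam : ℝ≥0∞) : Monotone (minIter ν g p h lam) := by
  refine monotone_nat_of_le_succ fun n => ?_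
  induction n with
  | zero => exact fun x => zero_le
  | succ n ih =>
    intro x
    simp only [minIter]
    gcongr
    exact kerOp_mono_ae (ae_of_all _ fun y => ENNReal.rpow_le_rpow (ih y) hp) x

theorem ennreal_rpow_eq_rpow_sub_one_mul (hp : 1 ≤ p) (t : ℝ≥0∞) : t ^ p = t ^ (p - 1) * t := by
  conv_rhs => rw [← ENNReal.rpow_one t, ← ENNReal.rpow_mul, one_mul,
    ← ENNReal.rpow_add_of_nonneg _ _ (by linarith) zero_le_one]
  rw [sub_add_cancel]

theorem rpow_iSup_nat {f : ℕ → ℝ≥0∞} (hp : 0 < p) : (⨆ n, f n) ^ p = ⨆ n, f n ^ p :=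
  (ENNReal.orderIsoRpow p hp).map_iSup f

/-- A monotone limit of solutions of the iterated equations solves the limit equation. -/
theorem iSup_eq_kerOp_add (hg : Measurable (Function.uncurry g)) (hp : 0 < p)
    {v w : ℕ → X → ℝ≥0∞} {l : ℕ → ℝ≥0∞} (hv : ∀ n, Measurable (v n)) (hvm : Monotone v)
    (hl : Monotone l)
    (hw : ∀ n x, w n x = kerOp ν g (fun y => v n y ^ p) x + l n * h x) (x : X) :
    ⨆ n, w n x = kerOp ν g (fun y => (⨆ n, v n y) ^ p) x + (⨆ n, l n) * h x := by
  have e : (fun y => (⨆ n, v n y) ^ p) = fun y => ⨆ n, v n y ^ p := by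
    ext y; exact rpow_iSup_nat hp
  have hm : Monotone fun n y => v n y ^ p :=
    fun i j hij y => ENNReal.rpow_le_rpow (hvm hij y) hp.le
  rw [e, kerOp_iSup hg (fun n => (hv n).pow_const p) hm, ENNReal.iSup_mul,
    ENNReal.iSup_add_iSup_of_monotone]
  · simp only [hw]
  · exact fun i j hij => kerOp_mono_ae (ae_of_all _ (hm hij)) x
  · exact fun i j hij => mul_le_mul_left (hl hij) _

theorem minSol_eq [SFinite ν] (hg : Measurable (Function.uncurry g)) (hh : Measurable h)
    (hp : 0 < p) (lam : ℝ≥0∞) (x : X) :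
    minSol ν g p h lam x = kerOp ν g (fun y => minSol ν g p h lam y ^ p) x + lam * h x := by
  have key := iSup_eq_kerOp_add (h := h) (x := x) (ν := ν) (l := fun _ => lam)
    (v := minIter ν g p h lam) (w := fun n => minIter ν g p h lam (n + 1)) hg hp
    (measurable_minIter (ν := ν) hg hh lam) (monotone_minIter hp.le lam) monotone_const (fun n x => rfl)
  rw [iSup_const] at key
  -- Dropping the first term does not change the supremum, since the iteration is increasing.
  have e : minSol ν g p h lam x = ⨆ n, minIter ν g p h lam (n + 1) x := by
    refine le_antisymm (iSup_le fun n => ?_) (iSup_le fun n => le_iSup_of_le (n + 1) le_rfl)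
    exact le_iSup_of_le n (monotone_minIter hp.le lam n.le_succ x)
  rw [e, key]
  rfl

/-- Induction on the iterates: the right-hand side of the equation is monotone in `u` and
insensitive to null sets. Both minimality and the existence criteria by supersolutions come from
this comparison. -/
theorem minSol_le_of_super (hp : 0 ≤ p) {lam : ℝ≥0∞} {w : X → ℝ≥0∞}
    (hw : ∀ᵐ x ∂ν, kerOp ν g (fun y => w y ^ p) x + lam * h x ≤ w x) :
    ∀ᵐ x ∂ν, minSol ν g p h lam x ≤ w x := by
  have key : ∀ n, ∀ᵐ x ∂ν, minIter ν g p h lam n x ≤ w x := by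
    intro n
    induction n with
    | zero => exact ae_of_all _ fun x => zero_le
    | succ n ih =>
      filter_upwards [hw] with x hx
      refine le_trans ?_ hx
      simp only [minIter]
      gcongr
      exact kerOp_mono_ae (ih.mono fun y hy => ENNReal.rpow_le_rpow hy hp) x
  filter_upwards [ae_all_iff.2 key] with x hx
  exact iSup_le hx

theorem minSol_mono (hp : 0 ≤ p) : Monotone (minSol ν g p h) := by
  intro l l' hl x
  refine iSup_mono fun n => ?_
  induction n generalizing x with
  | zero => exact le_rfl
  | succ n ih =>
    simp only [minIter]
    gcongr
    exact kerOp_mono_ae (ae_of_all _ fun y => ENNReal.rpow_le_rpow (ih y) hp) x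

end MinimalSolution

/-! ### Kernels with Green-type two-sided bounds -/

section GreenKernel

variable {X : Type*} [MeasurableSpace X]

/-- Jensen's inequality in the form `(∫ f)^p ≤ π(X)^(p-1) ∫ f^p`. -/
theorem rpow_lintegral_le_measure_univ_mul {π : Measure X} {p : ℝ} (hp : 1 < p)
    {f : X → ℝ≥0∞} (hf : Measurable f) :
    (∫⁻ x, f x ∂π) ^ p ≤ π univ ^ (p - 1) * ∫⁻ x, f x ^ p ∂π := by
  have hc : p.HolderConjugate (p / (p - 1)) := Real.HolderConjugate.conjExponent hp
  have h := ENNReal.lintegral_mul_le_Lp_mul_Lq π hc hf.aemeasurable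
    (measurable_const (a := (1 : ℝ≥0∞))).aemeasurable
  have hp0 : 0 < p := by linarith
  have hp1 : 0 < p - 1 := by linarith
  simp only [Pi.mul_apply, mul_one, ENNReal.one_rpow, lintegral_const, one_mul] at h
  calc _ ≤ _ := ENNReal.rpow_le_rpow h hp0.le
    _ = _ := by
      rw [ENNReal.mul_rpow_of_nonneg _ _ hp0.le, ← ENNReal.rpow_mul, ← ENNReal.rpow_mul, mul_comm]
      congr 2
      · field_simp
      · rw [one_div_mul_cancel hp0.ne', ENNReal.rpow_one]

/-- A symmetric kernel `g` comparable with `d(x) d(y) k(x,y)`, where `1/k` is a bounded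
quasi-metric and `k` satisfies a uniform integrability condition of order `p (1 + 1/m)`. -/
structure IsGreenKernel (ν : Measure X) (g k : X → X → ℝ≥0∞) (d : X → ℝ≥0∞) (p : ℝ) (m : ℕ) :
    Prop where
  measurable_g : Measurable (Function.uncurry g)
  measurable_k : Measurable (Function.uncurry k)
  measurable_d : Measurable d
  symm_g : ∀ x y, g x y = g y x
  symm_k : ∀ x y, k x y = k y x
  min_le : ∃ Q : ℝ≥0∞, Q ≠ ∞ ∧ ∀ x y z, min (k x y) (k y z) ≤ Q * k x z
  upper : ∃ C : ℝ≥0∞, C ≠ ∞ ∧ ∀ x y, g x y ≤ C * (d x * d y * k x y)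
  lower : ∃ c : ℝ≥0∞, c ≠ 0 ∧ c ≠ ∞ ∧ ∀ x y, c * (d x * d y * k x y) ≤ g x y
  k_lower : ∃ κ : ℝ≥0∞, κ ≠ 0 ∧ κ ≠ ∞ ∧ ∀ x y, κ ≤ k x y
  d_ne_zero : ∀ᵐ x ∂ν, d x ≠ 0
  d_ne_top : ∀ x, d x ≠ ∞
  lintegral_d : ∫⁻ x, d x ∂ν ≠ ∞
  measure_ne_zero : ν ≠ 0
  integrability : ∃ M : ℝ≥0∞, M ≠ ∞ ∧
    ∀ z, ∫⁻ y, k y z ^ (p * (1 + 1 / m)) * d y ^ (p + 1) ∂ν ≤ M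

namespace IsGreenKernel

variable {ν : Measure X} {g k : X → X → ℝ≥0∞} {d : X → ℝ≥0∞} {p : ℝ} {m : ℕ}

/-- Since `k` is bounded below, its singularity can be discarded. The resulting rank-one minorant
plays the role of Hopf's lemma. -/
theorem lower' (H : IsGreenKernel ν g k d p m) :
    ∃ c : ℝ≥0∞, c ≠ 0 ∧ c ≠ ∞ ∧ ∀ x y, c * (d x * d y) ≤ g x y := by
  obtain ⟨c, hc0, hct, hc⟩ := H.lower
  obtain ⟨κ, hκ0, hκt, hκ⟩ := H.k_lower
  refine ⟨c * κ, mul_ne_zero hc0 hκ0, ENNReal.mul_ne_top hct hκt, fun x y => ?_⟩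
  refine le_trans ?_ (hc x y)
  calc c * κ * (d x * d y) = c * (d x * d y * κ) := by ring
    _ ≤ _ := by gcongr; exact hκ x y

/-- The extra power `p/m` of `k` is at least a positive constant, so it can be divided out. -/
theorem integrability' (H : IsGreenKernel ν g k d p m) (hp : 1 < p) :
    ∃ M : ℝ≥0∞, M ≠ ∞ ∧ ∀ z, ∫⁻ y, k y z ^ p * d y ^ (p + 1) ∂ν ≤ M := by
  obtain ⟨κ, hκ0, hκt, hκ⟩ := H.k_lower
  obtain ⟨M, hMt, hM⟩ := H.integrability
  have he : 0 ≤ p * (1 / m : ℝ) := by positivity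
  have hκ' : κ ^ (p * (1 / m : ℝ)) ≠ 0 := by
    simp [ENNReal.rpow_eq_zero_iff, hκ0, hκt]
  refine ⟨M / κ ^ (p * (1 / m : ℝ)), ENNReal.div_ne_top hMt hκ', fun z => ?_⟩
  rw [ENNReal.le_div_iff_mul_le (Or.inl hκ') (Or.inl (ENNReal.rpow_ne_top_of_nonneg he hκt)),
    mul_comm]
  refine (lintegral_const_mul_le _ _).trans ((lintegral_mono fun y => ?_).trans (hM z))
  rw [mul_add, mul_one, ENNReal.rpow_add_of_nonneg _ _ (by linarith) he]
  calc _ = κ ^ (p * (1 / m : ℝ)) * (k y z ^ p * d y ^ (p + 1)) := rfl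
    _ ≤ k y z ^ (p * (1 / m : ℝ)) * (k y z ^ p * d y ^ (p + 1)) := by
      gcongr; exact hκ y z
    _ = _ := by ring

/-- Potentials of measures of finite weighted mass belong to `L^p(d ν)`. -/
theorem lintegral_kerPot_rpow_le [SFinite ν] (H : IsGreenKernel ν g k d p m) (hp : 1 < p) :
    ∃ K : ℝ≥0∞, K ≠ ∞ ∧ ∀ (π : Measure X) [SFinite π],
      ∫⁻ x, kerPot g π x ^ p * d x ∂ν ≤ K * (∫⁻ x, d x ∂π) ^ p := by
  obtain ⟨C, hCt, hC⟩ := H.upper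
  obtain ⟨M, hMt, hM⟩ := H.integrability' hp
  have hp0 : 0 < p := by linarith
  refine ⟨C ^ p * M, ENNReal.mul_ne_top (ENNReal.rpow_ne_top_of_nonneg hp0.le hCt) hMt,
    fun π _ => ?_⟩
  -- With `d(z)` absorbed into the measure only `k(y,z)` remains. Jensen for `ρ` moves the power `p`
  -- inside at the cost of `ρ(X)^(p-1)`, and Tonelli leaves the integral that is bounded uniformly
  -- in the pole `z`.
  set ρ := π.withDensity d with hρ
  have hρu : ρ univ = ∫⁻ x, d x ∂π := by rw [hρ, withDensity_apply _ MeasurableSet.univ,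
    Measure.restrict_univ]
  have h1 : ∀ y, kerPot g π y ≤ C * d y * ∫⁻ z, k y z ∂ρ := by
    intro y
    have hk : Measurable (k y) := H.measurable_k.of_uncurry_left
    rw [hρ, lintegral_withDensity_eq_lintegral_mul π H.measurable_d hk,
      ← lintegral_const_mul _ (H.measurable_d.mul hk)]
    refine lintegral_mono fun z => (hC y z).trans (le_of_eq ?_)
    simp only [Pi.mul_apply]; ring
  have hkp : Measurable (Function.uncurry fun y z => k y z ^ p * d y ^ (p + 1)) :=
    (H.measurable_k.pow_const p).mul ((H.measurable_d.comp measurable_fst).pow_const _)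
  calc ∫⁻ x, kerPot g π x ^ p * d x ∂ν
      ≤ ∫⁻ y, (C ^ p * ρ univ ^ (p - 1)) * ∫⁻ z, k y z ^ p * d y ^ (p + 1) ∂ρ ∂ν := by
        refine lintegral_mono fun y => ?_
        have hk : Measurable (k y) := H.measurable_k.of_uncurry_left
        rw [lintegral_mul_const _ (hk.pow_const p)]
        calc kerPot g π y ^ p * d y ≤ (C * d y * ∫⁻ z, k y z ∂ρ) ^ p * d y := by
              gcongr; exact h1 y
          _ = C ^ p * (d y ^ p * d y) * (∫⁻ z, k y z ∂ρ) ^ p := by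
              rw [ENNReal.mul_rpow_of_nonneg _ _ hp0.le, ENNReal.mul_rpow_of_nonneg _ _ hp0.le]
              ring
          _ ≤ C ^ p * (d y ^ p * d y) * (ρ univ ^ (p - 1) * ∫⁻ z, k y z ^ p ∂ρ) := by
              gcongr; exact rpow_lintegral_le_measure_univ_mul hp hk
          _ = _ := by
              rw [ENNReal.rpow_add_of_nonneg _ _ hp0.le zero_le_one, ENNReal.rpow_one]; ring
    _ = (C ^ p * ρ univ ^ (p - 1)) * ∫⁻ z, ∫⁻ y, k y z ^ p * d y ^ (p + 1) ∂ν ∂ρ := by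
        have hi : Measurable fun y => ∫⁻ z, k y z ^ p * d y ^ (p + 1) ∂ρ :=
          hkp.lintegral_prod_right'
        rw [lintegral_const_mul _ hi, lintegral_lintegral_swap hkp.aemeasurable]
    _ ≤ (C ^ p * ρ univ ^ (p - 1)) * ∫⁻ _, M ∂ρ := by
        gcongr with z; exact hM z
    _ = C ^ p * M * (ρ univ ^ (p - 1) * ρ univ ^ (1 : ℝ)) := by
        rw [lintegral_const, ENNReal.rpow_one]; ring
    _ = _ := by
        rw [← ENNReal.rpow_add_of_nonneg _ _ (by linarith) zero_le_one, hρu]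
        congr 2; ring

/-- A priori bound: weighted masses of supersolutions and parameters are bounded. -/
theorem mass_le_of_super (H : IsGreenKernel ν g k d p m) (hp : 1 < p)
    {μ : Measure X} (hμ : ∫⁻ x, d x ∂μ = 1) :
    ∃ B : ℝ≥0∞, B ≠ ∞ ∧ ∀ (lam : ℝ≥0∞) (u : X → ℝ≥0∞), lam ≠ ∞ →
      (∀ᵐ x ∂ν, kerOp ν g (fun y => u y ^ p) x + lam * kerPot g μ x ≤ u x) →
      ∫⁻ x, u x ^ p * d x ∂ν ≠ ∞ → ∫⁻ x, u x ^ p * d x ∂ν + lam ≤ B := by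
  obtain ⟨c, hc0, hct, hc⟩ := H.lower'
  have hp0 : 0 < p := by linarith
  have hp1 : 0 < p - 1 := by linarith
  set I := ∫⁻ x, d x ^ (p + 1) ∂ν with hI
  have hI0 : I ≠ 0 := by
    rw [hI, Ne, lintegral_eq_zero_iff (H.measurable_d.pow_const _)]
    intro h0
    have : ∀ᵐ x ∂ν, False := by
      filter_upwards [h0, H.d_ne_zero] with x hx hx0
      simp only [Pi.zero_apply, ENNReal.rpow_eq_zero_iff] at hx
      rcases hx with hx | hx
      · exact hx0 hx.1
      · linarith [hx.2]
    exact H.measure_ne_zero (ae_eq_bot.1 (eventually_false_iff_eq_bot.1 this))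
  set c0 := c ^ p * I with hc0def
  have hcp0 : c ^ p ≠ 0 := by simp [ENNReal.rpow_eq_zero_iff, hc0, hct]
  have hcz : c0 ≠ 0 := mul_ne_zero hcp0 hI0
  refine ⟨c0⁻¹ ^ (p - 1)⁻¹, ENNReal.rpow_ne_top_of_nonneg (by positivity)
    (ENNReal.inv_ne_top.2 hcz), fun lam u hl hu hA => ?_⟩
  set A := ∫⁻ x, u x ^ p * d x ∂ν with hAdef
  set t := A + lam with ht
  have htt : t ≠ ∞ := ENNReal.add_ne_top.2 ⟨hA, hl⟩
  -- The minorant `c d(x) d(y)` of the kernel turns both terms of the equation into weighted masses: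
  -- `A` from `u^p` and `lam` from the normalized measure `μ`.
  have hlow : ∀ᵐ x ∂ν, c * d x * t ≤ u x := by
    filter_upwards [hu] with x hx
    refine le_trans ?_ hx
    rw [ht, mul_add]
    refine add_le_add ?_ ?_
    · refine (lintegral_const_mul_le _ _).trans (lintegral_mono fun y => ?_)
      calc c * d x * (u y ^ p * d y) = c * (d x * d y) * u y ^ p := by ring
        _ ≤ _ := by gcongr; exact hc x y
    · rw [mul_comm]
      gcongr
      calc c * d x = c * d x * ∫⁻ y, d y ∂μ := by rw [hμ, mul_one]
        _ ≤ ∫⁻ y, c * d x * d y ∂μ := lintegral_const_mul_le _ _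
        _ ≤ _ := lintegral_mono fun y => by rw [mul_assoc]; exact hc x y
  have hmain : c0 * t ^ p ≤ t := by
    calc c0 * t ^ p = ∫⁻ x, c ^ p * t ^ p * d x ^ (p + 1) ∂ν := by
          rw [lintegral_const_mul _ (H.measurable_d.pow_const _)]; ring
      _ ≤ A := by
          refine lintegral_mono_ae ?_
          filter_upwards [hlow] with x hx
          calc c ^ p * t ^ p * d x ^ (p + 1) = (c * d x * t) ^ p * d x := by
                rw [ENNReal.mul_rpow_of_nonneg _ _ hp0.le, ENNReal.mul_rpow_of_nonneg _ _ hp0.le,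
                  ENNReal.rpow_add_of_nonneg _ _ hp0.le zero_le_one, ENNReal.rpow_one]
                ring
            _ ≤ _ := by gcongr
      _ ≤ t := le_self_add
  rcases eq_or_ne t 0 with h0 | h0
  · rw [h0]; exact zero_le
  -- Superlinearity: `c0 t^p ≤ t` bounds `t` once one power of `t` is cancelled. This is where the
  -- finiteness of `A` and `lam` is needed.
  have h1 : t ^ (p - 1) ≤ c0⁻¹ := by
    rw [ENNReal.le_inv_iff_mul_le, mul_comm]
    rw [ennreal_rpow_eq_rpow_sub_one_mul hp.le, ← mul_assoc] at hmain
    have := ENNReal.div_le_div_right hmain t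
    rwa [mul_div_assoc, ENNReal.div_self h0 htt, mul_one] at this
  rwa [ENNReal.le_rpow_inv_iff hp1]

/-- For small parameters the monotone iteration stays bounded. -/
theorem exists_mass_minSol_lt_top [SFinite ν] (H : IsGreenKernel ν g k d p m) (hp : 1 < p)
    {μ : Measure X} [SFinite μ] (hμ : ∫⁻ x, d x ∂μ = 1) :
    ∃ lam : ℝ≥0∞, lam ≠ 0 ∧ lam ≠ ∞ ∧
      ∫⁻ x, minSol ν g p (kerPot g μ) lam x ^ p * d x ∂ν ≠ ∞ := by
  obtain ⟨K, hKt, hK⟩ := H.lintegral_kerPot_rpow_le hp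
  have hp0 : 0 < p := by linarith
  have hp1 : 0 < p - 1 := by linarith
  -- The threshold `lam` below satisfies `lam^(p-1) = 1/K'`, so that `K (2 lam)^p ≤ lam` and mass at
  -- most `lam` is preserved by the iteration. The summand `1` keeps `K'` nonzero.
  set K' : ℝ≥0∞ := K * 2 ^ p + 1 with hK'
  have hK't : K' ≠ ∞ := by
    refine ENNReal.add_ne_top.2 ⟨ENNReal.mul_ne_top hKt ?_, ENNReal.one_ne_top⟩
    exact ENNReal.rpow_ne_top_of_nonneg hp0.le (by norm_num)
  have hK'0 : K' ≠ 0 := by simp [hK']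
  set lam : ℝ≥0∞ := K'⁻¹ ^ (p - 1)⁻¹ with hlam
  have hl0 : lam ≠ 0 := by
    simp [hlam, ENNReal.rpow_eq_zero_iff, hK't, hK'0]
  have hlt : lam ≠ ∞ :=
    ENNReal.rpow_ne_top_of_nonneg (by positivity) (ENNReal.inv_ne_top.2 hK'0)
  have hstep : K * (lam + lam) ^ p ≤ lam := by
    have e : lam ^ p = K'⁻¹ * lam := by
      rw [ennreal_rpow_eq_rpow_sub_one_mul hp.le, hlam, ← ENNReal.rpow_mul, inv_mul_cancel₀ hp1.ne',
        ENNReal.rpow_one]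
    rw [← two_mul, ENNReal.mul_rpow_of_nonneg _ _ hp0.le, e]
    calc K * (2 ^ p * (K'⁻¹ * lam)) = K * 2 ^ p * K'⁻¹ * lam := by ring
      _ ≤ K' * K'⁻¹ * lam := by gcongr; exact le_self_add
      _ = lam := by rw [ENNReal.mul_inv_cancel hK'0 hK't, one_mul]
  have hmp : Measurable (kerPot g μ) := measurable_kerPot H.measurable_g
  have hmi := measurable_minIter (ν := ν) (p := p) H.measurable_g hmp lam
  have hit : ∀ n, ∫⁻ x, minIter ν g p (kerPot g μ) lam n x ^ p * d x ∂ν ≤ lam := by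
    intro n
    induction n with
    | zero => simp [minIter, ENNReal.zero_rpow_of_pos hp0]
    | succ n ih =>
      have hf := (hmi n).pow_const p
      -- Each iterate is the potential of one measure, of weighted mass at most `lam + lam` by the
      -- induction hypothesis.
      have e : ∀ x, minIter ν g p (kerPot g μ) lam (n + 1) x =
          kerPot g (ν.withDensity (fun y => minIter ν g p (kerPot g μ) lam n y ^ p) + lam • μ) x := by
        intro x
        simp only [minIter]
        rw [kerOp_eq_kerPot H.measurable_g hf]
        simp [kerPot, lintegral_add_measure]
      simp only [e]
      refine (hK _).trans (le_trans ?_ hstep)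
      rw [lintegral_add_measure, lintegral_smul_measure, hμ, smul_eq_mul, mul_one,
        lintegral_withDensity_eq_lintegral_mul _ hf H.measurable_d]
      gcongr
      exact ih
  refine ⟨lam, hl0, hlt, ne_top_of_le_ne_top hlt ?_⟩
  have e : ∀ x, minSol ν g p (kerPot g μ) lam x ^ p * d x =
      ⨆ n, minIter ν g p (kerPot g μ) lam n x ^ p * d x := by
    intro x
    rw [minSol, rpow_iSup_nat hp0, ENNReal.iSup_mul]
  simp only [e]
  have hmn : ∀ n, Measurable fun x => minIter ν g p (kerPot g μ) lam n x ^ p * d x :=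
    fun n => ((hmi n).pow_const p).mul H.measurable_d
  rw [lintegral_iSup hmn]
  · exact iSup_le hit
  · intro i j hij x
    exact mul_le_mul_left (ENNReal.rpow_le_rpow (monotone_minIter hp0.le lam hij x) hp0.le) _

end IsGreenKernel

end GreenKernel

/-! ### Power inequalities in `[0,∞]` -/

theorem ennreal_one_add_mul_le_rpow {p : ℝ} (hp : 1 ≤ p) (t : ℝ≥0∞) :
    1 + ENNReal.ofReal p * t ≤ (1 + t) ^ p := by
  induction t with
  | top => simp [ENNReal.top_rpow_of_pos (by linarith : 0 < p)]
  | coe t =>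
    have h := one_add_mul_self_le_rpow_one_add (s := (t : ℝ)) (by linarith [t.coe_nonneg]) hp
    have e1 : (1 : ℝ≥0∞) + t = ENNReal.ofReal (1 + t) := by
      rw [ENNReal.ofReal_add zero_le_one t.coe_nonneg]; simp
    rw [e1, ENNReal.ofReal_rpow_of_nonneg (by positivity) (by linarith)]
    refine le_trans (le_of_eq ?_) (ENNReal.ofReal_le_ofReal h)
    rw [ENNReal.ofReal_add zero_le_one (by positivity), ENNReal.ofReal_mul (by linarith)]
    simp

/-- Convexity: the power function lies above its tangent at `a`. Homogeneity reduces this to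
Bernoulli's inequality in `t/a`, with `a = 0` and `a = ∞` handled apart. -/
theorem ennreal_rpow_add_mul_le {p : ℝ} (hp : 1 < p) (a t : ℝ≥0∞) :
    a ^ p + ENNReal.ofReal p * a ^ (p - 1) * t ≤ (a + t) ^ p := by
  have hp0 : 0 < p := by linarith
  rcases eq_or_ne a 0 with rfl | h0
  · simp [ENNReal.zero_rpow_of_pos hp0, ENNReal.zero_rpow_of_pos (by linarith : 0 < p - 1)]
  rcases eq_or_ne a ∞ with rfl | ht
  · simp [ENNReal.top_rpow_of_pos hp0]
  have e : a + t = a * (1 + t / a) := by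
    rw [mul_add, mul_one, ENNReal.mul_div_cancel h0 ht]
  rw [e, ENNReal.mul_rpow_of_nonneg _ _ hp0.le]
  calc _ = a ^ p * (1 + ENNReal.ofReal p * (t / a)) := by
        rw [ennreal_rpow_eq_rpow_sub_one_mul hp.le a, mul_add, mul_one]
        congr 1
        conv_lhs => rw [← ENNReal.mul_div_cancel (b := t) h0 ht]
        ring
    _ ≤ _ := by gcongr; exact ennreal_one_add_mul_le_rpow hp.le _

/-- The derivative of `(1+s)^p` at `0` is `p < τ p`, so difference quotients stay below `τ p` near
`0`. -/
theorem exists_rpow_one_add_le {p τ : ℝ} (hp : 1 < p) (hτ : 1 < τ) :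
    ∃ s₀ : ℝ, 0 < s₀ ∧ ∀ s : ℝ, 0 ≤ s → s ≤ s₀ → (1 + s) ^ p ≤ 1 + τ * p * s := by
  have hd : HasDerivAt (fun s : ℝ => (1 + s) ^ p) p 0 := by
    have := ((hasDerivAt_id (0 : ℝ)).const_add 1).rpow_const (p := p) (Or.inl (by simp))
    simpa using this
  have hlt : p < τ * p := by nlinarith
  have := (hasDerivAt_iff_tendsto_slope.1 hd).eventually_lt_const hlt
  rw [eventually_nhdsWithin_iff, Metric.eventually_nhds_iff] at this
  obtain ⟨r, hr, h⟩ := this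
  refine ⟨r / 2, by positivity, fun s hs hsr => ?_⟩
  rcases hs.eq_or_lt with rfl | hs0
  · simp
  have h1 := h (y := s) (by rw [Real.dist_eq, sub_zero, abs_of_pos hs0]; linarith) hs0.ne'
  rw [slope_def_field, sub_zero, add_zero, Real.one_rpow, div_lt_iff₀ hs0] at h1
  linarith

/-- By homogeneity only the ratio `t/a` matters, so the threshold is uniform in `a`. It lets a
linear equation with coefficient enlarged by `τ` dominate the nonlinear increment. -/
theorem exists_ennreal_rpow_add_le {p : ℝ} (hp : 1 < p) {τ : ℝ≥0∞} (hτ : 1 < τ) (hτt : τ ≠ ∞) :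
    ∃ s₀ : ℝ≥0∞, s₀ ≠ 0 ∧ s₀ ≠ ∞ ∧ ∀ a t : ℝ≥0∞, t ≤ s₀ * a →
      (a + t) ^ p ≤ a ^ p + τ * (ENNReal.ofReal p * a ^ (p - 1) * t) := by
  have hp0 : 0 < p := by linarith
  obtain ⟨τ, rfl⟩ : ∃ r : ℝ, ENNReal.ofReal r = τ := ⟨τ.toReal, ENNReal.ofReal_toReal hτt⟩
  have hτ1 : 1 < τ := by
    rwa [← ENNReal.ofReal_one, ENNReal.ofReal_lt_ofReal_iff_of_nonneg zero_le_one] at hτ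
  obtain ⟨s₀, hs₀, h⟩ := exists_rpow_one_add_le hp hτ1
  refine ⟨ENNReal.ofReal s₀, by simpa using hs₀, ENNReal.ofReal_ne_top, fun a t hat => ?_⟩
  rcases eq_or_ne a 0 with rfl | ha0
  · simp only [mul_zero, nonpos_iff_eq_zero] at hat
    simp [hat, ENNReal.zero_rpow_of_pos hp0]
  rcases eq_or_ne a ∞ with rfl | hat'
  · simp [ENNReal.top_rpow_of_pos hp0]
  have htt : t ≠ ∞ := ne_top_of_le_ne_top (ENNReal.mul_ne_top ENNReal.ofReal_ne_top hat') hat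
  have hdt : t / a ≠ ∞ := ENNReal.div_ne_top htt ha0
  obtain ⟨s, hs, hse⟩ : ∃ s : ℝ, 0 ≤ s ∧ ENNReal.ofReal s = t / a :=
    ⟨(t / a).toReal, ENNReal.toReal_nonneg, ENNReal.ofReal_toReal hdt⟩
  have hss : s ≤ s₀ := by
    rw [← ENNReal.ofReal_le_ofReal_iff hs₀.le, hse]
    exact ENNReal.div_le_of_le_mul hat
  have e : a + t = a * (1 + t / a) := by
    rw [mul_add, mul_one, ENNReal.mul_div_cancel ha0 hat']
  rw [e, ENNReal.mul_rpow_of_nonneg _ _ hp0.le]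
  calc a ^ p * (1 + t / a) ^ p
      ≤ a ^ p * (1 + τ.toNNReal * ENNReal.ofReal p * (t / a)) := by
        gcongr
        rw [← hse, ← ENNReal.ofReal_one, ← ENNReal.ofReal_add zero_le_one hs,
          ENNReal.ofReal_rpow_of_nonneg (by positivity) hp0.le,
          show ((τ.toNNReal : ℝ≥0∞)) = ENNReal.ofReal τ from rfl,
          ← ENNReal.ofReal_mul (by linarith), ← ENNReal.ofReal_mul (by positivity),
          ← ENNReal.ofReal_add zero_le_one (by positivity)]
        exact ENNReal.ofReal_le_ofReal (h s hs hss)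
    _ = _ := by
        rw [ennreal_rpow_eq_rpow_sub_one_mul hp.le a, mul_add, mul_one]
        congr 1
        conv_rhs => rw [← ENNReal.mul_div_cancel (b := t) ha0 hat']
        rw [show ((τ.toNNReal : ℝ≥0∞)) = ENNReal.ofReal τ from rfl]
        ring

/-! ### The extremal and the linearized problem -/

namespace IsGreenKernel

variable {X : Type*} [MeasurableSpace X]
variable {ν : Measure X} {g k : X → X → ℝ≥0∞} {d : X → ℝ≥0∞} {p : ℝ} {m : ℕ}

theorem ae_ne_top_of_mass (H : IsGreenKernel ν g k d p m) (hp : 0 < p) {u : X → ℝ≥0∞}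
    (hu : AEMeasurable u ν) (hA : ∫⁻ x, u x ^ p * d x ∂ν ≠ ∞) : ∀ᵐ x ∂ν, u x ≠ ∞ := by
  filter_upwards [ae_lt_top' ((hu.pow_const p).mul H.measurable_d.aemeasurable) hA, H.d_ne_zero]
    with x hx hd hux
  rw [Pi.mul_apply, hux, ENNReal.top_rpow_of_pos hp, ENNReal.top_mul hd] at hx
  exact lt_irrefl _ hx

/-- The rank-one minorant of the kernel is integrated against `μ`, whose weighted mass is `1`. Thus
anything bounded by `d` is bounded by a multiple of `h`. -/
theorem exists_mul_le_kerPot (H : IsGreenKernel ν g k d p m) {μ : Measure X}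
    (hμ : ∫⁻ x, d x ∂μ = 1) :
    ∃ c : ℝ≥0∞, c ≠ 0 ∧ c ≠ ∞ ∧ ∀ x, c * d x ≤ kerPot g μ x := by
  obtain ⟨c, hc0, hct, hc⟩ := H.lower'
  refine ⟨c, hc0, hct, fun x => ?_⟩
  calc c * d x = c * d x * ∫⁻ y, d y ∂μ := by rw [hμ, mul_one]
    _ ≤ ∫⁻ y, c * d x * d y ∂μ := lintegral_const_mul_le _ _
    _ ≤ _ := lintegral_mono fun y => by rw [mul_assoc]; exact hc x y

theorem kerPot_ne_zero (H : IsGreenKernel ν g k d p m) {μ : Measure X}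
    (hμ : ∫⁻ x, d x ∂μ = 1) : ∀ᵐ x ∂ν, kerPot g μ x ≠ 0 := by
  obtain ⟨c, hc0, -, hc⟩ := H.exists_mul_le_kerPot hμ
  filter_upwards [H.d_ne_zero] with x hx h0
  have := hc x
  rw [h0, nonpos_iff_eq_zero] at this
  exact mul_ne_zero hc0 hx this

/-- The supremum of minimal solutions along a monotone sequence of parameters is the minimal
solution for the limiting parameter. -/
theorem iSup_minSol [SFinite ν] (H : IsGreenKernel ν g k d p m) (hp : 1 < p)
    {μ : Measure X} [SFinite μ] (hμ : ∫⁻ x, d x ∂μ = 1) {l : ℕ → ℝ≥0∞} (hl : Monotone l)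
    (hlt : ∀ n, l n ≠ ∞) (hA : ∀ n, ∫⁻ x, minSol ν g p (kerPot g μ) (l n) x ^ p * d x ∂ν ≠ ∞) :
    (∀ x, ⨆ n, minSol ν g p (kerPot g μ) (l n) x =
      kerOp ν g (fun y => (⨆ n, minSol ν g p (kerPot g μ) (l n) y) ^ p) x +
        (⨆ n, l n) * kerPot g μ x) ∧
    ∫⁻ x, (⨆ n, minSol ν g p (kerPot g μ) (l n) x) ^ p * d x ∂ν ≠ ∞ ∧
    ∀ v : X → ℝ≥0∞, (∀ᵐ x ∂ν, kerOp ν g (fun y => v y ^ p) x + (⨆ n, l n) * kerPot g μ x ≤ v x) →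
      ∀ᵐ x ∂ν, ⨆ n, minSol ν g p (kerPot g μ) (l n) x ≤ v x := by
  have hp0 : 0 < p := by linarith
  have hh : Measurable (kerPot g μ) := measurable_kerPot H.measurable_g
  have hms := measurable_minSol (ν := ν) (p := p) H.measurable_g hh
  have hmono : Monotone fun n => minSol ν g p (kerPot g μ) (l n) :=
    fun i j hij => minSol_mono hp0.le (hl hij)
  refine ⟨fun x => iSup_eq_kerOp_add H.measurable_g hp0 (fun n => hms (l n)) hmono hl
    (fun n x => minSol_eq H.measurable_g hh hp0 (l n) x) x, ?_, fun v hv => ?_⟩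
  -- The a priori bound does not depend on the parameter, so monotone convergence keeps the limiting
  -- mass finite.
  · obtain ⟨B, hBt, hB⟩ := H.mass_le_of_super hp hμ
    refine ne_top_of_le_ne_top hBt ?_
    have e : ∀ x, (⨆ n, minSol ν g p (kerPot g μ) (l n) x) ^ p * d x =
        ⨆ n, minSol ν g p (kerPot g μ) (l n) x ^ p * d x := by
      intro x; rw [rpow_iSup_nat hp0, ENNReal.iSup_mul]
    have hmn : ∀ n, Measurable fun x => minSol ν g p (kerPot g μ) (l n) x ^ p * d x :=
      fun n => ((hms (l n)).pow_const p).mul H.measurable_d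
    simp only [e]
    rw [lintegral_iSup hmn]
    · refine iSup_le fun n => le_self_add.trans (hB (l n) _ (hlt n) (ae_of_all _ fun x => ?_) (hA n))
      exact (minSol_eq H.measurable_g hh hp0 (l n) x).ge
    · intro i j hij x
      exact mul_le_mul_left (ENNReal.rpow_le_rpow (hmono hij x) hp0.le) _
  · have : ∀ n, ∀ᵐ x ∂ν, minSol ν g p (kerPot g μ) (l n) x ≤ v x := fun n =>
      minSol_le_of_super hp0.le (hv.mono fun x hx => le_trans (by gcongr; exact le_iSup l n) hx)
    filter_upwards [ae_all_iff.2 this] with x hx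
    exact iSup_le hx

/-- Stability of minimal solutions below the extremal parameter: the quadratic form of the Green
operator is controlled by the linearized potential. -/
theorem lintegral_mul_kerOp_self_le_of_lt [SFinite ν] (H : IsGreenKernel ν g k d p m) (hp : 1 < p)
    {μ : Measure X} [SFinite μ] (hμ : ∫⁻ x, d x ∂μ = 1) {l l' : ℝ≥0∞} (hl : l < l') (h0 : l ≠ 0)
    (hA : ∫⁻ x, minSol ν g p (kerPot g μ) l' x ^ p * d x ∂ν ≠ ∞)
    {f : X → ℝ≥0∞} (hf : Measurable f) :
    ∫⁻ x, f x * kerOp ν g f x ∂ν ≤ ∫⁻ x, f x ^ 2 *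
      (ENNReal.ofReal p * minSol ν g p (kerPot g μ) l x ^ (p - 1))⁻¹ ∂ν := by
  have hp0 : 0 < p := by linarith
  have hp1 : 0 < p - 1 := by linarith
  have hh : Measurable (kerPot g μ) := measurable_kerPot H.measurable_g
  set U := minSol ν g p (kerPot g μ) l with hU
  set U' := minSol ν g p (kerPot g μ) l' with hU'
  have hUm : Measurable U := measurable_minSol H.measurable_g hh l
  have hUm' : Measurable U' := measurable_minSol H.measurable_g hh l'
  have hle : ∀ x, U x ≤ U' x := minSol_mono hp0.le hl.le
  have hUt' := H.ae_ne_top_of_mass hp0 hUm'.aemeasurable hA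
  have hk0 := H.kerPot_ne_zero hμ
  have hUe : ∀ x, U x = _ := minSol_eq H.measurable_g hh hp0 l
  have hUe' : ∀ x, U' x = _ := minSol_eq H.measurable_g hh hp0 l'
  set V : X → ℝ≥0∞ := fun x => ENNReal.ofReal p * U x ^ (p - 1) with hV
  have hVm : Measurable V := (hUm.pow_const _).const_mul _
  have hP0 : ENNReal.ofReal p ≠ 0 := by simpa using hp0
  have hV0 : ∀ᵐ x ∂ν, V x ≠ 0 := by
    filter_upwards [hk0] with x hx hx0
    have hUx : U x ≠ 0 := by
      rw [hUe]
      exact fun h => mul_ne_zero h0 hx (add_eq_zero.1 h).2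
    rcases mul_eq_zero.1 hx0 with h | h
    · exact hP0 h
    · rw [ENNReal.rpow_eq_zero_iff] at h
      rcases h with h | h
      · exact hUx h.1
      · linarith [h.2]
  have hVt : ∀ᵐ x ∂ν, V x ≠ ∞ := by
    filter_upwards [hUt'] with x hx
    exact ENNReal.mul_ne_top ENNReal.ofReal_ne_top
      (ENNReal.rpow_ne_top_of_nonneg hp1.le (ne_top_of_le_ne_top hx (hle x)))
  -- Subtract the two equations and use convexity: `U'^p ≥ U^p + V (U' - U)`. Subtraction in `[0,∞]`
  -- is legitimate where `U'` is finite.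
  have hw : ∀ᵐ x ∂ν, kerOp ν g (fun y => V y * (U' y - U y)) x + (l' - l) * kerPot g μ x
      ≤ U' x - U x := by
    filter_upwards [hUt'] with x hx
    refine ENNReal.le_sub_of_add_le_left (ne_top_of_le_ne_top hx (hle x)) ?_
    conv_lhs => rw [hUe x]
    conv_rhs => rw [hUe' x]
    calc _ = (kerOp ν g (fun y => U y ^ p) x + kerOp ν g (fun y => V y * (U' y - U y)) x) +
            (l + (l' - l)) * kerPot g μ x := by ring
      _ = kerOp ν g (fun y => U y ^ p + V y * (U' y - U y)) x + l' * kerPot g μ x := by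
          rw [kerOp_add H.measurable_g (hUm.pow_const p), add_tsub_cancel_of_le hl.le]
      _ ≤ _ := by
          gcongr
          refine kerOp_mono_ae (ae_of_all _ fun y => ?_) x
          refine (ennreal_rpow_add_mul_le hp (U y) (U' y - U y)).trans (le_of_eq ?_)
          rw [add_tsub_cancel_of_le (hle y)]
  -- The strict gap `l < l'` makes the difference at least a positive multiple of `h`, so `φ = V (U'
  -- - U)` is an admissible weight in Schur's test.
  have hd0 : ∀ᵐ x ∂ν, U' x - U x ≠ 0 := by
    filter_upwards [hw, hk0] with x hx hkx h0'
    rw [h0', nonpos_iff_eq_zero] at hx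
    exact mul_ne_zero (tsub_pos_of_lt hl).ne' hkx (add_eq_zero.1 hx).2
  refine lintegral_mul_kerOp_self_le H.measurable_g H.symm_g hf
    (φ := fun y => V y * (U' y - U y)) (hVm.mul (hUm'.sub hUm)) hVm ?_ ?_ hV0 hVt ?_
  · filter_upwards [hV0, hd0] with x h1 h2 using mul_ne_zero h1 h2
  · filter_upwards [hVt, hUt'] with x h1 h2
    exact ENNReal.mul_ne_top h1 (ENNReal.sub_ne_top h2)
  · filter_upwards [hw] with x hx
    gcongr
    exact le_self_add.trans hx

end IsGreenKernel

/-! ### Iterated kernels -/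

section IteratedKernels

variable {X : Type*} [MeasurableSpace X] {ν : Measure X} {g : X → X → ℝ≥0∞} {V : X → ℝ≥0∞}

/-- The kernels of `(𝔾V)^n 𝔾`. -/
noncomputable def iterKer (ν : Measure X) (g : X → X → ℝ≥0∞) (V : X → ℝ≥0∞) : ℕ → X → X → ℝ≥0∞
  | 0 => g
  | n + 1 => fun x z => ∫⁻ y, g x y * (V y * iterKer ν g V n y z) ∂ν

/-- The linear operator `f ↦ 𝔾[V f]`. -/
noncomputable def linOp (ν : Measure X) (g : X → X → ℝ≥0∞) (V : X → ℝ≥0∞) (f : X → ℝ≥0∞) :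
    X → ℝ≥0∞ :=
  kerOp ν g fun y => V y * f y

theorem measurable_iterKer [SFinite ν] (hg : Measurable (Function.uncurry g)) (hV : Measurable V)
    (n : ℕ) : Measurable (Function.uncurry (iterKer ν g V n)) := by
  induction n with
  | zero => exact hg
  | succ n ih =>
    have : Measurable fun q : (X × X) × X =>
        g q.1.1 q.2 * (V q.2 * iterKer ν g V n q.2 q.1.2) :=
      (hg.comp (measurable_fst.fst.prodMk measurable_snd)).mul
        ((hV.comp measurable_snd).mul (ih.comp (measurable_snd.prodMk measurable_fst.snd)))
    exact this.lintegral_prod_right'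

theorem measurable_linOp_iterate [SFinite ν] (hg : Measurable (Function.uncurry g))
    (hV : Measurable V) {f : X → ℝ≥0∞} (hf : Measurable f) (n : ℕ) :
    Measurable ((linOp ν g V)^[n] f) := by
  induction n with
  | zero => exact hf
  | succ n ih =>
    rw [Function.iterate_succ_apply']
    exact measurable_kerOp hg (hV.mul ih)

theorem linOp_mono {f f' : X → ℝ≥0∞} (h : ∀ x, f x ≤ f' x) (x : X) :
    linOp ν g V f x ≤ linOp ν g V f' x :=
  kerOp_mono_ae (ae_of_all _ fun y => by gcongr; exact h y) x

theorem linOp_const_mul (hg : Measurable (Function.uncurry g)) (hV : Measurable V)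
    {f : X → ℝ≥0∞} (hf : Measurable f) (c : ℝ≥0∞) (x : X) :
    linOp ν g V (fun y => c * f y) x = c * linOp ν g V f x := by
  have h := kerOp_const_mul (ν := ν) (f := fun y => V y * f y) hg (hV.mul hf) c x
  rw [linOp, linOp, ← h]
  congr 1; ext y; ring

/-- Tonelli, applied inductively. It converts pointwise bounds on iterated kernels into bounds on
iterated potentials. -/
theorem linOp_iterate_kerPot [SFinite ν] (hg : Measurable (Function.uncurry g)) (hV : Measurable V)
    (π : Measure X) [SFinite π] (n : ℕ) :
    (linOp ν g V)^[n] (kerPot g π) = kerPot (iterKer ν g V n) π := by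
  induction n with
  | zero => rfl
  | succ n ih =>
    rw [Function.iterate_succ_apply', ih]
    ext x
    have hk := measurable_iterKer (ν := ν) hg hV n
    have hx : Measurable (g x) := hg.of_uncurry_left
    have hm : Measurable (Function.uncurry fun y z => g x y * (V y * iterKer ν g V n y z)) :=
      (hx.comp measurable_fst).mul ((hV.comp measurable_fst).mul hk)
    simp only [linOp, kerOp, kerPot, iterKer]
    rw [← lintegral_lintegral_swap hm.aemeasurable]
    refine lintegral_congr fun y => ?_
    have hky : Measurable (iterKer ν g V n y) := hk.of_uncurry_left
    rw [lintegral_const_mul _ (hky.const_mul _), lintegral_const_mul _ hky]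

end IteratedKernels

/-- Take the power `e` from the smaller of `a` and `b`, where it is controlled by `Q c`, and bound
what is left by the power `1 + ε` of the larger. With `a = k(x,y)`, `b = k(y,z)`, `c = k(x,z)` this
separates the two singularities in `y`. -/
theorem mul_rpow_le_of_min_le {a b c Q : ℝ≥0∞} {e ε : ℝ} (he : 0 ≤ e) (hε : 0 ≤ ε)
    (heε : e + ε ≤ 1) (h : min a b ≤ Q * c) :
    a * b ^ (e + ε) ≤ (Q * c) ^ e * (a ^ (1 + ε) + b ^ (1 + ε)) := by
  rcases le_total a b with hab | hab
  · rw [min_eq_left hab] at h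
    calc a * b ^ (e + ε) = a ^ e * (a ^ (1 - e) * b ^ (e + ε)) := by
          rw [← mul_assoc, ← ENNReal.rpow_add_of_nonneg _ _ he (by linarith),
            add_sub_cancel, ENNReal.rpow_one]
      _ ≤ (Q * c) ^ e * (b ^ (1 - e) * b ^ (e + ε)) := by
          gcongr; linarith
      _ = (Q * c) ^ e * b ^ (1 + ε) := by
          rw [← ENNReal.rpow_add_of_nonneg _ _ (by linarith) (by linarith)]
          congr 2; ring
      _ ≤ _ := by gcongr; exact le_add_self
  · rw [min_eq_right hab] at h
    calc a * b ^ (e + ε) = b ^ e * (a * b ^ ε) := by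
          rw [ENNReal.rpow_add_of_nonneg _ _ he hε]; ring
      _ ≤ (Q * c) ^ e * (a * a ^ ε) := by gcongr
      _ = (Q * c) ^ e * a ^ (1 + ε) := by
          rw [ENNReal.rpow_add_of_nonneg _ _ zero_le_one hε, ENNReal.rpow_one]
      _ ≤ _ := by gcongr; exact le_self_add

namespace IsGreenKernel

variable {X : Type*} [MeasurableSpace X]
variable {ν : Measure X} {g k : X → X → ℝ≥0∞} {d : X → ℝ≥0∞} {p : ℝ} {m : ℕ} {V : X → ℝ≥0∞}

/-- The linearized potential of a function of finite weighted mass satisfies a Kato condition. -/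
theorem kato (H : IsGreenKernel ν g k d p m) (hp : 1 < p) {u : X → ℝ≥0∞}
    (hu : Measurable u) (hA : ∫⁻ x, u x ^ p * d x ∂ν ≠ ∞) :
    ∃ W : ℝ≥0∞, W ≠ ∞ ∧ ∀ z, ∫⁻ y, k y z ^ (1 + 1 / m : ℝ) *
      (ENNReal.ofReal p * u y ^ (p - 1) * d y ^ 2) ∂ν ≤ W := by
  obtain ⟨M, hMt, hM⟩ := H.integrability
  have hp0 : 0 < p := by linarith
  have hp1 : 0 < p - 1 := by linarith
  have hc : p.HolderConjugate (p / (p - 1)) := Real.HolderConjugate.conjExponent hp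
  set q := p / (p - 1) with hq
  have hq0 : 0 < q := hc.symm.pos
  have h1q : (0 : ℝ) ≤ 1 / q := by positivity
  have h1p : (0 : ℝ) ≤ 1 / p := by positivity
  refine ⟨ENNReal.ofReal p * (M ^ (1 / p) * (∫⁻ x, u x ^ p * d x ∂ν) ^ (1 / q)),
    ENNReal.mul_ne_top ENNReal.ofReal_ne_top (ENNReal.mul_ne_top
      (ENNReal.rpow_ne_top_of_nonneg h1p hMt) (ENNReal.rpow_ne_top_of_nonneg h1q hA)), fun z => ?_⟩
  have hkz : Measurable fun y => k y z := H.measurable_k.of_uncurry_right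
  -- Hölder with `d² = d · d^(1/p) · d^(1/q)`: the `p`-th power of the first factor is the integrand
  -- of `H.integrability`, and the `q`-th power of the second is `u^p d`.
  have key := ENNReal.lintegral_mul_le_Lp_mul_Lq ν hc
    (f := fun y => k y z ^ (1 + 1 / m : ℝ) * d y * d y ^ (1 / p))
    (g := fun y => u y ^ (p - 1) * d y ^ (1 / q))
    (((hkz.pow_const _).mul H.measurable_d).mul (H.measurable_d.pow_const _)).aemeasurable
    ((hu.pow_const _).mul (H.measurable_d.pow_const _)).aemeasurable
  have e1 : ∀ y, (k y z ^ (1 + 1 / m : ℝ) * d y * d y ^ (1 / p)) ^ p =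
      k y z ^ (p * (1 + 1 / m : ℝ)) * d y ^ (p + 1) := by
    intro y
    rw [ENNReal.mul_rpow_of_nonneg _ _ hp0.le, ENNReal.mul_rpow_of_nonneg _ _ hp0.le,
      ← ENNReal.rpow_mul, ← ENNReal.rpow_mul, one_div_mul_cancel hp0.ne', ENNReal.rpow_one,
      ENNReal.rpow_add_of_nonneg _ _ hp0.le zero_le_one, ENNReal.rpow_one, mul_comm p]
    ring
  have e2 : ∀ y, (u y ^ (p - 1) * d y ^ (1 / q)) ^ q = u y ^ p * d y := by
    intro y
    rw [ENNReal.mul_rpow_of_nonneg _ _ hq0.le, ← ENNReal.rpow_mul, ← ENNReal.rpow_mul,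
      one_div_mul_cancel hq0.ne', ENNReal.rpow_one, hq, mul_div_cancel₀ _ hp1.ne']
  simp only [e1, e2] at key
  have hdd : ∀ y, d y ^ (1 / p) * d y ^ (1 / q) = d y := by
    intro y
    rw [← ENNReal.rpow_add_of_nonneg _ _ h1p h1q, one_div, one_div, hc.inv_add_inv_eq_one,
      ENNReal.rpow_one]
  have e3 : ∀ y, k y z ^ (1 + 1 / m : ℝ) * (ENNReal.ofReal p * u y ^ (p - 1) * d y ^ 2) =
      ENNReal.ofReal p * ((fun y => k y z ^ (1 + 1 / m : ℝ) * d y * d y ^ (1 / p)) *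
        fun y => u y ^ (p - 1) * d y ^ (1 / q)) y := by
    intro y
    simp only [Pi.mul_apply]
    calc _ = ENNReal.ofReal p * (k y z ^ (1 + 1 / m : ℝ) * d y * u y ^ (p - 1) * d y) := by ring
      _ = ENNReal.ofReal p * (k y z ^ (1 + 1 / m : ℝ) * d y * u y ^ (p - 1) *
          (d y ^ (1 / p) * d y ^ (1 / q))) := by rw [hdd]
      _ = _ := by ring
  simp only [e3]
  rw [lintegral_const_mul' _ _ ENNReal.ofReal_ne_top]
  gcongr
  refine key.trans ?_
  gcongr
  exact hM z

/-- The iterated kernels gain a power of the singularity at each step. -/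
theorem iterKer_le (H : IsGreenKernel ν g k d p m) (hm : m ≠ 0) (hV : Measurable V)
    {W : ℝ≥0∞} (hWt : W ≠ ∞)
    (hW : ∀ z, ∫⁻ y, k y z ^ (1 + 1 / m : ℝ) * (V y * d y ^ 2) ∂ν ≤ W) (j : ℕ) (hj : j ≤ m) :
    ∃ C : ℝ≥0∞, C ≠ ∞ ∧ ∀ x z, iterKer ν g V j x z ≤ C * (d x * d z * k x z ^ (1 - j / m : ℝ)) := by
  obtain ⟨C₀, hC₀t, hC₀⟩ := H.upper
  obtain ⟨Q, hQt, hQ⟩ := H.min_le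
  have hm0 : (0 : ℝ) < m := by positivity
  induction j with
  | zero => exact ⟨C₀, hC₀t, fun x z => by simpa [iterKer] using hC₀ x z⟩
  | succ j ih =>
    obtain ⟨C, hCt, hC⟩ := ih (by omega)
    -- The induction hypothesis has exponent `e + 1/m`. Here `e` is transferred to `k(x,z)`, while
    -- the surplus `1/m` yields the power `1 + 1/m` in the Kato integral.
    set e : ℝ := 1 - (j + 1 : ℕ) / m with he
    have hjm : ((j + 1 : ℕ) : ℝ) / m ≤ 1 := by
      rw [div_le_one hm0]; exact_mod_cast hj
    have he0 : 0 ≤ e := by linarith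
    have hee : (1 - j / m : ℝ) = e + 1 / m := by
      rw [he]; push_cast; field_simp; ring
    have hee1 : e + 1 / m ≤ 1 := by
      rw [← hee]
      have : (0 : ℝ) ≤ j / m := by positivity
      linarith
    have hε : (0 : ℝ) ≤ 1 / m := by positivity
    refine ⟨C₀ * C * Q ^ e * (W + W), ENNReal.mul_ne_top (ENNReal.mul_ne_top
      (ENNReal.mul_ne_top hC₀t hCt) (ENNReal.rpow_ne_top_of_nonneg he0 hQt))
      (ENNReal.add_ne_top.2 ⟨hWt, hWt⟩), fun x z => ?_⟩
    have hkm : ∀ z, Measurable fun y => k y z ^ (1 + 1 / m : ℝ) * (V y * d y ^ 2) := fun z => by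
      have hkz : Measurable fun y => k y z := H.measurable_k.of_uncurry_right
      exact (hkz.pow_const _).mul (hV.mul (H.measurable_d.pow_const 2))
    calc iterKer ν g V (j + 1) x z
        ≤ ∫⁻ y, (C₀ * C * Q ^ e * (d x * d z * k x z ^ e)) *
            (k y x ^ (1 + 1 / m : ℝ) * (V y * d y ^ 2) +
              k y z ^ (1 + 1 / m : ℝ) * (V y * d y ^ 2)) ∂ν := by
          refine lintegral_mono fun y => ?_
          calc g x y * (V y * iterKer ν g V j y z)
              ≤ C₀ * (d x * d y * k x y) * (V y * (C * (d y * d z * k y z ^ (e + 1 / m)))) := by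
                gcongr
                · exact hC₀ x y
                · rw [← hee]; exact hC y z
            _ = C₀ * C * (d x * d z) * (V y * d y ^ 2) * (k x y * k y z ^ (e + 1 / m)) := by ring
            _ ≤ C₀ * C * (d x * d z) * (V y * d y ^ 2) * ((Q * k x z) ^ e *
                  (k x y ^ (1 + 1 / m : ℝ) + k y z ^ (1 + 1 / m : ℝ))) := by
                refine mul_le_mul_right ?_ _
                exact mul_rpow_le_of_min_le he0 hε hee1 (hQ x y z)
            _ = _ := by
                rw [ENNReal.mul_rpow_of_nonneg _ _ he0, H.symm_k x y]; ring
      _ ≤ (C₀ * C * Q ^ e * (d x * d z * k x z ^ e)) * (W + W) := by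
          have hkk : Measurable fun y => k y x ^ (1 + 1 / m : ℝ) * (V y * d y ^ 2) +
              k y z ^ (1 + 1 / m : ℝ) * (V y * d y ^ 2) := (hkm x).add (hkm z)
          rw [lintegral_const_mul _ hkk, lintegral_add_left (hkm x)]
          gcongr
          · exact hW x
          · exact hW z
      _ = _ := by ring

/-- One iteration gives a kernel of order `k^(1-1/m)`. This is at most a multiple of `k`, since `k`
is bounded below, and hence of `g`. -/
theorem linOp_kerPot_le [SFinite ν] (H : IsGreenKernel ν g k d p m) (hm : m ≠ 0)
    (hV : Measurable V) {W : ℝ≥0∞} (hWt : W ≠ ∞)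
    (hW : ∀ z, ∫⁻ y, k y z ^ (1 + 1 / m : ℝ) * (V y * d y ^ 2) ∂ν ≤ W) :
    ∃ C : ℝ≥0∞, C ≠ ∞ ∧ ∀ (π : Measure X) [SFinite π], ∀ x,
      linOp ν g V (kerPot g π) x ≤ C * kerPot g π x := by
  obtain ⟨C, hCt, hC⟩ := H.iterKer_le hm hV hWt hW 1 (by omega)
  obtain ⟨c, hc0, hct, hc⟩ := H.lower
  obtain ⟨κ, hκ0, hκt, hκ⟩ := H.k_lower
  have hε : (0 : ℝ) ≤ 1 / m := by positivity
  have hm1 : (1 / m : ℝ) ≤ 1 := by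
    rw [div_le_one (by positivity)]; exact_mod_cast Nat.one_le_iff_ne_zero.2 hm
  set κ' := κ ^ (1 / m : ℝ) with hκ'
  have hκ'0 : κ' ≠ 0 := by simp [hκ', ENNReal.rpow_eq_zero_iff, hκ0, hκt]
  have hκ't : κ' ≠ ∞ := ENNReal.rpow_ne_top_of_nonneg hε hκt
  refine ⟨C / (c * κ'), ENNReal.div_ne_top hCt (mul_ne_zero hc0 hκ'0), fun π _ x => ?_⟩
  have hg : Measurable (g x) := H.measurable_g.of_uncurry_left
  have h := congrFun (linOp_iterate_kerPot (ν := ν) H.measurable_g hV π 1) x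
  rw [Function.iterate_one] at h
  rw [h, kerPot, kerPot, ← lintegral_const_mul _ hg]
  refine lintegral_mono fun z => (hC x z).trans ?_
  rw [Nat.cast_one]
  have h1 : c * κ' * (d x * d z * k x z ^ (1 - 1 / m : ℝ)) ≤ g x z := by
    refine le_trans ?_ (hc x z)
    calc c * κ' * (d x * d z * k x z ^ (1 - 1 / m : ℝ))
        = c * (d x * d z * (κ' * k x z ^ (1 - 1 / m : ℝ))) := by ring
      _ ≤ c * (d x * d z * (k x z ^ (1 / m : ℝ) * k x z ^ (1 - 1 / m : ℝ))) := by
          gcongr; exact ENNReal.rpow_le_rpow (hκ x z) hε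
      _ = _ := by
          rw [← ENNReal.rpow_add_of_nonneg _ _ hε (by linarith), add_sub_cancel, ENNReal.rpow_one]
  have h2 := mul_le_mul_right h1 (C / (c * κ'))
  rwa [← mul_assoc, ENNReal.div_mul_cancel (mul_ne_zero hc0 hκ'0) (ENNReal.mul_ne_top hct hκ't)]
    at h2

/-- At step `m` the exponent `1 - m/m` vanishes: the kernel has no singularity left and is bounded
by `C d(x) d(z)`. -/
theorem linOp_iterate_kerPot_le [SFinite ν] (H : IsGreenKernel ν g k d p m) (hm : m ≠ 0)
    (hV : Measurable V) {W : ℝ≥0∞} (hWt : W ≠ ∞)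
    (hW : ∀ z, ∫⁻ y, k y z ^ (1 + 1 / m : ℝ) * (V y * d y ^ 2) ∂ν ≤ W) :
    ∃ C : ℝ≥0∞, C ≠ ∞ ∧ ∀ (π : Measure X) [SFinite π], ∀ x,
      (linOp ν g V)^[m] (kerPot g π) x ≤ C * d x * ∫⁻ z, d z ∂π := by
  obtain ⟨C, hCt, hC⟩ := H.iterKer_le hm hV hWt hW m le_rfl
  refine ⟨C, hCt, fun π _ x => ?_⟩
  rw [linOp_iterate_kerPot H.measurable_g hV, ← lintegral_const_mul _ H.measurable_d]
  refine lintegral_mono fun z => (hC x z).trans (le_of_eq ?_)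
  rw [div_self (by exact_mod_cast hm), sub_self, ENNReal.rpow_zero]
  ring

end IsGreenKernel

/-! ### Continuation beyond a strictly stable solution -/

section

variable {X : Type*} [MeasurableSpace X] {ν : Measure X} {g : X → X → ℝ≥0∞} {V : X → ℝ≥0∞}

/-- Substituting `V f` for `f` in the hypothesis turns `f²/V` into `V f²`, so `f ↦ 𝔾[V f]` contracts
`L²(V)` by the factor `θ` at each step. -/
theorem lintegral_mul_linOp_iterate_sq_le [SFinite ν] (hg : Measurable (Function.uncurry g))
    (hV : Measurable V) (hV0 : ∀ᵐ x ∂ν, V x ≠ 0) (hVt : ∀ᵐ x ∂ν, V x ≠ ∞) {θ : ℝ≥0∞}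
    (hc : ∀ f : X → ℝ≥0∞, Measurable f →
      ∫⁻ x, V x * kerOp ν g f x ^ 2 ∂ν ≤ θ ^ 2 * ∫⁻ x, f x ^ 2 * (V x)⁻¹ ∂ν)
    {f : X → ℝ≥0∞} (hf : Measurable f) (n : ℕ) :
    ∫⁻ x, V x * (linOp ν g V)^[n] f x ^ 2 ∂ν ≤ (θ ^ n) ^ 2 * ∫⁻ x, V x * f x ^ 2 ∂ν := by
  induction n with
  | zero => simp
  | succ n ih =>
    simp only [Function.iterate_succ_apply']
    have hm := measurable_linOp_iterate (ν := ν) hg hV hf n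
    refine (hc (fun y => V y * (linOp ν g V)^[n] f y) (hV.mul hm)).trans ?_
    have e : ∫⁻ x, (V x * (linOp ν g V)^[n] f x) ^ 2 * (V x)⁻¹ ∂ν =
        ∫⁻ x, V x * (linOp ν g V)^[n] f x ^ 2 ∂ν := by
      refine lintegral_congr_ae ?_
      filter_upwards [hV0, hVt] with x h0 ht
      calc _ = V x * (V x)⁻¹ * (V x * (linOp ν g V)^[n] f x ^ 2) := by ring
        _ = _ := by rw [ENNReal.mul_inv_cancel h0 ht, one_mul]
    rw [e]
    calc _ ≤ θ ^ 2 * ((θ ^ n) ^ 2 * ∫⁻ x, V x * f x ^ 2 ∂ν) := by gcongr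
      _ = _ := by ring

/-- If the iterates of `h` decay geometrically up to multiples of `h`, a Neumann series produces a
solution of `φ = h + τ 𝔾[V φ]` that is bounded by a multiple of `h`. -/
theorem exists_neumann_series [SFinite ν] (hg : Measurable (Function.uncurry g))
    (hV : Measurable V) {h : X → ℝ≥0∞} (hh : Measurable h) {C₁ C₂ θ τ : ℝ≥0∞} {M : ℕ}
    (hC₁t : C₁ ≠ ∞) (hC₂t : C₂ ≠ ∞) (hτt : τ ≠ ∞) (hτθ : τ * θ < 1)
    (h₁ : ∀ n x, (linOp ν g V)^[n] h x ≤ C₁ ^ n * h x)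
    (h₂ : ∀ n x, (linOp ν g V)^[n + M] h x ≤ C₂ * θ ^ n * h x) :
    ∃ φ : X → ℝ≥0∞, Measurable φ ∧ (∀ x, φ x = h x + τ * linOp ν g V φ x) ∧
      ∃ C : ℝ≥0∞, C ≠ ∞ ∧ ∀ x, φ x ≤ C * h x := by
  have hm := measurable_linOp_iterate (ν := ν) hg hV hh
  -- In the bound by `h`, the first `M` terms are estimated crudely by `h₁`; from `M` on, `h₂` gives
  -- a geometric series of ratio `τ θ < 1`.
  refine ⟨fun x => ∑' n, τ ^ n * (linOp ν g V)^[n] h x,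
    Measurable.tsum fun n => (hm n).const_mul _, fun x => ?_,
    ∑ n ∈ Finset.range M, (τ * C₁) ^ n + τ ^ M * C₂ * (1 - τ * θ)⁻¹, ?_, fun x => ?_⟩
  · beta_reduce
    rw [tsum_eq_zero_add' ENNReal.summable]
    simp only [pow_zero, one_mul, Function.iterate_zero, id_eq]
    congr 1
    have e : linOp ν g V (fun x => ∑' n, τ ^ n * (linOp ν g V)^[n] h x) x =
        ∑' n, τ ^ n * (linOp ν g V)^[n + 1] h x := by
      have := kerOp_tsum (ν := ν) (f := fun n y => V y * (τ ^ n * (linOp ν g V)^[n] h y)) hg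
        (fun n => hV.mul ((hm n).const_mul _)) x
      simp only [ENNReal.tsum_mul_left] at this
      rw [linOp, this]
      refine tsum_congr fun n => ?_
      rw [Function.iterate_succ_apply', ← linOp_const_mul hg hV (hm n)]
      rfl
    rw [e, ← ENNReal.tsum_mul_left]
    refine tsum_congr fun n => ?_
    ring
  · refine ENNReal.add_ne_top.2 ⟨?_, ?_⟩
    · refine ENNReal.sum_ne_top.2 fun n _ => ENNReal.pow_ne_top (ENNReal.mul_ne_top hτt hC₁t)
    · refine ENNReal.mul_ne_top (ENNReal.mul_ne_top (ENNReal.pow_ne_top hτt) hC₂t) ?_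
      rw [ENNReal.inv_ne_top]
      exact (tsub_pos_of_lt hτθ).ne'
  · beta_reduce
    rw [← ENNReal.summable.sum_add_tsum_nat_add' (k := M), add_mul]
    refine add_le_add ?_ ?_
    · rw [Finset.sum_mul]
      refine Finset.sum_le_sum fun n _ => ?_
      rw [mul_pow, mul_assoc]
      gcongr
      exact h₁ n x
    · rw [← ENNReal.tsum_geometric, ← ENNReal.tsum_mul_left, ← ENNReal.tsum_mul_right]
      refine ENNReal.tsum_le_tsum fun n => ?_
      calc _ ≤ τ ^ (n + M) * (C₂ * θ ^ n * h x) := by gcongr; exact h₂ n x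
        _ = _ := by rw [pow_add, mul_pow]; ring

end

namespace IsGreenKernel

variable {X : Type*} [MeasurableSpace X]
variable {ν : Measure X} {g k : X → X → ℝ≥0∞} {d : X → ℝ≥0∞} {p : ℝ} {m : ℕ}

/-- If the linearization at a solution is a strict contraction in the weighted `L²` space, then
the problem remains solvable for slightly larger parameters. -/
theorem exists_mass_minSol_lt_top_of_contraction [SFinite ν] (H : IsGreenKernel ν g k d p m)
    (hm : m ≠ 0) (hp : 1 < p) {μ : Measure X} [SFinite μ] (hμ : ∫⁻ x, d x ∂μ = 1)
    {lam : ℝ≥0∞} (hl0 : lam ≠ 0) (hlt : lam ≠ ∞) {u : X → ℝ≥0∞} (hu : Measurable u)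
    (hue : ∀ x, u x = kerOp ν g (fun y => u y ^ p) x + lam * kerPot g μ x)
    (hA : ∫⁻ x, u x ^ p * d x ∂ν ≠ ∞) {θ : ℝ≥0∞} (hθ : θ < 1)
    (hc : ∀ f : X → ℝ≥0∞, Measurable f →
      ∫⁻ x, ENNReal.ofReal p * u x ^ (p - 1) * kerOp ν g f x ^ 2 ∂ν ≤
        θ ^ 2 * ∫⁻ x, f x ^ 2 * (ENNReal.ofReal p * u x ^ (p - 1))⁻¹ ∂ν) :
    ∃ lam' : ℝ≥0∞, lam < lam' ∧ lam' ≠ ∞ ∧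
      ∫⁻ x, minSol ν g p (kerPot g μ) lam' x ^ p * d x ∂ν ≠ ∞ := by
  have hp0 : 0 < p := by linarith
  have hp1 : 0 < p - 1 := by linarith
  have hg := H.measurable_g
  set h := kerPot g μ with hh
  have hhm : Measurable h := measurable_kerPot hg
  set V : X → ℝ≥0∞ := fun x => ENNReal.ofReal p * u x ^ (p - 1) with hV
  have hVm : Measurable V := (hu.pow_const _).const_mul _
  have hP0 : ENNReal.ofReal p ≠ 0 := by simpa using hp0
  have hut := H.ae_ne_top_of_mass hp0 hu.aemeasurable hA
  have hV0 : ∀ᵐ x ∂ν, V x ≠ 0 := by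
    filter_upwards [H.kerPot_ne_zero hμ] with x hx hx0
    have hUx : u x ≠ 0 := by
      rw [hue]
      exact fun h => mul_ne_zero hl0 hx (add_eq_zero.1 h).2
    rcases mul_eq_zero.1 hx0 with h | h
    · exact hP0 h
    · rw [ENNReal.rpow_eq_zero_iff] at h
      rcases h with h | h
      · exact hUx h.1
      · linarith [h.2]
  have hVt : ∀ᵐ x ∂ν, V x ≠ ∞ := by
    filter_upwards [hut] with x hx
    exact ENNReal.mul_ne_top ENNReal.ofReal_ne_top (ENNReal.rpow_ne_top_of_nonneg hp1.le hx)
  obtain ⟨W, hWt, hW⟩ := H.kato hp hu hA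
  obtain ⟨C₁, hC₁t, hC₁⟩ := H.linOp_kerPot_le hm hVm hWt hW
  obtain ⟨C, hCt, hC⟩ := H.linOp_iterate_kerPot_le hm hVm hWt hW
  obtain ⟨c, hc0, hct, hcd⟩ := H.exists_mul_le_kerPot hμ
  -- `d` belongs to `L²(V)`
  set D := ∫⁻ x, V x * d x ^ 2 ∂ν with hD
  have hDt : D ≠ ∞ := by
    obtain ⟨κ, hκ0, hκt, hκ⟩ := H.k_lower
    have hε : (0 : ℝ) ≤ 1 + 1 / m := by positivity
    -- The Kato bound at a single pole suffices, because `k` is bounded below.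
    obtain ⟨x₀, -⟩ := nonempty_of_measure_ne_zero (Measure.measure_univ_ne_zero.2 H.measure_ne_zero)
    set κ' := κ ^ (1 + 1 / m : ℝ) with hκ'
    have hκ'0 : κ' ≠ 0 := by simp [hκ', ENNReal.rpow_eq_zero_iff, hκ0, hκt]
    have hle : κ' * D ≤ W := by
      refine (lintegral_const_mul_le _ _).trans ((lintegral_mono fun y => ?_).trans
        (hW x₀))
      exact mul_le_mul_left (ENNReal.rpow_le_rpow (hκ y _) hε) _
    intro hDtop
    rw [hDtop, ENNReal.mul_top hκ'0] at hle
    exact hWt (top_le_iff.1 hle)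
  have hfirst : ∀ n x, (linOp ν g V)^[n] h x ≤ C₁ ^ n * h x := by
    intro n
    induction n with
    | zero => intro x; simp
    | succ n ih =>
      intro x
      rw [Function.iterate_succ_apply']
      refine (linOp_mono ih x).trans ?_
      rw [linOp_const_mul hg hVm hhm, pow_succ, mul_assoc]
      gcongr
      exact hC₁ μ x
  -- The first `m` steps bring `h` below a multiple of `d ∈ L²(V)`, and the next `n` contract in
  -- `L²(V)`. One more step makes the result a potential of mass `O(θ^n)`, and the last `m` return
  -- to a pointwise bound by `d`, hence by `h`.
  have htail : ∀ n x, (linOp ν g V)^[n + (m + 1 + m)] h x ≤ (C ^ 2 * D / c) * θ ^ n * h x := by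
    intro n x
    set f₀ := (linOp ν g V)^[m] h with hf₀
    have hf₀m : Measurable f₀ := measurable_linOp_iterate hg hVm hhm m
    have hf₀d : ∀ x, f₀ x ≤ C * d x := fun x => by simpa [hμ] using hC μ x
    set F := (linOp ν g V)^[n] f₀ with hF
    have hFm : Measurable F := measurable_linOp_iterate hg hVm hf₀m n
    have hF2 : ∫⁻ x, V x * F x ^ 2 ∂ν ≤ (θ ^ n) ^ 2 * (C ^ 2 * D) := by
      refine (lintegral_mul_linOp_iterate_sq_le hg hVm hV0 hVt hc hf₀m n).trans ?_
      gcongr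
      rw [hD, ← lintegral_const_mul' _ _ (ENNReal.pow_ne_top hCt)]
      refine lintegral_mono fun x => ?_
      calc V x * f₀ x ^ 2 ≤ V x * (C * d x) ^ 2 := by gcongr; exact hf₀d x
        _ = _ := by ring
    have hVF : Measurable fun y => V y * F y := hVm.mul hFm
    have hdF : ∫⁻ y, V y * F y * d y ∂ν ≤ θ ^ n * C * D := by
      refine (ENNReal.pow_le_pow_left_iff two_ne_zero).1 ?_
      refine (sq_lintegral_mul_le hVF H.measurable_d hVm.inv
        (hVt.mono fun x hx => by simpa using hx) (hV0.mono fun x hx => by simpa using hx)).trans ?_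
      have e : ∫⁻ x, (V x * F x) ^ 2 * V⁻¹ x ∂ν = ∫⁻ x, V x * F x ^ 2 ∂ν := by
        refine lintegral_congr_ae ?_
        filter_upwards [hV0, hVt] with x h0 ht
        rw [Pi.inv_apply]
        calc _ = V x * (V x)⁻¹ * (V x * F x ^ 2) := by ring
          _ = _ := by rw [ENNReal.mul_inv_cancel h0 ht, one_mul]
      have e' : ∫⁻ x, d x ^ 2 * (V⁻¹ x)⁻¹ ∂ν = D := by
        refine lintegral_congr fun x => ?_
        rw [Pi.inv_apply, inv_inv, mul_comm]
      rw [e, e']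
      calc _ ≤ (θ ^ n) ^ 2 * (C ^ 2 * D) * D := by gcongr
        _ = _ := by ring
    have hit : (linOp ν g V)^[n + (m + 1 + m)] h =
        (linOp ν g V)^[m] (kerPot g (ν.withDensity fun y => V y * F y)) := by
      rw [show n + (m + 1 + m) = m + 1 + n + m by ring, Function.iterate_add_apply,
        Function.iterate_add_apply, Function.iterate_succ_apply]
      congr 1
      ext y
      exact kerOp_eq_kerPot hg hVF y
    rw [hit]
    refine (hC _ x).trans ?_
    rw [lintegral_withDensity_eq_lintegral_mul _ hVF H.measurable_d]
    have hd : d x ≤ c⁻¹ * h x := by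
      calc d x = c⁻¹ * (c * d x) := by rw [← mul_assoc, ENNReal.inv_mul_cancel hc0 hct, one_mul]
        _ ≤ _ := by gcongr; exact hcd x
    calc _ ≤ C * (c⁻¹ * h x) * (θ ^ n * C * D) := by gcongr; exact hdF
      _ = _ := by rw [ENNReal.div_eq_inv_mul]; ring
  -- Any `τ` in `(1, 1/θ)`: above `1` to absorb the nonlinear remainder, below `1/θ` for the Neumann
  -- series to converge.
  obtain ⟨τ, hτ1, hτθ'⟩ := exists_between (ENNReal.one_lt_inv.2 hθ)
  have hτt : τ ≠ ∞ := hτθ'.ne_top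
  have hτθ : τ * θ < 1 := ENNReal.mul_lt_of_lt_div (by rwa [one_div])
  obtain ⟨φ, hφm, hφe, Cφ, hCφt, hCφ⟩ := exists_neumann_series hg hVm hhm hC₁t
    (ENNReal.div_ne_top (ENNReal.mul_ne_top (ENNReal.pow_ne_top hCt) hDt) hc0) hτt hτθ
    hfirst htail
  obtain ⟨s₀, hs₀, hs₀t, hs⟩ := exists_ennreal_rpow_add_le hp hτ1 hτt
  have hC1 : Cφ + 1 ≠ ∞ := ENNReal.add_ne_top.2 ⟨hCφt, ENNReal.one_ne_top⟩
  have hC10 : Cφ + 1 ≠ 0 := by simp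
  -- Chosen so that `e φ ≤ s₀ u`, which follows from `φ ≤ Cφ h` and `lam h ≤ u`. The `1` keeps the
  -- denominator nonzero.
  set e : ℝ≥0∞ := s₀ * lam / (Cφ + 1) with he
  have he0 : e ≠ 0 := by
    rw [he, Ne, ENNReal.div_eq_zero_iff]
    exact not_or.2 ⟨mul_ne_zero hs₀ hl0, hC1⟩
  have het : e ≠ ∞ := ENNReal.div_ne_top (ENNReal.mul_ne_top hs₀t hlt) hC10
  have heφ : ∀ x, e * φ x ≤ s₀ * u x := by
    intro x
    calc e * φ x ≤ e * ((Cφ + 1) * h x) := by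
          gcongr
          exact (hCφ x).trans (by gcongr; exact le_self_add)
      _ = s₀ * (lam * h x) := by
          rw [← mul_assoc, he, ENNReal.div_mul_cancel hC10 hC1, mul_assoc]
      _ ≤ _ := by
          gcongr
          rw [hue x]; exact le_add_self
  refine ⟨lam + e, ENNReal.lt_add_right hlt he0, ENNReal.add_ne_top.2 ⟨hlt, het⟩, ?_⟩
  -- Smallness of `e φ` relative to `u` gives `(u + e φ)^p ≤ u^p + τ V e φ`. The equations for `u`
  -- and `φ` then add up to a supersolution for `lam + e`.
  have hsup : ∀ x, kerOp ν g (fun y => (u y + e * φ y) ^ p) x + (lam + e) * h x ≤ u x + e * φ x := by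
    intro x
    have hVφ := kerOp_const_mul (ν := ν) (f := fun y => V y * φ y) hg (hVm.mul hφm) (τ * e) x
    calc _ ≤ kerOp ν g (fun y => u y ^ p + τ * e * (V y * φ y)) x + (lam + e) * h x := by
          gcongr
          refine kerOp_mono_ae (ae_of_all _ fun y => (hs _ _ (heφ y)).trans (le_of_eq ?_)) x
          rw [hV]; ring
      _ = (kerOp ν g (fun y => u y ^ p) x + lam * h x) + e * (h x + τ * linOp ν g V φ x) := by
          rw [kerOp_add hg (hu.pow_const p), hVφ, linOp]; ring
      _ = _ := by rw [← hue x, ← hφe x]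
  have hle := minSol_le_of_super hp0.le (ae_of_all ν hsup)
  have hfin : (1 + s₀) ^ p * ∫⁻ x, u x ^ p * d x ∂ν ≠ ∞ :=
    ENNReal.mul_ne_top (ENNReal.rpow_ne_top_of_nonneg hp0.le
      (ENNReal.add_ne_top.2 ⟨ENNReal.one_ne_top, hs₀t⟩)) hA
  refine ne_top_of_le_ne_top hfin ?_
  rw [← lintegral_const_mul' _ _ (ENNReal.rpow_ne_top_of_nonneg hp0.le
    (ENNReal.add_ne_top.2 ⟨ENNReal.one_ne_top, hs₀t⟩))]
  refine lintegral_mono_ae ?_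
  filter_upwards [hle] with x hx
  rw [← mul_assoc, ← ENNReal.mul_rpow_of_nonneg _ _ hp0.le, add_mul, one_mul]
  gcongr
  exact hx.trans (add_le_add le_rfl (heφ x))

end IsGreenKernel

/-! ### The Green function of a bounded domain as an abstract kernel -/

section Domain

variable {N : ℕ} {Ω : Opens (Euc N)}

theorem continuous_bdist (Ω : Opens (Euc N)) : Continuous (bdist Ω) :=
  Metric.continuous_infDist_pt _

theorem bdist_nonneg (Ω : Opens (Euc N)) (x : Euc N) : 0 ≤ bdist Ω x := Metric.infDist_nonneg

theorem frontier_nonempty_of_isBounded (hN : N ≠ 0) (hne : (Ω : Set (Euc N)).Nonempty)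
    (hb : Bornology.IsBounded (Ω : Set (Euc N))) : (frontier (Ω : Set (Euc N))).Nonempty := by
  have : Nonempty (Fin N) := ⟨⟨0, Nat.pos_of_ne_zero hN⟩⟩
  by_contra h
  rw [Set.not_nonempty_iff_eq_empty, ← isClopen_iff_frontier_eq_empty, isClopen_iff] at h
  rcases h with h | h
  · exact hne.ne_empty h
  · rw [h] at hb
    exact NoncompactSpace.noncompact_univ
      (Metric.isCompact_of_isClosed_isBounded isClosed_univ hb : IsCompact (univ : Set (Euc N)))

theorem bdist_pos (hf : (frontier (Ω : Set (Euc N))).Nonempty) {x : Euc N} (hx : x ∈ Ω) :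
    0 < bdist Ω x := by
  refine (isClosed_frontier.notMem_iff_infDist_pos hf).1 fun h => ?_
  rw [Ω.isOpen.frontier_eq] at h
  exact h.2 hx

/-- `d = δ^γ` as an extended nonnegative function. -/
noncomputable def bweight (Ω : Opens (Euc N)) (γ : ℝ) (x : Euc N) : ℝ≥0∞ :=
  ENNReal.ofReal (bdist Ω x ^ γ)

/-- The quotient `greenProfile / (δ(x) δ(y))^γ`. -/
noncomputable def reducedProfile (Ω : Opens (Euc N)) (a γ : ℝ) (x y : Euc N) : ℝ≥0∞ :=
  edist x y ^ (-a) * max (edist x y) (ENNReal.ofReal (bdist Ω x)) ^ (-γ) *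
    max (edist x y) (ENNReal.ofReal (bdist Ω y)) ^ (-γ)

theorem measurable_bweight (Ω : Opens (Euc N)) (γ : ℝ) : Measurable (bweight Ω γ) :=
  ((continuous_bdist Ω).measurable.pow_const γ).ennreal_ofReal

theorem bweight_eq_rpow {γ : ℝ} (hγ : 0 ≤ γ) (x : Euc N) :
    bweight Ω γ x = ENNReal.ofReal (bdist Ω x) ^ γ :=
  (ENNReal.ofReal_rpow_of_nonneg (bdist_nonneg Ω x) hγ).symm

theorem measurable_reducedProfile (Ω : Opens (Euc N)) (a γ : ℝ) :
    Measurable (Function.uncurry (reducedProfile Ω a γ)) := by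
  have he : Measurable fun q : Euc N × Euc N => edist q.1 q.2 := measurable_edist
  have hb : Measurable fun x : Euc N => ENNReal.ofReal (bdist Ω x) :=
    (continuous_bdist Ω).measurable.ennreal_ofReal
  exact ((he.pow_const _).mul ((he.max (hb.comp measurable_fst)).pow_const _)).mul
    ((he.max (hb.comp measurable_snd)).pow_const _)

theorem reducedProfile_comm (a γ : ℝ) (x y : Euc N) :
    reducedProfile Ω a γ x y = reducedProfile Ω a γ y x := by
  unfold reducedProfile
  rw [edist_comm]; ring

theorem ofReal_bdist_le (x y : Euc N) :
    ENNReal.ofReal (bdist Ω x) ≤ ENNReal.ofReal (bdist Ω y) + edist x y := by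
  rw [edist_dist, ← ENNReal.ofReal_add (bdist_nonneg Ω y) dist_nonneg]
  exact ENNReal.ofReal_le_ofReal Metric.infDist_le_infDist_add_dist

theorem rpow_neg_le_two_mul {u v : ℝ≥0∞} {c : ℝ} (hc : 0 ≤ c) (hv : v ≠ ∞) (h : u ≤ 2 * v) :
    v ^ (-c) ≤ 2 ^ c * u ^ (-c) := by
  have h2 : (2 : ℝ≥0∞) ^ c ≠ 0 := by simp [ENNReal.rpow_eq_zero_iff]
  have h2t : (2 : ℝ≥0∞) ^ c ≠ ∞ := ENNReal.rpow_ne_top_of_nonneg hc (by norm_num)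
  have h1 : (2 * v) ^ (-c) ≤ u ^ (-c) := by
    rw [ENNReal.rpow_neg, ENNReal.rpow_neg]
    exact ENNReal.inv_le_inv.2 (ENNReal.rpow_le_rpow h hc)
  rw [ENNReal.mul_rpow_of_ne_top (by norm_num) hv, ENNReal.rpow_neg 2] at h1
  calc v ^ (-c) = 2 ^ c * ((2 ^ c)⁻¹ * v ^ (-c)) := by
        rw [← mul_assoc, ENNReal.mul_inv_cancel h2 h2t, one_mul]
    _ ≤ _ := by gcongr

theorem max_edist_ne_top (x y z : Euc N) :
    max (edist x y) (ENNReal.ofReal (bdist Ω z)) ≠ ∞ :=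
  (max_lt (edist_lt_top x y) ENNReal.ofReal_lt_top).ne

/-- Replacing `y` by `x` at most doubles each of the three lengths in the profile, by the triangle
inequality and since `δ` is `1`-Lipschitz. -/
theorem reducedProfile_le_of_edist_le {a γ : ℝ} (ha : 0 ≤ a) (hγ : 0 ≤ γ) {x y z : Euc N}
    (h : edist x y ≤ edist y z) :
    reducedProfile Ω a γ y z ≤ 2 ^ a * 2 ^ γ * 2 ^ γ * reducedProfile Ω a γ x z := by
  have hr : edist x z ≤ 2 * edist y z :=
    (edist_triangle x y z).trans (by rw [two_mul]; gcongr)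
  have hx : max (edist x z) (ENNReal.ofReal (bdist Ω x)) ≤
      2 * max (edist y z) (ENNReal.ofReal (bdist Ω y)) := by
    refine max_le (hr.trans (by gcongr; exact le_max_left _ _)) ?_
    refine (ofReal_bdist_le x y).trans ?_
    rw [two_mul]
    exact add_le_add (le_max_right _ _) (h.trans (le_max_left _ _))
  have hz : max (edist x z) (ENNReal.ofReal (bdist Ω z)) ≤
      2 * max (edist y z) (ENNReal.ofReal (bdist Ω z)) := by
    refine max_le (hr.trans (by gcongr; exact le_max_left _ _)) ?_
    rw [two_mul]
    exact le_add_self.trans (add_le_add (le_max_right _ _) (le_max_right _ _))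
  have h1 := rpow_neg_le_two_mul ha (edist_ne_top y z) hr
  have h2 := rpow_neg_le_two_mul hγ (max_edist_ne_top y z y) hx
  have h3 := rpow_neg_le_two_mul hγ (max_edist_ne_top y z z) hz
  calc reducedProfile Ω a γ y z ≤ _ := mul_le_mul' (mul_le_mul' h1 h2) h3
    _ = _ := by unfold reducedProfile; ring

/-- Of the pairs `(x,y)` and `(y,z)`, the more distant one carries the controlled value; symmetry of
the profile reduces both cases to one comparison. -/
theorem min_reducedProfile_le {a γ : ℝ} (ha : 0 ≤ a) (hγ : 0 ≤ γ) (x y z : Euc N) :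
    min (reducedProfile Ω a γ x y) (reducedProfile Ω a γ y z) ≤
      2 ^ a * 2 ^ γ * 2 ^ γ * reducedProfile Ω a γ x z := by
  rcases le_total (edist x y) (edist y z) with h | h
  · exact (min_le_right _ _).trans (reducedProfile_le_of_edist_le ha hγ h)
  · refine (min_le_left _ _).trans ?_
    rw [reducedProfile_comm a γ x y, reducedProfile_comm a γ x z]
    refine reducedProfile_le_of_edist_le ha hγ ?_
    rwa [edist_comm z y, edist_comm y x]

/-- In this form the factor `δ^γ` separates from the Green profile, leaving the reduced one. -/
theorem min_div_one_eq {δ r : ℝ} (hδ : 0 < δ) (hr : 0 < r) : min (δ / r) 1 = δ / max r δ := by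
  rcases le_total r δ with h | h
  · rw [max_eq_right h, min_eq_right ((one_le_div hr).2 h), div_self hδ.ne']
  · rw [max_eq_left h, min_eq_left ((div_le_one hr).2 h)]

theorem ofReal_greenProfile {s γ : ℝ} (hf : (frontier (Ω : Set (Euc N))).Nonempty)
    {x y : Euc N} (hx : x ∈ Ω) (hy : y ∈ Ω) (hxy : x ≠ y) :
    ENNReal.ofReal (greenProfile Ω s γ x y) =
      bweight Ω γ x * bweight Ω γ y * reducedProfile Ω ((N : ℝ) - 2 * s) γ x y := by
  have hr : 0 < dist x y := dist_pos.2 hxy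
  have hδx := bdist_pos hf hx
  have hδy := bdist_pos hf hy
  have hm : ∀ z : Euc N, z ∈ Ω → max (edist x y) (ENNReal.ofReal (bdist Ω z)) ^ (-γ) =
      ENNReal.ofReal (max (dist x y) (bdist Ω z) ^ (-γ)) := by
    intro z hz
    rw [edist_dist, ← ENNReal.ofReal_max, ENNReal.ofReal_rpow_of_pos (lt_max_of_lt_left hr)]
  unfold reducedProfile bweight
  rw [hm x hx, hm y hy, edist_dist, ENNReal.ofReal_rpow_of_pos hr,
    ← ENNReal.ofReal_mul (by positivity), ← ENNReal.ofReal_mul (by positivity),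
    ← ENNReal.ofReal_mul (by positivity), ← ENNReal.ofReal_mul (by positivity)]
  congr 1
  unfold greenProfile
  rw [← dist_eq_norm, min_div_one_eq hδx hr, min_div_one_eq hδy hr,
    Real.div_rpow hδx.le (by positivity), Real.div_rpow hδy.le (by positivity),
    Real.rpow_neg (by positivity), Real.rpow_neg (by positivity), Real.rpow_neg (by positivity)]
  field_simp

theorem exists_diam_bound (hf : (frontier (Ω : Set (Euc N))).Nonempty)
    (hb : Bornology.IsBounded (Ω : Set (Euc N))) :
    ∃ D : ℝ≥0∞, D ≠ 0 ∧ D ≠ ∞ ∧ (∀ x ∈ Ω, ∀ y ∈ Ω, edist x y ≤ D) ∧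
      ∀ x ∈ Ω, ENNReal.ofReal (bdist Ω x) ≤ D := by
  obtain ⟨z, hz⟩ := hf
  obtain ⟨R, hR⟩ := (Metric.isBounded_iff.1 hb.closure)
  refine ⟨ENNReal.ofReal (max R 1), by simp, ENNReal.ofReal_ne_top, fun x hx y hy => ?_,
    fun x hx => ?_⟩
  · rw [edist_dist]
    exact ENNReal.ofReal_le_ofReal ((hR (subset_closure hx) (subset_closure hy)).trans
      (le_max_left _ _))
  · refine ENNReal.ofReal_le_ofReal ((Metric.infDist_le_dist_of_mem hz).trans
      ((hR (subset_closure hx) hz.1).trans (le_max_left _ _)))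

theorem exists_le_reducedProfile {a γ : ℝ} (ha : 0 ≤ a) (hγ : 0 ≤ γ)
    (hf : (frontier (Ω : Set (Euc N))).Nonempty) (hb : Bornology.IsBounded (Ω : Set (Euc N))) :
    ∃ κ : ℝ≥0∞, κ ≠ 0 ∧ κ ≠ ∞ ∧ ∀ x ∈ Ω, ∀ y ∈ Ω, κ ≤ reducedProfile Ω a γ x y := by
  obtain ⟨D, hD0, hDt, hr, hδ⟩ := exists_diam_bound hf hb
  have hanti : ∀ {u : ℝ≥0∞} {c : ℝ}, 0 ≤ c → u ≤ D → D ^ (-c) ≤ u ^ (-c) := by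
    intro u c hc hu
    rw [ENNReal.rpow_neg, ENNReal.rpow_neg]
    exact ENNReal.inv_le_inv.2 (ENNReal.rpow_le_rpow hu hc)
  have h0 : ∀ c : ℝ, D ^ c ≠ 0 := fun c => by simp [ENNReal.rpow_eq_zero_iff, hD0, hDt]
  have ht : ∀ c : ℝ, D ^ c ≠ ∞ := fun c => by simp [ENNReal.rpow_eq_top_iff, hD0, hDt]
  refine ⟨D ^ (-a) * D ^ (-γ) * D ^ (-γ), mul_ne_zero (mul_ne_zero (h0 _) (h0 _)) (h0 _),
    ENNReal.mul_ne_top (ENNReal.mul_ne_top (ht _) (ht _)) (ht _), fun x hx y hy => ?_⟩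
  exact mul_le_mul' (mul_le_mul' (hanti ha (hr x hx y hy))
    (hanti hγ (max_le (hr x hx y hy) (hδ x hx)))) (hanti hγ (max_le (hr x hx y hy) (hδ y hy)))

/-- The integrand is at most `1` outside the unit ball about `z`, and inside it translation
invariance removes the dependence on `z`. -/
theorem lintegral_edist_rpow_neg_le (hN : N ≠ 0) (hb : Bornology.IsBounded (Ω : Set (Euc N)))
    {β : ℝ} (hβ0 : 0 ≤ β) (hβ : β < N) :
    ∃ M : ℝ≥0∞, M ≠ ∞ ∧ ∀ z : Euc N, ∫⁻ y in (Ω : Set (Euc N)), edist y z ^ (-β) ≤ M := by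
  have : Nonempty (Fin N) := ⟨⟨0, Nat.pos_of_ne_zero hN⟩⟩
  have hI : IntegrableOn (fun x : Euc N => ‖x‖ ^ (-β)) (Metric.ball 0 1) := by
    rw [integrableOn_fun_norm_addHaar volume (f := fun r : ℝ => r ^ (-β))]
    rw [finrank_euclideanSpace_fin]
    have h1 : IntegrableOn (fun r : ℝ => r ^ ((N : ℝ) - 1 - β)) (Ioo 0 1) := by
      rw [intervalIntegral.integrableOn_Ioo_rpow_iff zero_lt_one]; linarith
    refine h1.congr_fun (fun r hr => ?_) measurableSet_Ioo
    simp only [smul_eq_mul]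
    rw [← Real.rpow_natCast, ← Real.rpow_add hr.1, Nat.cast_pred (Nat.pos_of_ne_zero hN)]
    rfl
  refine ⟨(∫⁻ x in Metric.ball (0 : Euc N) 1, ‖‖x‖ ^ (-β)‖ₑ) + volume (Ω : Set (Euc N)),
    ENNReal.add_ne_top.2 ⟨hI.2.ne, hb.measure_lt_top.ne⟩, fun z => ?_⟩
  have hz0 : ∀ᵐ y : Euc N, y ≠ z := by
    have := Measure.ae_ne (volume : Measure (Euc N)) z
    exact this
  have hpt : ∀ᵐ y : Euc N, edist y z ^ (-β) ≤
      (Metric.ball (0 : Euc N) 1).indicator (fun x => ‖‖x‖ ^ (-β)‖ₑ) (y - z) + 1 := by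
    filter_upwards [hz0] with y hy
    have hpos : 0 < ‖y - z‖ := norm_pos_iff.2 (sub_ne_zero.2 hy)
    have e : edist y z ^ (-β) = ENNReal.ofReal (‖y - z‖ ^ (-β)) := by
      rw [edist_dist, dist_eq_norm, ENNReal.ofReal_rpow_of_pos hpos]
    by_cases h : y - z ∈ Metric.ball (0 : Euc N) 1
    · rw [Set.indicator_of_mem h, e, Real.enorm_eq_ofReal (by positivity)]
      exact le_self_add
    · rw [Set.indicator_of_notMem h, zero_add, e]
      rw [mem_ball_zero_iff, not_lt] at h
      exact ENNReal.ofReal_le_one.2 (Real.rpow_le_one_of_one_le_of_nonpos h (by linarith))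
  calc ∫⁻ y in (Ω : Set (Euc N)), edist y z ^ (-β)
      ≤ ∫⁻ y in (Ω : Set (Euc N)),
          ((Metric.ball (0 : Euc N) 1).indicator (fun x => ‖‖x‖ ^ (-β)‖ₑ) (y - z) + 1) :=
        lintegral_mono_ae (ae_restrict_of_ae hpt)
    _ = (∫⁻ y in (Ω : Set (Euc N)),
          (Metric.ball (0 : Euc N) 1).indicator (fun x => ‖‖x‖ ^ (-β)‖ₑ) (y - z)) +
          volume (Ω : Set (Euc N)) := by
        rw [lintegral_add_right _ measurable_const, lintegral_one, Measure.restrict_apply_univ]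
    _ ≤ (∫⁻ y, (Metric.ball (0 : Euc N) 1).indicator (fun x => ‖‖x‖ ^ (-β)‖ₑ) (y - z)) +
          volume (Ω : Set (Euc N)) := by
        gcongr; exact Measure.restrict_le_self
    _ = _ := by
        rw [lintegral_sub_right_eq_self (fun x =>
          (Metric.ball (0 : Euc N) 1).indicator (fun x => ‖‖x‖ ^ (-β)‖ₑ) x) z,
          lintegral_indicator measurableSet_ball]

end Domain

/-! ### Subcritical integrability and the passage to an abstract kernel. -/

section Domain

variable {N : ℕ} {Ω : Opens (Euc N)}

theorem rpow_mul_rpow_neg_le {r A : ℝ≥0∞} {b c : ℝ} (hr : r ≠ 0) (hA : A ≠ ∞) (hrA : r ≤ A)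
    (hbc : b ≤ c) : A ^ b * A ^ (-c) ≤ r ^ (-(c - b)) := by
  have hA0 : A ≠ 0 := fun h => hr (le_antisymm (h ▸ hrA) zero_le)
  rw [← ENNReal.rpow_add _ _ hA0 hA, show b + -c = -(c - b) by ring, ENNReal.rpow_neg,
    ENNReal.rpow_neg]
  exact ENNReal.inv_le_inv.2 (ENNReal.rpow_le_rpow hrA (by linarith))

/-- The weight `δ(y)^(γ(p+1))` is split into equal halves. One is absorbed by `max r δ(y)`, the
other by `max r δ(z)`, which is at least `δ(y)/2`. What is left of each maximum is a nonpositive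
power, so it is bounded by the same power of `r`. -/
theorem reducedProfile_rpow_mul_le {a γ p q : ℝ} (hγ : 0 < γ) (hp : 1 < p)
    (hpq : p ≤ q) {y z : Euc N} (hyz : y ≠ z) :
    reducedProfile Ω a γ y z ^ q * bweight Ω γ y ^ (p + 1) ≤
      2 ^ (γ * ((p + 1) / 2)) * edist y z ^ (-(a * q + γ * (2 * q - p - 1))) := by
  have hq0 : 0 ≤ q := by linarith
  set r := edist y z with hr
  have hr0 : r ≠ 0 := by simpa [hr] using hyz
  have hrt : r ≠ ∞ := edist_ne_top y z
  set δ := ENNReal.ofReal (bdist Ω y) with hδ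
  set A := max r δ with hA
  set B := max r (ENNReal.ofReal (bdist Ω z)) with hB
  have hAt : A ≠ ∞ := max_edist_ne_top y z y
  have hBt : B ≠ ∞ := max_edist_ne_top y z z
  set b := γ * ((p + 1) / 2) with hb
  have hb0 : 0 ≤ b := by positivity
  have hbc : b ≤ γ * q := by rw [hb]; gcongr; linarith
  have hδB : δ ≤ 2 * B := by
    refine (ofReal_bdist_le y z).trans ?_
    rw [two_mul]
    exact add_le_add (le_max_right _ _) (le_max_left _ _)
  have hw : bweight Ω γ y ^ (p + 1) = δ ^ b * δ ^ b := by
    rw [bweight_eq_rpow hγ.le, ← ENNReal.rpow_mul, ← ENNReal.rpow_add_of_nonneg _ _ hb0 hb0]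
    congr 1; rw [hb]; ring
  have hk : reducedProfile Ω a γ y z ^ q = r ^ (-(a * q)) * A ^ (-(γ * q)) * B ^ (-(γ * q)) := by
    unfold reducedProfile
    rw [ENNReal.mul_rpow_of_nonneg _ _ hq0, ENNReal.mul_rpow_of_nonneg _ _ hq0,
      ← ENNReal.rpow_mul, ← ENNReal.rpow_mul, ← ENNReal.rpow_mul]
    simp only [neg_mul]
    rfl
  rw [hw, hk]
  calc r ^ (-(a * q)) * A ^ (-(γ * q)) * B ^ (-(γ * q)) * (δ ^ b * δ ^ b)
      ≤ r ^ (-(a * q)) * A ^ (-(γ * q)) * B ^ (-(γ * q)) * (A ^ b * (2 * B) ^ b) := by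
        gcongr
        exact le_max_right _ _
    _ = 2 ^ b * (r ^ (-(a * q)) * (A ^ b * A ^ (-(γ * q))) * (B ^ b * B ^ (-(γ * q)))) := by
        rw [ENNReal.mul_rpow_of_nonneg _ _ hb0]; ring
    _ ≤ 2 ^ b * (r ^ (-(a * q)) * r ^ (-(γ * q - b)) * r ^ (-(γ * q - b))) := by
        gcongr
        · exact rpow_mul_rpow_neg_le hr0 hAt (le_max_left _ _) hbc
        · exact rpow_mul_rpow_neg_le hr0 hBt (le_max_left _ _) hbc
    _ = _ := by
        rw [← ENNReal.rpow_add _ _ hr0 hrt, ← ENNReal.rpow_add _ _ hr0 hrt]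
        congr 2; rw [hb]; ring

/-- The Green function, extended to a kernel on the whole space. -/
noncomputable def extendedGreen (Ω : Opens (Euc N)) (G : Euc N → Euc N → ℝ)
    (F : Euc N → Euc N → ℝ≥0∞) (x y : Euc N) : ℝ≥0∞ :=
  open Classical in if x ∈ Ω ∧ y ∈ Ω ∧ x ≠ y then ENNReal.ofReal (G x y) else F x y

theorem extendedGreen_of_mem {G : Euc N → Euc N → ℝ} {F : Euc N → Euc N → ℝ≥0∞} {x y : Euc N}
    (hx : x ∈ Ω) (hy : y ∈ Ω) (hxy : x ≠ y) :
    extendedGreen Ω G F x y = ENNReal.ofReal (G x y) := if_pos ⟨hx, hy, hxy⟩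

theorem measurable_extendedGreen {G : Euc N → Euc N → ℝ} {F : Euc N → Euc N → ℝ≥0∞}
    (hG : Measurable fun q : Ω × Ω => G q.1 q.2) (hF : Measurable (Function.uncurry F)) :
    Measurable (Function.uncurry (extendedGreen Ω G F)) := by
  set S : Set (Euc N × Euc N) := {q | q.1 ∈ Ω ∧ q.2 ∈ Ω ∧ q.1 ≠ q.2} with hS
  have hSm : MeasurableSet S := by
    have h1 : MeasurableSet {q : Euc N × Euc N | q.1 ∈ Ω} :=
      measurable_fst Ω.isOpen.measurableSet
    have h2 : MeasurableSet {q : Euc N × Euc N | q.2 ∈ Ω} :=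
      measurable_snd Ω.isOpen.measurableSet
    have h3 : MeasurableSet {q : Euc N × Euc N | q.1 ≠ q.2} :=
      (measurableSet_eq_fun measurable_fst measurable_snd).compl
    exact h1.inter (h2.inter h3)
  refine measurable_of_restrict_of_restrict_compl hSm ?_ ?_
  · have e : S.domRestrict (Function.uncurry (extendedGreen Ω G F)) = fun q : S =>
        ENNReal.ofReal ((fun q : Ω × Ω => G q.1 q.2) (⟨q.1.1, q.2.1⟩, ⟨q.1.2, q.2.2.1⟩)) := by
      ext q
      exact extendedGreen_of_mem q.2.1 q.2.2.1 q.2.2.2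
    rw [e]
    refine (hG.comp ?_).ennreal_ofReal
    exact (measurable_subtype_coe.fst.subtype_mk).prodMk (measurable_subtype_coe.snd.subtype_mk)
  · have e : Sᶜ.domRestrict (Function.uncurry (extendedGreen Ω G F)) =
        Sᶜ.domRestrict (Function.uncurry F) := by
      ext q
      exact if_neg q.2
    rw [e]
    exact hF.comp measurable_subtype_coe

/-- The exponent exceeds its limiting value `a p + γ (p - 1)` by `(a + 2γ) p / m`, so a strict gap
leaves room for large `m`. -/
theorem exists_nat_exponent {a γ p : ℝ} (ha : 0 < a) (hγ : 0 < γ) (hp : 1 < p) {n : ℝ}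
    (h : a * p + γ * (p - 1) < n) :
    ∃ m : ℕ, m ≠ 0 ∧
      a * (p * (1 + 1 / m)) + γ * (2 * (p * (1 + 1 / m)) - p - 1) < n := by
  obtain ⟨m, hm⟩ := exists_nat_gt ((a + 2 * γ) * p / (n - (a * p + γ * (p - 1))))
  have hgap : 0 < n - (a * p + γ * (p - 1)) := by linarith
  have hm0 : (0 : ℝ) < m := lt_of_le_of_lt (by positivity) hm
  refine ⟨m, by exact_mod_cast hm0.ne', ?_⟩
  rw [div_lt_iff₀ hgap] at hm
  have : (a + 2 * γ) * p / m < n - (a * p + γ * (p - 1)) := by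
    rw [div_lt_iff₀ hm0]; linarith
  have e : a * (p * (1 + 1 / m)) + γ * (2 * (p * (1 + 1 / m)) - p - 1) =
      a * p + γ * (p - 1) + (a + 2 * γ) * p / m := by
    field_simp; ring
  linarith

/-- A Green function of a bounded domain extends to a kernel satisfying the abstract bounds. -/
theorem IsGreenFunction.exists_isGreenKernel {s γ p : ℝ} (hs : 0 < s) (hγ : 0 < γ)
    (hN : 2 * s < (N : ℝ)) (hne : (Ω : Set (Euc N)).Nonempty)
    (hb : Bornology.IsBounded (Ω : Set (Euc N))) {L : TestOperator Ω} {G : Euc N → Euc N → ℝ}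
    (hG : IsGreenFunction L s γ G) (hp : 1 < p) (hp' : p < critExp N s γ) :
    ∃ (g k : Euc N → Euc N → ℝ≥0∞) (m : ℕ), m ≠ 0 ∧
      IsGreenKernel (volume.restrict (Ω : Set (Euc N))) g k (bweight Ω γ) p m ∧
      ∀ x ∈ Ω, ∀ y ∈ Ω, x ≠ y → g x y = ENNReal.ofReal (G x y) := by
  have ha : 0 < (N : ℝ) - 2 * s := by linarith
  have hN0 : N ≠ 0 := by
    rintro rfl
    norm_num at hN; linarith
  have hfin : Nonempty (Fin N) := ⟨⟨0, Nat.pos_of_ne_zero hN0⟩⟩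
  have hf := frontier_nonempty_of_isBounded hN0 hne hb
  obtain ⟨c, C, hc, hC, hest⟩ := hG.estimate
  obtain ⟨κ, hκ0, hκt, hκ⟩ := exists_le_reducedProfile ha.le hγ.le hf hb
  obtain ⟨D, hD0, hDt, -, hD⟩ := exists_diam_bound hf hb
  -- This is `p < p^*` after clearing the denominator: subcriticality is exactly local integrability
  -- of the limiting singularity.
  have hexp : ((N : ℝ) - 2 * s) * p + γ * (p - 1) < N := by
    rw [critExp, lt_div_iff₀ (by linarith)] at hp'
    linarith
  obtain ⟨m, hm, hmN⟩ := exists_nat_exponent ha hγ hp hexp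
  set a := (N : ℝ) - 2 * s with ha'
  set d := bweight Ω γ with hd
  -- The maximum with `κ` makes the lower bound hold on the whole space and changes nothing on `Ω ×
  -- Ω`.
  set k : Euc N → Euc N → ℝ≥0∞ := fun x y => max κ (reducedProfile Ω a γ x y) with hk
  have hkm : Measurable (Function.uncurry k) :=
    measurable_const.max (measurable_reducedProfile Ω a γ)
  have hdm : Measurable d := measurable_bweight Ω γ
  -- This fills in the diagonal and the complement of `Ω × Ω`, so that symmetry and the two-sided
  -- bounds hold everywhere. The lower constant becomes `min c C` on its account.
  set F : Euc N → Euc N → ℝ≥0∞ := fun x y => ENNReal.ofReal C * (d x * d y * k x y) with hF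
  have hFm : Measurable (Function.uncurry F) :=
    (((hdm.comp measurable_fst).mul (hdm.comp measurable_snd)).mul hkm).const_mul _
  have hksymm : ∀ x y, k x y = k y x := fun x y => by
    simp only [hk, reducedProfile_comm a γ x y]
  have hkΩ : ∀ x ∈ Ω, ∀ y ∈ Ω, k x y = reducedProfile Ω a γ x y := fun x hx y hy =>
    max_eq_right (hκ x hx y hy)
  have hprof : ∀ x ∈ Ω, ∀ y ∈ Ω, x ≠ y →
      d x * d y * k x y = ENNReal.ofReal (greenProfile Ω s γ x y) := fun x hx y hy hxy => by
    rw [hkΩ x hx y hy, ofReal_greenProfile hf hx hy hxy]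
  set g := extendedGreen Ω G F with hg
  have hgΩ : ∀ x ∈ Ω, ∀ y ∈ Ω, x ≠ y → g x y = ENNReal.ofReal (G x y) :=
    fun x hx y hy hxy => extendedGreen_of_mem hx hy hxy
  have hgF : ∀ x y, ¬ (x ∈ Ω ∧ y ∈ Ω ∧ x ≠ y) → g x y = F x y := fun x y h => if_neg h
  have hcC : ENNReal.ofReal (min c C) ≤ ENNReal.ofReal C := ENNReal.ofReal_le_ofReal (min_le_right _ _)
  refine ⟨g, k, m, hm, ?_, hgΩ⟩
  refine ⟨measurable_extendedGreen hG.measurable hFm, hkm, hdm, ?_, hksymm, ?_, ?_, ?_, ?_, ?_, ?_,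
    ?_, ?_, ?_⟩
  · intro x y
    by_cases h : x ∈ Ω ∧ y ∈ Ω ∧ x ≠ y
    · rw [hgΩ x h.1 y h.2.1 h.2.2, hgΩ y h.2.1 x h.1 h.2.2.symm, hG.symm x h.1 y h.2.1 h.2.2]
    · rw [hgF x y h, hgF y x (fun h' => h ⟨h'.2.1, h'.1, h'.2.2.symm⟩)]
      simp only [hF, hksymm x y]
      ring
  · set Q : ℝ≥0∞ := 2 ^ a * 2 ^ γ * 2 ^ γ with hQ
    have h1 : ∀ e : ℝ, 0 < e → (1 : ℝ≥0∞) ≤ 2 ^ e := fun e he =>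
      ENNReal.one_le_rpow (by norm_num) he
    have ht : ∀ e : ℝ, 0 ≤ e → (2 : ℝ≥0∞) ^ e ≠ ∞ := fun e he =>
      ENNReal.rpow_ne_top_of_nonneg he (by norm_num)
    -- Needed where the truncation level `κ` is attained.
    have hQ1 : 1 ≤ Q := one_le_mul (one_le_mul (h1 a ha) (h1 γ hγ)) (h1 γ hγ)
    refine ⟨Q, ENNReal.mul_ne_top (ENNReal.mul_ne_top (ht a ha.le) (ht γ hγ.le)) (ht γ hγ.le),
      fun x y z => ?_⟩
    simp only [hk]
    rw [← max_min_distrib_left]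
    refine max_le ?_ ((min_reducedProfile_le ha.le hγ.le x y z).trans ?_)
    · calc κ ≤ Q * κ := le_mul_of_one_le_left zero_le hQ1
        _ ≤ _ := by gcongr; exact le_max_left _ _
    · gcongr; exact le_max_right _ _
  · refine ⟨ENNReal.ofReal C, ENNReal.ofReal_ne_top, fun x y => ?_⟩
    by_cases h : x ∈ Ω ∧ y ∈ Ω ∧ x ≠ y
    · rw [hgΩ x h.1 y h.2.1 h.2.2, hprof x h.1 y h.2.1 h.2.2, ← ENNReal.ofReal_mul hC.le]
      exact ENNReal.ofReal_le_ofReal (hest x h.1 y h.2.1 h.2.2).2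
    · rw [hgF x y h]
  · refine ⟨ENNReal.ofReal (min c C), by simp [hc, hC], ENNReal.ofReal_ne_top, fun x y => ?_⟩
    by_cases h : x ∈ Ω ∧ y ∈ Ω ∧ x ≠ y
    · rw [hgΩ x h.1 y h.2.1 h.2.2, hprof x h.1 y h.2.1 h.2.2]
      calc _ ≤ ENNReal.ofReal c * ENNReal.ofReal (greenProfile Ω s γ x y) := by
            gcongr; exact min_le_left _ _
        _ = ENNReal.ofReal (c * greenProfile Ω s γ x y) := (ENNReal.ofReal_mul hc.le).symm
        _ ≤ _ := ENNReal.ofReal_le_ofReal (hest x h.1 y h.2.1 h.2.2).1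
    · rw [hgF x y h]
      simp only [hF]
      gcongr
  · exact ⟨κ, hκ0, hκt, fun x y => le_max_left _ _⟩
  · filter_upwards [ae_restrict_mem Ω.isOpen.measurableSet] with x hx
    have := Real.rpow_pos_of_pos (bdist_pos hf hx) γ
    simpa [hd, bweight] using this
  · exact fun x => ENNReal.ofReal_ne_top
  · have hle : ∫⁻ x in (Ω : Set (Euc N)), d x ≤ ∫⁻ _ in (Ω : Set (Euc N)), D ^ γ := by
      refine setLIntegral_mono measurable_const fun x hx => ?_
      rw [hd, bweight_eq_rpow hγ.le]
      exact ENNReal.rpow_le_rpow (hD x hx) hγ.le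
    refine ne_top_of_le_ne_top ?_ hle
    rw [lintegral_const, Measure.restrict_apply_univ]
    exact ENNReal.mul_ne_top (ENNReal.rpow_ne_top_of_nonneg hγ.le hDt) hb.measure_lt_top.ne
  · rw [Ne, Measure.restrict_eq_zero]
    exact (Ω.isOpen.measure_pos volume hne).ne'
  · set q := p * (1 + 1 / m : ℝ) with hq
    have hpq : p ≤ q := by
      rw [hq]
      have : (0 : ℝ) ≤ 1 / m := by positivity
      nlinarith
    have hq0 : 0 ≤ q := by linarith
    have hp10 : 0 ≤ p + 1 := by linarith
    have hβ0 : 0 ≤ a * q + γ * (2 * q - p - 1) := by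
      have : 0 ≤ 2 * q - p - 1 := by linarith
      positivity
    obtain ⟨M, hMt, hM⟩ := lintegral_edist_rpow_neg_le hN0 hb hβ0 hmN
    set E : ℝ≥0∞ := 2 ^ (γ * ((p + 1) / 2)) with hE
    have hEt : E ≠ ∞ := ENNReal.rpow_ne_top_of_nonneg (by positivity) (by norm_num)
    set K : ℝ≥0∞ := κ ^ q * (D ^ γ) ^ (p + 1) with hK
    have hKt : K ≠ ∞ := ENNReal.mul_ne_top (ENNReal.rpow_ne_top_of_nonneg hq0 hκt)
      (ENNReal.rpow_ne_top_of_nonneg hp10 (ENNReal.rpow_ne_top_of_nonneg hγ.le hDt))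
    refine ⟨K * volume (Ω : Set (Euc N)) + E * M, ENNReal.add_ne_top.2
      ⟨ENNReal.mul_ne_top hKt hb.measure_lt_top.ne, ENNReal.mul_ne_top hEt hMt⟩, fun z => ?_⟩
    calc ∫⁻ y in (Ω : Set (Euc N)), k y z ^ q * d y ^ (p + 1)
        ≤ ∫⁻ y in (Ω : Set (Euc N)),
            (K + E * edist y z ^ (-(a * q + γ * (2 * q - p - 1)))) := by
          refine lintegral_mono_ae ?_
          filter_upwards [ae_restrict_mem Ω.isOpen.measurableSet,
            ae_restrict_of_ae (Measure.ae_ne (volume : Measure (Euc N)) z)] with y hy hyz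
          have h1 : k y z ^ q ≤ κ ^ q + reducedProfile Ω a γ y z ^ q := by
            rcases le_total κ (reducedProfile Ω a γ y z) with h | h
            · simp only [hk, max_eq_right h]; exact le_add_self
            · simp only [hk, max_eq_left h]; exact le_self_add
          calc _ ≤ (κ ^ q + reducedProfile Ω a γ y z ^ q) * d y ^ (p + 1) := by gcongr
            _ ≤ _ := by
              rw [add_mul]
              refine add_le_add ?_ (reducedProfile_rpow_mul_le hγ hp hpq hyz)
              rw [hK, hd, bweight_eq_rpow hγ.le]
              gcongr
              exact hD y hy
      _ ≤ _ := by
          rw [lintegral_add_left measurable_const, lintegral_const, Measure.restrict_apply_univ,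
            lintegral_const_mul' _ _ hEt]
          gcongr
          exact hM z

end Domain

/-! ### Test functions and the energy space -/

theorem tendsto_integral_mul_of_eLpNorm {α : Type*} [MeasurableSpace α] {ν : Measure α}
    {f : ℕ → α → ℝ} {f₀ g : α → ℝ} (hf : ∀ n, MemLp (f n) 2 ν) (hf₀ : MemLp f₀ 2 ν)
    (hg : MemLp g 2 ν) (h : Tendsto (fun n => eLpNorm (fun x => f n x - f₀ x) 2 ν) atTop (𝓝 0)) :
    Tendsto (fun n => ∫ x, f n x * g x ∂ν) atTop (𝓝 (∫ x, f₀ x * g x ∂ν)) := by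
  refine tendsto_iff_enorm_sub_tendsto_zero.2 ?_
  have hb : Tendsto (fun n => eLpNorm (fun x => f n x - f₀ x) 2 ν * eLpNorm g 2 ν) atTop (𝓝 0) := by
    simpa using ENNReal.Tendsto.mul_const (b := eLpNorm g 2 ν) h (Or.inr hg.2.ne)
  refine tendsto_of_tendsto_of_tendsto_of_le_of_le tendsto_const_nhds hb (fun _ => zero_le)
    fun n => ?_
  have hn : MemLp (fun x => f n x - f₀ x) 2 ν := (hf n).sub hf₀
  have e : ∫ x, f n x * g x ∂ν - ∫ x, f₀ x * g x ∂ν = ∫ x, (f n x - f₀ x) * g x ∂ν := by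
    have h1 : Integrable (fun x => f n x * g x) ν := (hf n).integrable_mul hg
    have h2 : Integrable (fun x => f₀ x * g x) ν := hf₀.integrable_mul hg
    rw [← integral_sub h1 h2]
    simp only [sub_mul]
  simp only [e]
  refine (enorm_integral_le_lintegral_enorm _).trans ?_
  rw [← eLpNorm_one_eq_lintegral_enorm]
  have := eLpNorm_smul_le_mul_eLpNorm (p := 2) (q := 2) (r := 1) hg.1 hn.1
  exact this

section Energy

variable {N : ℕ} {Ω : Opens (Euc N)}

/-- Test functions are dense in `L²(Ω)`. -/
theorem exists_testFunction_tendsto (hb : Bornology.IsBounded (Ω : Set (Euc N))) {f : Euc N → ℝ}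
    (hf : MemLp f 2 (volume.restrict (Ω : Set (Euc N)))) :
    ∃ φ : ℕ → 𝓓(Ω, ℝ), Tendsto (fun n => eLpNorm (fun x => φ n x - f x) 2
      (volume.restrict (Ω : Set (Euc N)))) atTop (𝓝 0) := by
  set ν := volume.restrict (Ω : Set (Euc N)) with hν
  have : IsFiniteMeasure ν := ⟨by
    rw [hν, Measure.restrict_apply_univ]; exact hb.measure_lt_top⟩
  let T : 𝓓(Ω, ℝ) →ₗ[ℝ] L2 Ω :=
    { toFun := fun φ => (testFunction_memLp φ).toLp φ
      map_add' := fun φ ψ => rfl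
      map_smul' := fun c φ => rfl }
  have hT : ∀ φ, T φ = (testFunction_memLp φ).toLp φ := fun _ => rfl
  -- Density by orthogonality: an `L²` function annihilating all test functions vanishes almost
  -- everywhere.
  have horth : (LinearMap.range T)ᗮ = ⊥ := by
    rw [Submodule.eq_bot_iff]
    intro v hv
    have hint : ∀ φ : 𝓓(Ω, ℝ), ∫ x in (Ω : Set (Euc N)), φ x * v x = 0 := by
      intro φ
      have h := (Submodule.mem_orthogonal _ _).1 hv (T φ) ⟨φ, rfl⟩
      rw [MeasureTheory.L2.inner_def] at h
      rw [← h]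
      refine integral_congr_ae ?_
      filter_upwards [(testFunction_memLp φ).coeFn_toLp] with x hx
      rw [hT, hx]
      simp [mul_comm]
    have hvi : LocallyIntegrableOn v (Ω : Set (Euc N)) volume :=
      IntegrableOn.locallyIntegrableOn ((Lp.memLp v).integrable (by norm_num))
    have hz := Ω.isOpen.ae_eq_zero_of_integral_contDiff_smul_eq_zero hvi fun g hg hgc hgs => by
      have := hint ⟨g, hg, hgc, hgs⟩
      rw [← this]
      refine (setIntegral_eq_integral_of_forall_compl_eq_zero fun x hx => ?_).symm
      have : x ∉ tsupport g := fun h => hx (hgs h)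
      rw [image_eq_zero_of_notMem_tsupport this, zero_smul]
    rw [Lp.eq_zero_iff_ae_eq_zero]
    exact (ae_restrict_iff' Ω.isOpen.measurableSet).2 hz
  have hdense : hf.toLp f ∈ closure (LinearMap.range T : Set (L2 Ω)) := by
    have := Submodule.topologicalClosure_eq_top_iff.2 horth
    rw [← Submodule.topologicalClosure_coe, this]
    trivial
  obtain ⟨w, hw, hlim⟩ := mem_closure_iff_seq_limit.1 hdense
  choose φ hφ using hw
  refine ⟨φ, ?_⟩
  rw [tendsto_iff_edist_tendsto_0] at hlim
  refine hlim.congr fun n => ?_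
  rw [← hφ n, hT, Lp.edist_toLp_toLp]
  rfl

theorem energy_nonneg {L : TestOperator Ω} (hL : IsPositiveSymmetric L) {u : L2 Ω}
    (hu : u ∈ formDomain L) : 0 ≤ energy L u := by
  obtain ⟨φ, hφ⟩ := hu
  exact ge_of_tendsto' (energy_eq_of_tendsto hL hφ) fun n => hL.2 _

theorem IsFormApprox.tendsto_integral {L : TestOperator Ω} {φ : ℕ → 𝓓(Ω, ℝ)} {u : L2 Ω}
    (hφ : IsFormApprox L φ u) {g : Euc N → ℝ}
    (hg : MemLp g 2 (volume.restrict (Ω : Set (Euc N)))) :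
    Tendsto (fun n => ∫ x in (Ω : Set (Euc N)), φ n x * g x) atTop
      (𝓝 (∫ x in (Ω : Set (Euc N)), u x * g x)) :=
  tendsto_integral_mul_of_eLpNorm (fun n => testFunction_memLp (φ n)) (Lp.memLp u) hg hφ.1

theorem IsSolution.tendsto_testForm {L : TestOperator Ω} {f : 𝓓(Ω, ℝ)} {u : L2 Ω}
    (hu : IsSolution L f u) {φ : ℕ → 𝓓(Ω, ℝ)} (hφ : IsFormApprox L φ u) (ψ : 𝓓(Ω, ℝ)) :
    Tendsto (fun n => testForm L (φ n) ψ) atTop (𝓝 (∫ x in (Ω : Set (Euc N)), f x * ψ x)) := by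
  rw [← hu.2 ψ]
  exact hφ.tendsto_integral (Lp.memLp (L ψ))

/-- The energy of the solution of `𝓛u = f` is at most `∫ f u`. -/
theorem IsSolution.energy_le {L : TestOperator Ω} (hL : IsPositiveSymmetric L) {f : 𝓓(Ω, ℝ)}
    {u : L2 Ω} (hu : IsSolution L f u) :
    energy L u ≤ ∫ x in (Ω : Set (Euc N)), f x * u x := by
  obtain ⟨φ, hφ⟩ := hu.1
  have hE := energy_eq_of_tendsto hL hφ
  have hfu : Tendsto (fun n => ∫ x in (Ω : Set (Euc N)), f x * φ n x) atTop
      (𝓝 (∫ x in (Ω : Set (Euc N)), f x * u x)) := by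
    simp_rw [mul_comm (f _)]
    exact hφ.tendsto_integral (testFunction_memLp f)
  -- As `u` need not be a test function, approximate: `B(φ m, φ n)` tends to `∫ f φ n` as `m → ∞`,
  -- and differs from `B(φ n, φ n)` by at most `ε √B(φ n, φ n)` for large indices.
  have key : ∀ ε : ℝ, 0 < ε →
      energy L u - ε * √(energy L u) ≤ ∫ x in (Ω : Set (Euc N)), f x * u x := by
    intro ε hε
    obtain ⟨k, hk⟩ := hφ.sqrt_cauchy hε
    refine le_of_tendsto_of_tendsto (hE.sub ((hE.sqrt).const_mul ε)) hfu ?_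
    filter_upwards [eventually_ge_atTop k] with n hn
    refine ge_of_tendsto (hu.tendsto_testForm hφ (φ n)) ?_
    filter_upwards [eventually_ge_atTop k] with m hm
    have hsplit : testForm L (φ m) (φ n) =
        testForm L (φ n) (φ n) + testForm L (φ m - φ n) (φ n) := by
      rw [← testForm_add_left]; congr 1; abel
    have hcs := testForm_cauchySchwarz L hL (φ m - φ n) (φ n)
    have h1 := neg_abs_le (testForm L (φ m - φ n) (φ n))
    have h2 : √(testForm L (φ m - φ n) (φ m - φ n)) * √(testForm L (φ n) (φ n)) ≤
        ε * √(testForm L (φ n) (φ n)) :=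
      mul_le_mul_of_nonneg_right (hk m hm n hn).le (Real.sqrt_nonneg _)
    linarith
  have hlim : Tendsto (fun ε : ℝ => energy L u - ε * √(energy L u)) (𝓝[>] 0)
      (𝓝 (energy L u - 0 * √(energy L u))) :=
    (Continuous.tendsto (by fun_prop) 0).mono_left nhdsWithin_le_nhds
  rw [zero_mul, sub_zero] at hlim
  exact le_of_tendsto hlim (eventually_mem_nhdsWithin.mono fun ε hε => key ε hε)

/-- Duality between the energy and the Green operator. -/
theorem IsSolution.sq_integral_mul_le {L : TestOperator Ω} (hL : IsPositiveSymmetric L)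
    {f : 𝓓(Ω, ℝ)} {u : L2 Ω} (hu : IsSolution L f u) {ξ : L2 Ω} (hξ : ξ ∈ formDomain L) :
    (∫ x in (Ω : Set (Euc N)), f x * ξ x) ^ 2 ≤
      energy L ξ * ∫ x in (Ω : Set (Euc N)), f x * u x := by
  obtain ⟨φ, hφ⟩ := hu.1
  obtain ⟨ψ, hψ⟩ := hξ
  have hE := energy_eq_of_tendsto hL hφ
  have hEξ := energy_eq_of_tendsto hL hψ
  have hEu0 := energy_nonneg hL hu.1
  have hEξ0 := energy_nonneg hL ⟨ψ, hψ⟩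
  -- Cauchy–Schwarz for `B(φ n, χ)`, whose limit is `∫ f χ` because `u` solves the equation.
  have h1 : ∀ χ : 𝓓(Ω, ℝ), |∫ x in (Ω : Set (Euc N)), f x * χ x| ≤
      √(energy L u) * √(testForm L χ χ) := fun χ =>
    le_of_tendsto_of_tendsto' (hu.tendsto_testForm hφ χ).abs (hE.sqrt.mul_const _)
      fun n => testForm_cauchySchwarz L hL (φ n) χ
  have hfξ : Tendsto (fun n => ∫ x in (Ω : Set (Euc N)), f x * ψ n x) atTop
      (𝓝 (∫ x in (Ω : Set (Euc N)), f x * ξ x)) := by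
    simp_rw [mul_comm (f _)]
    exact hψ.tendsto_integral (testFunction_memLp f)
  have h2 : |∫ x in (Ω : Set (Euc N)), f x * ξ x| ≤ √(energy L u) * √(energy L ξ) :=
    le_of_tendsto_of_tendsto' hfξ.abs (hEξ.sqrt.const_mul _) fun n => h1 (ψ n)
  have h3 : (∫ x in (Ω : Set (Euc N)), f x * ξ x) ^ 2 ≤ energy L u * energy L ξ := by
    rw [← sq_abs]
    refine (pow_le_pow_left₀ (abs_nonneg _) h2 2).trans (le_of_eq ?_)
    rw [mul_pow, Real.sq_sqrt hEu0, Real.sq_sqrt hEξ0]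
  refine h3.trans ?_
  rw [mul_comm]
  exact mul_le_mul_of_nonneg_left (hu.energy_le hL) hEξ0

end Energy

/-! ### `L²` bounds for the Green operator -/

section L2Bounds

variable {X : Type*} [MeasurableSpace X] {ν : Measure X} {g k : X → X → ℝ≥0∞} {d : X → ℝ≥0∞}
  {p : ℝ} {m : ℕ}

/-- The `L²` norm of an extended nonnegative function. -/
noncomputable def l2norm (ν : Measure X) (f : X → ℝ≥0∞) : ℝ≥0∞ := (∫⁻ x, f x ^ 2 ∂ν) ^ (1 / 2 : ℝ)

theorem l2norm_sq (f : X → ℝ≥0∞) : l2norm ν f ^ 2 = ∫⁻ x, f x ^ 2 ∂ν := by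
  rw [l2norm, ← ENNReal.rpow_natCast, ← ENNReal.rpow_mul]
  norm_num

theorem l2norm_enorm (f : X → ℝ) : l2norm ν (fun x => ‖f x‖ₑ) = eLpNorm f 2 ν := by
  rw [eLpNorm_eq_lintegral_rpow_enorm_toReal (by norm_num) (by norm_num)]
  simp [l2norm]

theorem lintegral_mul_le_l2norm {a b : X → ℝ≥0∞} (ha : Measurable a) (hb : Measurable b) :
    ∫⁻ x, a x * b x ∂ν ≤ l2norm ν a * l2norm ν b := by
  have h := ENNReal.lintegral_mul_le_Lp_mul_Lq ν Real.HolderConjugate.two_two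
    ha.aemeasurable hb.aemeasurable
  simpa [l2norm] using h

/-- From `t ≤ t^p + 1` with `t = k d` the integrand is at most `k^p d^(p+1) + d`, up to the factor
`C d(x)`; both terms have bounded integrals. -/
theorem IsGreenKernel.exists_kerOp_weight_le (H : IsGreenKernel ν g k d p m) (hp : 1 < p) :
    ∃ K : ℝ≥0∞, K ≠ 0 ∧ K ≠ ∞ ∧ ∀ x, kerOp ν g d x ≤ K * d x := by
  obtain ⟨C, hCt, hC⟩ := H.upper
  obtain ⟨M, hMt, hM⟩ := H.integrability' hp
  have hp0 : 0 ≤ p := by linarith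
  set D := ∫⁻ y, d y ∂ν with hD
  refine ⟨C * (M + D) + 1, by simp, ENNReal.add_ne_top.2 ⟨ENNReal.mul_ne_top hCt
    (ENNReal.add_ne_top.2 ⟨hMt, H.lintegral_d⟩), ENNReal.one_ne_top⟩, fun x => ?_⟩
  have hk : Measurable fun y => k y x := H.measurable_k.of_uncurry_right
  calc kerOp ν g d x ≤ ∫⁻ y, C * d x * (k y x ^ p * d y ^ (p + 1) + d y) ∂ν := by
        refine lintegral_mono fun y => ?_
        have h1 : k y x * d y ≤ (k y x * d y) ^ p + 1 := by
          rcases le_total (k y x * d y) 1 with h | h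
          · exact h.trans le_add_self
          · refine le_trans ?_ le_self_add
            conv_lhs => rw [← ENNReal.rpow_one (k y x * d y)]
            exact ENNReal.rpow_le_rpow_of_exponent_le h hp.le
        calc g x y * d y ≤ C * (d x * d y * k x y) * d y := by gcongr; exact hC x y
          _ = C * d x * (k y x * d y * d y) := by rw [H.symm_k x y]; ring
          _ ≤ C * d x * (((k y x * d y) ^ p + 1) * d y) := by gcongr
          _ = _ := by
            rw [ENNReal.mul_rpow_of_nonneg _ _ hp0, ENNReal.rpow_add_of_nonneg _ _ hp0 zero_le_one,
              ENNReal.rpow_one]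
            ring
    _ ≤ C * d x * (M + D) := by
        rw [lintegral_const_mul' _ _ (ENNReal.mul_ne_top hCt (H.d_ne_top x)),
          lintegral_add_right _ H.measurable_d]
        gcongr
        exact hM x
    _ ≤ _ := by
        rw [add_mul]
        refine le_trans (le_of_eq ?_) le_self_add
        ring

/-- Schur's test with `φ = d` and the constant potential `V = 1/K`. -/
theorem IsGreenKernel.exists_l2norm_kerOp_le [SFinite ν] (H : IsGreenKernel ν g k d p m)
    (hp : 1 < p) : ∃ K : ℝ≥0∞, K ≠ ∞ ∧ ∀ f : X → ℝ≥0∞, Measurable f →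
      l2norm ν (kerOp ν g f) ≤ K * l2norm ν f := by
  obtain ⟨K, hK0, hKt, hK⟩ := H.exists_kerOp_weight_le hp
  refine ⟨K, hKt, fun f hf => ?_⟩
  have h := lintegral_mul_kerOp_sq_le H.measurable_g H.symm_g hf H.measurable_d
    H.d_ne_zero (ae_of_all _ H.d_ne_top) (V := fun _ => K⁻¹)
    (ae_of_all _ fun _ => ENNReal.inv_ne_zero.2 hKt) (ae_of_all _ fun _ => ENNReal.inv_ne_top.2 hK0)
    (ae_of_all _ fun x => by
      calc K⁻¹ * kerOp ν g d x ≤ K⁻¹ * (K * d x) := by gcongr; exact hK x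
        _ = d x := by rw [← mul_assoc, ENNReal.inv_mul_cancel hK0 hKt, one_mul])
  rw [lintegral_const_mul' _ _ (ENNReal.inv_ne_top.2 hK0), inv_inv,
    lintegral_mul_const' _ _ hKt] at h
  refine (ENNReal.pow_le_pow_left_iff two_ne_zero).1 ?_
  rw [mul_pow, l2norm_sq, l2norm_sq]
  calc _ = K * (K⁻¹ * ∫⁻ x, kerOp ν g f x ^ 2 ∂ν) := by
        rw [← mul_assoc, ENNReal.mul_inv_cancel hK0 hKt, one_mul]
    _ ≤ K * ((∫⁻ x, f x ^ 2 ∂ν) * K) := by gcongr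
    _ = _ := by ring

/-- Expands the form on `a + b`. With `a = |f|`, `b = |φ n - f|`, `c = |φ n|`, the error vanishes
under `L²` approximation. -/
theorem lintegral_mul_kerOp_add_le [SFinite ν] (hg : Measurable (Function.uncurry g))
    (hs : ∀ x y, g x y = g y x) {K : ℝ≥0∞}
    (hK : ∀ f : X → ℝ≥0∞, Measurable f → l2norm ν (kerOp ν g f) ≤ K * l2norm ν f)
    {a b c : X → ℝ≥0∞} (ha : Measurable a) (hb : Measurable b) (hc : ∀ x, c x ≤ a x + b x) :
    ∫⁻ x, c x * kerOp ν g c x ∂ν ≤ ∫⁻ x, a x * kerOp ν g a x ∂ν +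
      (2 * K * l2norm ν a * l2norm ν b + K * l2norm ν b * l2norm ν b) := by
  have hTa := measurable_kerOp (ν := ν) hg ha
  have hTb := measurable_kerOp (ν := ν) hg hb
  have hbb : ∫⁻ x, b x * kerOp ν g b x ∂ν ≤ K * l2norm ν b * l2norm ν b := by
    refine (lintegral_mul_le_l2norm hb hTb).trans ?_
    rw [mul_comm (K * _)]
    gcongr
    exact hK b hb
  have hab : ∫⁻ x, a x * kerOp ν g b x ∂ν ≤ K * l2norm ν a * l2norm ν b := by
    refine (lintegral_mul_le_l2norm ha hTb).trans ?_
    calc _ ≤ l2norm ν a * (K * l2norm ν b) := by gcongr; exact hK b hb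
      _ = _ := by ring
  have hba : ∫⁻ x, b x * kerOp ν g a x ∂ν = ∫⁻ x, a x * kerOp ν g b x ∂ν :=
    lintegral_mul_kerOp_symm hg hs hb ha
  calc ∫⁻ x, c x * kerOp ν g c x ∂ν
      ≤ ∫⁻ x, (a x * kerOp ν g a x + a x * kerOp ν g b x) +
          (b x * kerOp ν g a x + b x * kerOp ν g b x) ∂ν := by
        refine lintegral_mono fun x => ?_
        have h1 : kerOp ν g c x ≤ kerOp ν g a x + kerOp ν g b x := by
          rw [← kerOp_add hg ha]
          exact kerOp_mono_ae (ae_of_all _ hc) x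
        calc _ ≤ (a x + b x) * (kerOp ν g a x + kerOp ν g b x) := by gcongr; exact hc x
          _ = _ := by ring
    _ = (∫⁻ x, a x * kerOp ν g a x ∂ν + ∫⁻ x, a x * kerOp ν g b x ∂ν) +
          (∫⁻ x, a x * kerOp ν g b x ∂ν + ∫⁻ x, b x * kerOp ν g b x ∂ν) := by
        have hm : Measurable fun x => a x * kerOp ν g a x + a x * kerOp ν g b x :=
          (ha.mul hTa).add (ha.mul hTb)
        have ha' : Measurable fun x => a x * kerOp ν g a x := ha.mul hTa
        have hb' : Measurable fun x => b x * kerOp ν g a x := hb.mul hTa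
        rw [lintegral_add_left hm, lintegral_add_left ha', lintegral_add_left hb', hba]
    _ ≤ (∫⁻ x, a x * kerOp ν g a x ∂ν + K * l2norm ν a * l2norm ν b) +
          (K * l2norm ν a * l2norm ν b + K * l2norm ν b * l2norm ν b) := by gcongr
    _ = _ := by ring

end L2Bounds

/-! ### Duality with the Green operator -/

section Duality

variable {N : ℕ} {Ω : Opens (Euc N)} {L : TestOperator Ω} {G : Euc N → Euc N → ℝ} {s γ p : ℝ}
  {g k : Euc N → Euc N → ℝ≥0∞} {m : ℕ}

theorem ae_mem_and_ne [NullSingletonClass (volume : Measure (Euc N))] (x : Euc N) :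
    ∀ᵐ y ∂volume.restrict (Ω : Set (Euc N)), y ∈ Ω ∧ x ≠ y := by
  filter_upwards [ae_restrict_mem Ω.isOpen.measurableSet,
    ae_restrict_of_ae (Measure.ae_ne (volume : Measure (Euc N)) x)] with y hy hyx
  exact ⟨hy, hyx.symm⟩

theorem lintegral_enorm_green [NullSingletonClass (volume : Measure (Euc N))]
    (hGpos : ∀ x ∈ Ω, ∀ y ∈ Ω, x ≠ y → 0 < G x y)
    (hgG : ∀ x ∈ Ω, ∀ y ∈ Ω, x ≠ y → g x y = ENNReal.ofReal (G x y)) (f : Euc N → ℝ)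
    {x : Euc N} (hx : x ∈ Ω) :
    ∫⁻ y in (Ω : Set (Euc N)), ‖G x y * f y‖ₑ =
      kerOp (volume.restrict (Ω : Set (Euc N))) g (fun y => ‖f y‖ₑ) x := by
  refine lintegral_congr_ae ?_
  filter_upwards [ae_mem_and_ne x] with y hy
  rw [enorm_mul, hgG x hx y hy.1 hy.2, Real.enorm_eq_ofReal (hGpos x hx y hy.1 hy.2).le]

theorem enorm_greenOp_le [NullSingletonClass (volume : Measure (Euc N))]
    (hGpos : ∀ x ∈ Ω, ∀ y ∈ Ω, x ≠ y → 0 < G x y)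
    (hgG : ∀ x ∈ Ω, ∀ y ∈ Ω, x ≠ y → g x y = ENNReal.ofReal (G x y)) (f : Euc N → ℝ)
    {x : Euc N} (hx : x ∈ Ω) :
    ‖greenOp Ω G f x‖ₑ ≤ kerOp (volume.restrict (Ω : Set (Euc N))) g (fun y => ‖f y‖ₑ) x := by
  rw [← lintegral_enorm_green hGpos hgG f hx]
  exact enorm_integral_le_lintegral_enorm _

theorem ofReal_integral_mul_green_le [NullSingletonClass (volume : Measure (Euc N))]
    (hGpos : ∀ x ∈ Ω, ∀ y ∈ Ω, x ≠ y → 0 < G x y)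
    (hgG : ∀ x ∈ Ω, ∀ y ∈ Ω, x ≠ y → g x y = ENNReal.ofReal (G x y)) (f : Euc N → ℝ)
    {u : Euc N → ℝ} (hu : u =ᵐ[volume.restrict (Ω : Set (Euc N))] greenOp Ω G f) :
    ENNReal.ofReal (∫ x in (Ω : Set (Euc N)), f x * u x) ≤ ∫⁻ x in (Ω : Set (Euc N)),
      ‖f x‖ₑ * kerOp (volume.restrict (Ω : Set (Euc N))) g (fun y => ‖f y‖ₑ) x := by
  refine (Real.ofReal_le_enorm _).trans ((enorm_integral_le_lintegral_enorm _).trans ?_)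
  refine lintegral_mono_ae ?_
  filter_upwards [hu, ae_restrict_mem Ω.isOpen.measurableSet] with x hx hxΩ
  rw [enorm_mul, hx]
  gcongr
  exact enorm_greenOp_le hGpos hgG f hxΩ

/-- The pairing of `f` with the solution for `f` is dominated by the kernel form of `|f|`, which the
estimates for nonnegative functions control. -/
theorem enorm_integral_test_sq_le [NullSingletonClass (volume : Measure (Euc N))]
    (hL : IsPositiveSymmetric L) (hG : IsGreenFunction L s γ G)
    (hgG : ∀ x ∈ Ω, ∀ y ∈ Ω, x ≠ y → g x y = ENNReal.ofReal (G x y)) (f : 𝓓(Ω, ℝ))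
    {ξ : L2 Ω} (hξ : ξ ∈ formDomain L) :
    ‖∫ x in (Ω : Set (Euc N)), f x * ξ x‖ₑ ^ 2 ≤ ENNReal.ofReal (energy L ξ) *
      ∫⁻ x in (Ω : Set (Euc N)),
        ‖f x‖ₑ * kerOp (volume.restrict (Ω : Set (Euc N))) g (fun y => ‖f y‖ₑ) x := by
  obtain ⟨u, hu, hs⟩ := hG.solves f
  have h := ((hs u).2 rfl).sq_integral_mul_le hL hξ
  have h1 := ENNReal.ofReal_le_ofReal h
  rw [ENNReal.ofReal_mul (energy_nonneg hL hξ)] at h1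
  calc _ = ENNReal.ofReal ((∫ x in (Ω : Set (Euc N)), f x * ξ x) ^ 2) := by
        rw [← sq_abs, ENNReal.ofReal_pow (abs_nonneg _), Real.enorm_eq_ofReal_abs]
    _ ≤ _ := h1
    _ ≤ _ := by gcongr; exact ofReal_integral_mul_green_le hG.pos hgG f hu

/-- Both sides pass to the limit along test functions converging to `f` in `L²`, as `𝔾` is bounded
there. Discontinuous `f`, such as truncations of `V ξ`, become available. -/
theorem enorm_integral_sq_le [NullSingletonClass (volume : Measure (Euc N))]
    (hb : Bornology.IsBounded (Ω : Set (Euc N)))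
    (hL : IsPositiveSymmetric L) (hG : IsGreenFunction L s γ G)
    (hgG : ∀ x ∈ Ω, ∀ y ∈ Ω, x ≠ y → g x y = ENNReal.ofReal (G x y))
    (H : IsGreenKernel (volume.restrict (Ω : Set (Euc N))) g k (bweight Ω γ) p m) (hp : 1 < p)
    {f : Euc N → ℝ} (hfm : Measurable f) (hf : MemLp f 2 (volume.restrict (Ω : Set (Euc N))))
    {ξ : L2 Ω} (hξ : ξ ∈ formDomain L) :
    ‖∫ x in (Ω : Set (Euc N)), f x * ξ x‖ₑ ^ 2 ≤ ENNReal.ofReal (energy L ξ) *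
      ∫⁻ x in (Ω : Set (Euc N)),
        ‖f x‖ₑ * kerOp (volume.restrict (Ω : Set (Euc N))) g (fun y => ‖f y‖ₑ) x := by
  set ν := volume.restrict (Ω : Set (Euc N)) with hν
  obtain ⟨K, hKt, hK⟩ := H.exists_l2norm_kerOp_le hp
  obtain ⟨φ, hφ⟩ := exists_testFunction_tendsto hb hf
  set e : ℕ → ℝ≥0∞ := fun n => eLpNorm (fun x => φ n x - f x) 2 ν with he
  have hlhs : Tendsto (fun n => ‖∫ x, φ n x * ξ x ∂ν‖ₑ ^ 2) atTop
      (𝓝 (‖∫ x, f x * ξ x ∂ν‖ₑ ^ 2)) :=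
    ((ENNReal.continuous_pow 2).tendsto _).comp ((continuous_enorm.tendsto _).comp
      (tendsto_integral_mul_of_eLpNorm (fun n => testFunction_memLp (φ n)) hf (Lp.memLp ξ) hφ))
  set A := eLpNorm f 2 ν with hA
  have hAt : A ≠ ∞ := hf.2.ne
  have hrhs : Tendsto (fun n => ENNReal.ofReal (energy L ξ) *
      (∫⁻ x, ‖f x‖ₑ * kerOp ν g (fun y => ‖f y‖ₑ) x ∂ν + (2 * K * A * e n + K * e n * e n)))
      atTop (𝓝 (ENNReal.ofReal (energy L ξ) *
        (∫⁻ x, ‖f x‖ₑ * kerOp ν g (fun y => ‖f y‖ₑ) x ∂ν + (2 * K * A * 0 + K * 0 * 0)))) := by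
    have hKe : Tendsto (fun n => K * e n) atTop (𝓝 (K * 0)) :=
      ENNReal.Tendsto.const_mul hφ (Or.inr hKt)
    refine ENNReal.Tendsto.const_mul (tendsto_const_nhds.add ((ENNReal.Tendsto.const_mul hφ
      (Or.inr (ENNReal.mul_ne_top (ENNReal.mul_ne_top (by norm_num) hKt) hAt))).add
      (ENNReal.Tendsto.mul hKe (Or.inr (by simp)) hφ (Or.inr (by simp)))))
      (Or.inr ENNReal.ofReal_ne_top)
  simp only [mul_zero, add_zero] at hrhs
  refine le_of_tendsto_of_tendsto' hlhs hrhs fun n => ?_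
  refine (enorm_integral_test_sq_le hL hG hgG (φ n) hξ).trans ?_
  gcongr
  have hφm : Measurable (φ n) := (φ n).continuous.measurable
  have h := lintegral_mul_kerOp_add_le H.measurable_g H.symm_g hK (a := fun x => ‖f x‖ₑ)
    (b := fun x => ‖φ n x - f x‖ₑ) (c := fun x => ‖φ n x‖ₑ) hfm.enorm (hφm.sub hfm).enorm
    (fun x => by
      calc ‖φ n x‖ₑ = ‖f x + (φ n x - f x)‖ₑ := by rw [add_sub_cancel]
        _ ≤ _ := enorm_add_le _ _)
  rw [l2norm_enorm, l2norm_enorm] at h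
  exact h

/-- A bound for the quadratic form of the Green operator yields a weighted Hardy-type inequality
on the energy space. -/
theorem lintegral_mul_enorm_sq_le_energy [NullSingletonClass (volume : Measure (Euc N))]
    (hb : Bornology.IsBounded (Ω : Set (Euc N)))
    (hL : IsPositiveSymmetric L) (hG : IsGreenFunction L s γ G)
    (hgG : ∀ x ∈ Ω, ∀ y ∈ Ω, x ≠ y → g x y = ENNReal.ofReal (G x y))
    (H : IsGreenKernel (volume.restrict (Ω : Set (Euc N))) g k (bweight Ω γ) p m) (hp : 1 < p)
    {V : Euc N → ℝ≥0∞} (hV : Measurable V)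
    (hVt : ∀ᵐ x ∂volume.restrict (Ω : Set (Euc N)), V x ≠ ∞)
    (hform : ∀ f : Euc N → ℝ≥0∞, Measurable f →
      ∫⁻ x in (Ω : Set (Euc N)), f x * kerOp (volume.restrict (Ω : Set (Euc N))) g f x ≤
        ∫⁻ x in (Ω : Set (Euc N)), f x ^ 2 * (V x)⁻¹)
    {ξ : L2 Ω} (hξ : ξ ∈ formDomain L) :
    ∫⁻ x in (Ω : Set (Euc N)), V x * ‖ξ x‖ₑ ^ 2 ≤ ENNReal.ofReal (energy L ξ) := by
  set ν := volume.restrict (Ω : Set (Euc N)) with hν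
  obtain ⟨ζ, hζm, hζ⟩ := (Lp.aestronglyMeasurable ξ).aemeasurable
  have hζ2 : MemLp ζ 2 ν := (memLp_congr_ae hζ).1 (Lp.memLp ξ)
  set S : ℕ → Set (Euc N) := fun j => {x | V x ≤ j} with hS
  have hSm : ∀ j, MeasurableSet (S j) := fun j => measurableSet_le hV measurable_const
  set F : ℕ → Euc N → ℝ≥0∞ := fun j => (S j).indicator fun x => V x * ‖ζ x‖ₑ ^ 2 with hF
  have hFm : ∀ j, Measurable (F j) := fun j =>
    (hV.mul (hζm.enorm.pow_const 2)).indicator (hSm j)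
  have hFmono : Monotone F := by
    intro i j hij x
    refine indicator_le_indicator_of_subset (fun y hy => ?_) (fun _ => zero_le) x
    exact le_trans (show V y ≤ i from hy) (by exact_mod_cast hij)
  have hζint : ∫⁻ x, ‖ζ x‖ₑ ^ 2 ∂ν ≠ ∞ := by
    rw [← l2norm_sq, l2norm_enorm]
    exact ENNReal.pow_ne_top hζ2.2.ne
  have hFle : ∀ j, ∫⁻ x, F j x ∂ν ≤ ENNReal.ofReal (energy L ξ) := by
    intro j
    -- The extremal choice `f = V ξ` in the duality inequality, cut off where `V > j`. Then `∫ f ξ`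
    -- equals `I = ∫ F j`, while the form of `|f|` is at most `I`. So `I² ≤ ‖ξ‖² I`, and the cutoff
    -- makes `I` finite, hence cancellable.
    set f : Euc N → ℝ := (S j).indicator fun x => (V x).toReal * ζ x with hf
    have hfm : Measurable f := (hV.ennreal_toReal.mul hζm).indicator (hSm j)
    have hVj : ∀ x ∈ S j, V x ≠ ∞ := fun x hx =>
      ne_top_of_le_ne_top (ENNReal.natCast_ne_top j) hx
    have hfe : ∀ x, ‖f x‖ₑ = (S j).indicator (fun x => V x * ‖ζ x‖ₑ) x := by
      intro x
      by_cases hx : x ∈ S j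
      · rw [hf, indicator_of_mem hx, indicator_of_mem hx, enorm_mul,
          Real.enorm_eq_ofReal ENNReal.toReal_nonneg, ENNReal.ofReal_toReal (hVj x hx)]
      · rw [hf, indicator_of_notMem hx, indicator_of_notMem hx, enorm_zero]
    have hf2 : MemLp f 2 ν := by
      refine MemLp.of_le_mul (c := j) hζ2 hfm.aestronglyMeasurable (ae_of_all _ fun x => ?_)
      by_cases hx : x ∈ S j
      · rw [hf, indicator_of_mem hx, norm_mul, Real.norm_of_nonneg ENNReal.toReal_nonneg]
        gcongr
        exact ENNReal.toReal_le_of_le_ofReal (by positivity)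
          (by rw [ENNReal.ofReal_natCast]; exact hx)
      · rw [hf, indicator_of_notMem hx, norm_zero]; positivity
    have hI : ‖∫ x, f x * ξ x ∂ν‖ₑ = ∫⁻ x, F j x ∂ν := by
      have e : ∫ x, f x * ξ x ∂ν = ∫ x, f x * ζ x ∂ν :=
        integral_congr_ae (hζ.mono fun x hx => by simp only [hx])
      have h0 : ∀ x, 0 ≤ f x * ζ x := by
        intro x
        by_cases hx : x ∈ S j
        · rw [hf, indicator_of_mem hx, mul_assoc]
          exact mul_nonneg ENNReal.toReal_nonneg (mul_self_nonneg _)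
        · rw [hf, indicator_of_notMem hx, zero_mul]
      have hint : Integrable (fun x => f x * ζ x) ν := hf2.integrable_mul hζ2
      rw [e, Real.enorm_eq_ofReal (integral_nonneg h0),
        ofReal_integral_eq_lintegral_ofReal hint (ae_of_all _ h0)]
      refine lintegral_congr fun x => ?_
      rw [← Real.enorm_eq_ofReal (h0 x), enorm_mul, hfe, hF]
      by_cases hx : x ∈ S j
      · simp only [indicator_of_mem hx]; ring
      · simp only [indicator_of_notMem hx, zero_mul]
    have hQ : ∫⁻ x, ‖f x‖ₑ * kerOp ν g (fun y => ‖f y‖ₑ) x ∂ν ≤ ∫⁻ x, F j x ∂ν := by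
      refine (hform _ hfm.enorm).trans (lintegral_mono fun x => ?_)
      rw [hfe, hF]
      by_cases hx : x ∈ S j
      · simp only [indicator_of_mem hx]
        rcases eq_or_ne (V x) 0 with h0 | h0
        · simp [h0]
        · refine le_of_eq ?_
          calc _ = V x * (V x)⁻¹ * (V x * ‖ζ x‖ₑ ^ 2) := by ring
            _ = _ := by rw [ENNReal.mul_inv_cancel h0 (hVj x hx), one_mul]
      · simp only [indicator_of_notMem hx]; simp
    have hfin : ∫⁻ x, F j x ∂ν ≠ ∞ := by
      refine ne_top_of_le_ne_top (ENNReal.mul_ne_top (ENNReal.natCast_ne_top j) hζint) ?_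
      rw [← lintegral_const_mul' _ _ (ENNReal.natCast_ne_top j)]
      refine lintegral_mono fun x => ?_
      by_cases hx : x ∈ S j
      · simp only [hF, indicator_of_mem hx]
        gcongr
        exact hx
      · simp only [hF, indicator_of_notMem hx]; exact zero_le
    have key := enorm_integral_sq_le hb hL hG hgG H hp hfm hf2 hξ
    rw [hI, sq] at key
    have key2 := key.trans (mul_le_mul_right hQ _)
    rcases eq_or_ne (∫⁻ x, F j x ∂ν) 0 with h0 | h0
    · rw [h0]; exact zero_le
    · exact (ENNReal.mul_le_mul_iff_left h0 hfin).1 key2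
  have hsup : ∫⁻ x, V x * ‖ξ x‖ₑ ^ 2 ∂ν = ∫⁻ x, ⨆ j, F j x ∂ν := by
    refine lintegral_congr_ae ?_
    filter_upwards [hVt, hζ] with x hx hxζ
    rw [hxζ]
    refine le_antisymm ?_ (iSup_le fun j => indicator_le_self' (fun _ _ => zero_le) x)
    obtain ⟨j, hj⟩ := ENNReal.exists_nat_gt hx
    refine le_iSup_of_le j ?_
    simp only [hF]
    rw [indicator_of_mem (show x ∈ S j from hj.le)]
  rw [hsup, lintegral_iSup hFm hFmono]
  exact iSup_le hFle

end Duality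

/-! ### From the energy space back to weighted bounds on the Green operator. -/

section Duality

variable {N : ℕ} {Ω : Opens (Euc N)} {L : TestOperator Ω} {G : Euc N → Euc N → ℝ} {s γ p : ℝ}
  {g k : Euc N → Euc N → ℝ≥0∞} {m : ℕ}

theorem aestronglyMeasurable_green [NullSingletonClass (volume : Measure (Euc N))]
    (hGpos : ∀ x ∈ Ω, ∀ y ∈ Ω, x ≠ y → 0 < G x y)
    (hgG : ∀ x ∈ Ω, ∀ y ∈ Ω, x ≠ y → g x y = ENNReal.ofReal (G x y))
    (hg : Measurable (Function.uncurry g)) {x : Euc N} (hx : x ∈ Ω) :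
    AEStronglyMeasurable (G x) (volume.restrict (Ω : Set (Euc N))) := by
  have hgx : Measurable (g x) := hg.of_uncurry_left
  refine hgx.ennreal_toReal.aestronglyMeasurable.congr ?_
  filter_upwards [ae_mem_and_ne x] with y hy
  rw [hgG x hx y hy.1 hy.2, ENNReal.toReal_ofReal (hGpos x hx y hy.1 hy.2).le]

theorem integrable_green_mul [NullSingletonClass (volume : Measure (Euc N))]
    (hGpos : ∀ x ∈ Ω, ∀ y ∈ Ω, x ≠ y → 0 < G x y)
    (hgG : ∀ x ∈ Ω, ∀ y ∈ Ω, x ≠ y → g x y = ENNReal.ofReal (G x y))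
    (hg : Measurable (Function.uncurry g)) {f : Euc N → ℝ}
    (hf : AEStronglyMeasurable f (volume.restrict (Ω : Set (Euc N)))) {x : Euc N} (hx : x ∈ Ω)
    (ht : kerOp (volume.restrict (Ω : Set (Euc N))) g (fun y => ‖f y‖ₑ) x ≠ ∞) :
    Integrable (fun y => G x y * f y) (volume.restrict (Ω : Set (Euc N))) := by
  refine ⟨(aestronglyMeasurable_green hGpos hgG hg hx).mul hf, ?_⟩
  rw [hasFiniteIntegral_iff_enorm, lintegral_enorm_green hGpos hgG f hx]
  exact lt_top_iff_ne_top.2 ht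

theorem kerOp_eq_enorm_greenOp [NullSingletonClass (volume : Measure (Euc N))]
    (hGpos : ∀ x ∈ Ω, ∀ y ∈ Ω, x ≠ y → 0 < G x y)
    (hgG : ∀ x ∈ Ω, ∀ y ∈ Ω, x ≠ y → g x y = ENNReal.ofReal (G x y))
    (hg : Measurable (Function.uncurry g)) {f : Euc N → ℝ}
    (hf : AEStronglyMeasurable f (volume.restrict (Ω : Set (Euc N)))) (hf0 : ∀ x, 0 ≤ f x)
    {x : Euc N} (hx : x ∈ Ω)
    (ht : kerOp (volume.restrict (Ω : Set (Euc N))) g (fun y => ‖f y‖ₑ) x ≠ ∞) :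
    kerOp (volume.restrict (Ω : Set (Euc N))) g (fun y => ‖f y‖ₑ) x =
      ENNReal.ofReal (greenOp Ω G f x) := by
  have hint := integrable_green_mul hGpos hgG hg hf hx ht
  have h0 : 0 ≤ᵐ[volume.restrict (Ω : Set (Euc N))] fun y => G x y * f y := by
    filter_upwards [ae_mem_and_ne x] with y hy
    exact mul_nonneg (hGpos x hx y hy.1 hy.2).le (hf0 y)
  rw [greenOp, ofReal_integral_eq_lintegral_ofReal hint h0, ← lintegral_enorm_green hGpos hgG f hx]
  exact lintegral_congr_ae (h0.mono fun y hy => Real.enorm_eq_ofReal hy)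

/-- Write `𝔾f = 𝔾φ - 𝔾[φ - f]` and take absolute values only in the error term. The signed `𝔾φ` must
be kept, because for a test function `φ` it is the solution lying in the energy space. -/
theorem kerOp_le_enorm_greenOp_add [NullSingletonClass (volume : Measure (Euc N))]
    (hGpos : ∀ x ∈ Ω, ∀ y ∈ Ω, x ≠ y → 0 < G x y)
    (hgG : ∀ x ∈ Ω, ∀ y ∈ Ω, x ≠ y → g x y = ENNReal.ofReal (G x y))
    (hg : Measurable (Function.uncurry g)) {f φ : Euc N → ℝ} (hf : Measurable f)
    (hφ : Measurable φ) (hf0 : ∀ x, 0 ≤ f x) {x : Euc N} (hx : x ∈ Ω)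
    (ht : kerOp (volume.restrict (Ω : Set (Euc N))) g (fun y => ‖φ y‖ₑ) x ≠ ∞) :
    kerOp (volume.restrict (Ω : Set (Euc N))) g (fun y => ‖f y‖ₑ) x ≤ ‖greenOp Ω G φ x‖ₑ +
      kerOp (volume.restrict (Ω : Set (Euc N))) g (fun y => ‖φ y - f y‖ₑ) x := by
  set ν := volume.restrict (Ω : Set (Euc N)) with hν
  rcases eq_or_ne (kerOp ν g (fun y => ‖φ y - f y‖ₑ) x) ∞ with h | h
  · rw [h]; simp
  have hle : kerOp ν g (fun y => ‖f y‖ₑ) x ≤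
      kerOp ν g (fun y => ‖φ y‖ₑ) x + kerOp ν g (fun y => ‖φ y - f y‖ₑ) x := by
    rw [← kerOp_add hg hφ.enorm]
    refine kerOp_mono_ae (ae_of_all _ fun y => ?_) x
    calc ‖f y‖ₑ = ‖φ y - (φ y - f y)‖ₑ := by rw [sub_sub_cancel]
      _ ≤ _ := enorm_sub_le
  have hft : kerOp ν g (fun y => ‖f y‖ₑ) x ≠ ∞ :=
    ne_top_of_le_ne_top (ENNReal.add_ne_top.2 ⟨ht, h⟩) hle
  have hφi := integrable_green_mul hGpos hgG hg hφ.aestronglyMeasurable hx ht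
  have hdi := integrable_green_mul (f := fun y => φ y - f y) hGpos hgG hg
    (hφ.sub hf).aestronglyMeasurable hx h
  have e : greenOp Ω G f x = greenOp Ω G φ x - greenOp Ω G (fun y => φ y - f y) x := by
    rw [greenOp, greenOp, greenOp, ← integral_sub hφi hdi]
    congr 1; ext y; ring
  rw [kerOp_eq_enorm_greenOp hGpos hgG hg hf.aestronglyMeasurable hf0 hx hft, e]
  refine (Real.ofReal_le_enorm _).trans (enorm_sub_le.trans ?_)
  gcongr
  exact enorm_greenOp_le hGpos hgG _ hx

theorem l2norm_add_le {X : Type*} [MeasurableSpace X] {ν : Measure X} {a b : X → ℝ≥0∞}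
    (ha : AEMeasurable a ν) (hb : AEMeasurable b ν) :
    l2norm ν (fun x => a x + b x) ≤ l2norm ν a + l2norm ν b := by
  have h := ENNReal.lintegral_Lp_add_le ha hb (p := 2) (by norm_num)
  simpa [l2norm] using h

/-- A Hardy-type inequality on the energy space with constant `θ` bounds the Green operator in the
weighted `L²` space. -/
theorem lintegral_mul_kerOp_sq_le_of_energy [NullSingletonClass (volume : Measure (Euc N))]
    (hb : Bornology.IsBounded (Ω : Set (Euc N)))
    (hL : IsPositiveSymmetric L) (hG : IsGreenFunction L s γ G)
    (hgG : ∀ x ∈ Ω, ∀ y ∈ Ω, x ≠ y → g x y = ENNReal.ofReal (G x y))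
    (H : IsGreenKernel (volume.restrict (Ω : Set (Euc N))) g k (bweight Ω γ) p m) (hp : 1 < p)
    {V : Euc N → ℝ≥0∞} (hV : Measurable V)
    (hV0 : ∀ᵐ x ∂volume.restrict (Ω : Set (Euc N)), V x ≠ 0)
    (hVt : ∀ᵐ x ∂volume.restrict (Ω : Set (Euc N)), V x ≠ ∞) {θ : ℝ≥0∞} (hθ : θ ≠ ∞)
    (hE : ∀ ξ ∈ formDomain L, ∫⁻ x in (Ω : Set (Euc N)), V x * ‖ξ x‖ₑ ^ 2 ≤
      θ * ENNReal.ofReal (energy L ξ)) {f : Euc N → ℝ≥0∞} (hf : Measurable f) :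
    ∫⁻ x in (Ω : Set (Euc N)), V x * kerOp (volume.restrict (Ω : Set (Euc N))) g f x ^ 2 ≤
      θ ^ 2 * ∫⁻ x in (Ω : Set (Euc N)), f x ^ 2 * (V x)⁻¹ := by
  set ν := volume.restrict (Ω : Set (Euc N)) with hν
  have : IsFiniteMeasure ν := ⟨by
    rw [hν, Measure.restrict_apply_univ]; exact hb.measure_lt_top⟩
  have hg := H.measurable_g
  obtain ⟨K, hKt, hK⟩ := H.exists_l2norm_kerOp_le hp
  -- smooth right-hand sides
  have htest : ∀ φ : 𝓓(Ω, ℝ), ∀ u : L2 Ω, IsSolution L φ u → u =ᵐ[ν] greenOp Ω G φ →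
      ∫⁻ x, V x * ‖u x‖ₑ ^ 2 ∂ν ≤
        θ * ∫⁻ x, ‖φ x‖ₑ * kerOp ν g (fun y => ‖φ y‖ₑ) x ∂ν := by
    intro φ u hs hu
    refine (hE u hs.1).trans ?_
    gcongr
    exact (ENNReal.ofReal_le_ofReal (hs.energy_le hL)).trans
      (ofReal_integral_mul_green_le hG.pos hgG φ hu)
  -- bounded truncations of the weight
  have htrunc : ∀ f : Euc N → ℝ, Measurable f → (∀ x, 0 ≤ f x) → MemLp f 2 ν → ∀ j : ℕ,
      ∫⁻ x, min (V x) j * kerOp ν g (fun y => ‖f y‖ₑ) x ^ 2 ∂ν ≤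
        θ * ∫⁻ x, ‖f x‖ₑ * kerOp ν g (fun y => ‖f y‖ₑ) x ∂ν := by
    intro f hfm hf0 hf j
    obtain ⟨φ, hφ⟩ := exists_testFunction_tendsto hb hf
    set e : ℕ → ℝ≥0∞ := fun n => eLpNorm (fun x => φ n x - f x) 2 ν with he
    set A := eLpNorm f 2 ν with hA
    have hAt : A ≠ ∞ := hf.2.ne
    set q := ∫⁻ x, ‖f x‖ₑ * kerOp ν g (fun y => ‖f y‖ₑ) x ∂ν with hq
    set W : Euc N → ℝ≥0∞ := fun x => min (V x) j with hW
    have hWm : Measurable W := hV.min measurable_const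
    set νW := ν.withDensity W with hνW
    have hac : νW ≪ ν := withDensity_absolutelyContinuous ν W
    have hsq : ∀ c : Euc N → ℝ≥0∞, AEMeasurable c ν →
        l2norm νW c ^ 2 = ∫⁻ x, W x * c x ^ 2 ∂ν := by
      intro c hc
      rw [l2norm_sq, hνW, lintegral_withDensity_eq_lintegral_mul₀ hWm.aemeasurable (hc.pow_const 2)]
      rfl
    have hTm : ∀ c : Euc N → ℝ≥0∞, Measurable c → Measurable (kerOp ν g c) :=
      fun c hc => measurable_kerOp hg hc
    -- Minkowski in `L²(W)`. The solution for `φ n` is controlled by the energy inequality, and the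
    -- error `𝔾|φ n - f|` by the unweighted `L²` bound, for which `W ≤ j` is needed.
    have hbound : ∀ n, l2norm νW (kerOp ν g (fun y => ‖f y‖ₑ)) ≤
        (θ * (q + (2 * K * A * e n + K * e n * e n))) ^ (1 / 2 : ℝ) + j * (K * e n) := by
      intro n
      have hφm : Measurable (φ n) := (φ n).continuous.measurable
      obtain ⟨u, hu, hs⟩ := hG.solves (φ n)
      have hum : AEMeasurable (fun x => ‖u x‖ₑ) ν := (Lp.aestronglyMeasurable u).enorm
      have hdm : Measurable (kerOp ν g fun y => ‖φ n y - f y‖ₑ) := hTm _ (hφm.sub hfm).enorm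
      have hfin : ∀ᵐ x ∂ν, kerOp ν g (fun y => ‖φ n y‖ₑ) x ≠ ∞ := by
        have h1 : ∫⁻ x, kerOp ν g (fun y => ‖φ n y‖ₑ) x ^ 2 ∂ν ≠ ∞ := by
          rw [← l2norm_sq]
          refine ENNReal.pow_ne_top (ne_top_of_le_ne_top ?_ (hK _ hφm.enorm))
          rw [l2norm_enorm]
          exact ENNReal.mul_ne_top hKt (testFunction_memLp (φ n)).2.ne
        filter_upwards [ae_lt_top ((hTm _ hφm.enorm).pow_const 2) h1] with x hx hxt
        simp [hxt] at hx
      have hpt : ∀ᵐ x ∂νW, kerOp ν g (fun y => ‖f y‖ₑ) x ≤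
          ‖u x‖ₑ + kerOp ν g (fun y => ‖φ n y - f y‖ₑ) x := by
        refine hac.ae_le ?_
        filter_upwards [hfin, hu, ae_restrict_mem Ω.isOpen.measurableSet] with x hx hux hxΩ
        rw [hux]
        exact kerOp_le_enorm_greenOp_add hG.pos hgG hg hfm hφm hf0 hxΩ hx
      have h1 : l2norm νW (fun x => ‖u x‖ₑ) ≤
          (θ * (q + (2 * K * A * e n + K * e n * e n))) ^ (1 / 2 : ℝ) := by
        have h2 : l2norm νW (fun x => ‖u x‖ₑ) =
            (∫⁻ x, W x * ‖u x‖ₑ ^ 2 ∂ν) ^ (1 / 2 : ℝ) := by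
          rw [← hsq _ hum, ← ENNReal.rpow_natCast, ← ENNReal.rpow_mul]
          norm_num
        rw [h2]
        refine ENNReal.rpow_le_rpow ?_ (by norm_num)
        calc ∫⁻ x, W x * ‖u x‖ₑ ^ 2 ∂ν ≤ ∫⁻ x, V x * ‖u x‖ₑ ^ 2 ∂ν :=
              lintegral_mono fun x => mul_le_mul_left (min_le_left _ _) _
          _ ≤ θ * ∫⁻ x, ‖φ n x‖ₑ * kerOp ν g (fun y => ‖φ n y‖ₑ) x ∂ν :=
              htest (φ n) u ((hs u).2 rfl) hu
          _ ≤ _ := by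
              gcongr
              have h := lintegral_mul_kerOp_add_le hg H.symm_g hK (a := fun x => ‖f x‖ₑ)
                (b := fun x => ‖φ n x - f x‖ₑ) (c := fun x => ‖φ n x‖ₑ) hfm.enorm
                (hφm.sub hfm).enorm (fun x => by
                  calc ‖φ n x‖ₑ = ‖f x + (φ n x - f x)‖ₑ := by rw [add_sub_cancel]
                    _ ≤ _ := enorm_add_le _ _)
              rw [l2norm_enorm, l2norm_enorm] at h
              exact h
      have h3 : l2norm νW (kerOp ν g fun y => ‖φ n y - f y‖ₑ) ≤ j * (K * e n) := by
        refine (ENNReal.pow_le_pow_left_iff two_ne_zero).1 ?_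
        rw [hsq _ hdm.aemeasurable]
        have h4 := hK _ (hφm.sub hfm).enorm
        have h5 : l2norm ν (fun x => ‖(φ n - f) x‖ₑ) = e n := l2norm_enorm _
        calc ∫⁻ x, W x * kerOp ν g (fun y => ‖φ n y - f y‖ₑ) x ^ 2 ∂ν
            ≤ ∫⁻ x, (j : ℝ≥0∞) * kerOp ν g (fun y => ‖φ n y - f y‖ₑ) x ^ 2 ∂ν :=
              lintegral_mono fun x => mul_le_mul_left (min_le_right _ _) _
          _ = j * l2norm ν (kerOp ν g fun y => ‖φ n y - f y‖ₑ) ^ 2 := by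
              rw [lintegral_const_mul' _ _ (ENNReal.natCast_ne_top j), l2norm_sq]
          _ ≤ j ^ 2 * (K * e n) ^ 2 := by
              rw [← h5]
              gcongr
              · exact_mod_cast Nat.le_self_pow two_ne_zero j
              · exact h4
          _ = _ := by ring
      calc l2norm νW (kerOp ν g (fun y => ‖f y‖ₑ))
          ≤ l2norm νW (fun x => ‖u x‖ₑ + kerOp ν g (fun y => ‖φ n y - f y‖ₑ) x) := by
            refine ENNReal.rpow_le_rpow (lintegral_mono_ae ?_) (by norm_num)
            filter_upwards [hpt] with x hx
            gcongr
        _ ≤ _ := l2norm_add_le (hum.mono_ac hac) hdm.aemeasurable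
        _ ≤ _ := add_le_add h1 h3
    have hlim : Tendsto (fun n => (θ * (q + (2 * K * A * e n + K * e n * e n))) ^ (1 / 2 : ℝ) +
        j * (K * e n)) atTop
        (𝓝 ((θ * (q + (2 * K * A * 0 + K * 0 * 0))) ^ (1 / 2 : ℝ) + j * (K * 0))) := by
      have hKe : Tendsto (fun n => K * e n) atTop (𝓝 (K * 0)) :=
        ENNReal.Tendsto.const_mul hφ (Or.inr hKt)
      refine Tendsto.add ((ENNReal.continuous_rpow_const.tendsto _).comp
        (ENNReal.Tendsto.const_mul (tendsto_const_nhds.add ((ENNReal.Tendsto.const_mul hφ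
          (Or.inr (ENNReal.mul_ne_top (ENNReal.mul_ne_top (by norm_num) hKt) hAt))).add
          (ENNReal.Tendsto.mul hKe (Or.inr (by simp)) hφ (Or.inr (by simp))))) (Or.inr hθ)))
        (ENNReal.Tendsto.const_mul hKe (Or.inr (ENNReal.natCast_ne_top j)))
    simp only [mul_zero, add_zero] at hlim
    have hfinal := ge_of_tendsto' hlim hbound
    have h6 := pow_le_pow_left' hfinal 2
    rw [hsq _ (hTm _ hfm.enorm).aemeasurable, ← ENNReal.rpow_natCast, ← ENNReal.rpow_mul] at h6
    norm_num at h6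
    exact h6
  -- bounded functions
  have hbdd : ∀ f : Euc N → ℝ, Measurable f → (∀ x, 0 ≤ f x) → MemLp f 2 ν →
      ∫⁻ x, V x * kerOp ν g (fun y => ‖f y‖ₑ) x ^ 2 ∂ν ≤
        θ ^ 2 * ∫⁻ x, ‖f x‖ₑ ^ 2 * (V x)⁻¹ ∂ν := by
    intro f hfm hf0 hf
    set q := ∫⁻ x, ‖f x‖ₑ * kerOp ν g (fun y => ‖f y‖ₑ) x ∂ν with hq
    set I := ∫⁻ x, ‖f x‖ₑ ^ 2 * (V x)⁻¹ ∂ν with hI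
    have hTm : Measurable (kerOp ν g fun y => ‖f y‖ₑ) := measurable_kerOp hg hfm.enorm
    have hVq : ∫⁻ x, V x * kerOp ν g (fun y => ‖f y‖ₑ) x ^ 2 ∂ν ≤ θ * q := by
      have e : ∫⁻ x, V x * kerOp ν g (fun y => ‖f y‖ₑ) x ^ 2 ∂ν =
          ∫⁻ x, ⨆ j : ℕ, min (V x) j * kerOp ν g (fun y => ‖f y‖ₑ) x ^ 2 ∂ν := by
        refine lintegral_congr_ae ?_
        filter_upwards [hVt] with x hx
        refine le_antisymm ?_ (iSup_le fun j => mul_le_mul_left (min_le_left _ _) _)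
        obtain ⟨j, hj⟩ := ENNReal.exists_nat_gt hx
        refine le_iSup_of_le j ?_
        rw [min_eq_left hj.le]
      have hmeas : ∀ j : ℕ, Measurable fun x =>
          min (V x) (j : ℝ≥0∞) * kerOp ν g (fun y => ‖f y‖ₑ) x ^ 2 :=
        fun j => (hV.min measurable_const).mul (hTm.pow_const 2)
      rw [e, lintegral_iSup hmeas]
      · exact iSup_le (htrunc f hfm hf0 hf)
      · intro i j hij x
        exact mul_le_mul_left (min_le_min_left _ (by exact_mod_cast hij)) _
    have hqt : q ≠ ∞ := by
      refine ne_top_of_le_ne_top ?_ (lintegral_mul_le_l2norm hfm.enorm hTm)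
      have hft : l2norm ν (fun x => ‖f x‖ₑ) ≠ ∞ := by rw [l2norm_enorm]; exact hf.2.ne
      exact ENNReal.mul_ne_top hft (ne_top_of_le_ne_top (ENNReal.mul_ne_top hKt hft)
        (hK _ hfm.enorm))
    -- Cauchy–Schwarz gives `q² ≤ I ∫ V (𝔾f)² ≤ θ I q`, and the finite `q` is cancelled. Combined
    -- with `hVq` this produces the factor `θ²`.
    have hqI : q ≤ θ * I := by
      have hcs := sq_lintegral_mul_le (ν := ν) hfm.enorm hTm hV.inv
        (hVt.mono fun x hx => by simpa using hx) (hV0.mono fun x hx => by simpa using hx)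
      have e : ∫⁻ x, kerOp ν g (fun y => ‖f y‖ₑ) x ^ 2 * (V⁻¹ x)⁻¹ ∂ν =
          ∫⁻ x, V x * kerOp ν g (fun y => ‖f y‖ₑ) x ^ 2 ∂ν :=
        lintegral_congr fun x => by rw [Pi.inv_apply, inv_inv, mul_comm]
      rw [e] at hcs
      have h1 : q * q ≤ θ * I * q := by
        calc q * q = q ^ 2 := (sq q).symm
          _ ≤ I * _ := hcs
          _ ≤ I * (θ * q) := by gcongr
          _ = _ := by ring
      rcases eq_or_ne q 0 with h0 | h0
      · rw [h0]; exact zero_le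
      · exact (ENNReal.mul_le_mul_iff_left h0 hqt).1 h1
    calc _ ≤ θ * q := hVq
      _ ≤ θ * (θ * I) := by gcongr
      _ = _ := by ring
  -- general functions
  set F : ℕ → Euc N → ℝ≥0∞ := fun n x => min (f x) n with hF
  have hFm : ∀ n, Measurable (F n) := fun n => hf.min measurable_const
  have hFmono : Monotone F := fun i j hij x => min_le_min_left _ (by exact_mod_cast hij)
  have hFle : ∀ n, ∫⁻ x, V x * kerOp ν g (F n) x ^ 2 ∂ν ≤
      θ ^ 2 * ∫⁻ x, f x ^ 2 * (V x)⁻¹ ∂ν := by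
    intro n
    have hnt : ∀ x, F n x ≠ ∞ := fun x =>
      ne_top_of_le_ne_top (ENNReal.natCast_ne_top n) (min_le_right _ _)
    have he : ∀ x, ‖(F n x).toReal‖ₑ = F n x := fun x => by
      rw [Real.enorm_eq_ofReal ENNReal.toReal_nonneg, ENNReal.ofReal_toReal (hnt x)]
    have h2 : MemLp (fun x => (F n x).toReal) 2 ν := by
      refine MemLp.of_bound (hFm n).ennreal_toReal.aestronglyMeasurable n (ae_of_all _ fun x => ?_)
      rw [Real.norm_of_nonneg ENNReal.toReal_nonneg]
      exact ENNReal.toReal_le_of_le_ofReal (by positivity)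
        (by rw [ENNReal.ofReal_natCast]; exact min_le_right _ _)
    have := hbdd _ (hFm n).ennreal_toReal (fun x => ENNReal.toReal_nonneg) h2
    simp only [he] at this
    refine this.trans ?_
    gcongr with x
    exact min_le_left _ _
  have hsup : ∀ x, ⨆ n, F n x = f x := by
    intro x
    refine le_antisymm (iSup_le fun n => min_le_left _ _) ?_
    rcases eq_or_ne (f x) ∞ with h | h
    · simp only [hF, h, min_eq_right le_top, ENNReal.iSup_natCast, le_refl]
    · obtain ⟨n, hn⟩ := ENNReal.exists_nat_gt h
      refine le_iSup_of_le n ?_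
      simp only [hF, min_eq_left hn.le, le_refl]
  have hk : ∀ x, kerOp ν g f x = ⨆ n, kerOp ν g (F n) x := by
    intro x
    rw [← kerOp_iSup hg hFm hFmono]
    simp only [hsup]
  have hkmono : ∀ x, Monotone fun n => kerOp ν g (F n) x :=
    fun x i j hij => kerOp_mono_ae (ae_of_all _ (hFmono hij)) x
  have e : ∀ x, V x * kerOp ν g f x ^ 2 = ⨆ n, V x * kerOp ν g (F n) x ^ 2 := by
    intro x
    rw [hk, ← ENNReal.mul_iSup]
    congr 1
    simp only [← ENNReal.rpow_natCast]
    exact rpow_iSup_nat (by norm_num)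
  have hmeas : ∀ n, Measurable fun x => V x * kerOp ν g (F n) x ^ 2 :=
    fun n => hV.mul ((measurable_kerOp hg (hFm n)).pow_const 2)
  simp only [e]
  rw [lintegral_iSup hmeas]
  · exact iSup_le hFle
  · intro i j hij x
    exact mul_le_mul_right (pow_le_pow_left' (hkmono x hij) 2) _

end Duality

/-! ### Weak-dual solutions and the integral equation -/

section WeakDual

variable {N : ℕ} {Ω : Opens (Euc N)} {G : Euc N → Euc N → ℝ} {γ p : ℝ}
  {g k : Euc N → Euc N → ℝ≥0∞} {m : ℕ} {μ : Measure (Euc N)}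

/-- On `Ω` the measure `δ^γ μ` is finite, and `μ` is recovered from it by the density `δ^(-γ)`. This
makes Tonelli available for `μ`. -/
theorem sFinite_restrict_of_weight (hf : (frontier (Ω : Set (Euc N))).Nonempty)
    (hμ : ∫⁻ x in (Ω : Set (Euc N)), bweight Ω γ x ∂μ = 1) :
    SFinite (μ.restrict (Ω : Set (Euc N))) := by
  have hd := measurable_bweight Ω γ
  have h0 : ∀ᵐ x ∂μ.restrict (Ω : Set (Euc N)), bweight Ω γ x ≠ 0 := by
    filter_upwards [ae_restrict_mem Ω.isOpen.measurableSet] with x hx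
    have := Real.rpow_pos_of_pos (bdist_pos hf hx) γ
    simpa [bweight] using this
  have hfin : IsFiniteMeasure ((μ.restrict (Ω : Set (Euc N))).withDensity (bweight Ω γ)) :=
    isFiniteMeasure_withDensity (by rw [hμ]; exact ENNReal.one_ne_top)
  rw [← withDensity_inv_same hd h0 (ae_of_all _ fun x => ENNReal.ofReal_ne_top)]
  infer_instance

/-- Integrals against `δ^γ v` with `v ≥ 0` bounded. -/
theorem weakDual_integrals [NullSingletonClass (volume : Measure (Euc N))]
    (hGpos : ∀ x ∈ Ω, ∀ y ∈ Ω, x ≠ y → 0 < G x y)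
    (hgG : ∀ x ∈ Ω, ∀ y ∈ Ω, x ≠ y → g x y = ENNReal.ofReal (G x y))
    (H : IsGreenKernel (volume.restrict (Ω : Set (Euc N))) g k (bweight Ω γ) p m) (hp : 1 < p)
    [SFinite (μ.restrict (Ω : Set (Euc N)))]
    (hμ : ∫⁻ x in (Ω : Set (Euc N)), bweight Ω γ x ∂μ = 1)
    {u : Euc N → ℝ} {U : Euc N → ℝ≥0∞} (hU : Measurable U)
    (huU : u =ᵐ[volume.restrict (Ω : Set (Euc N))] fun x => (U x).toReal)
    (hA : ∫⁻ x in (Ω : Set (Euc N)), U x ^ p * bweight Ω γ x ≠ ∞)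
    {v : Euc N → ℝ} (hv : Measurable v) (hv0 : ∀ x, 0 ≤ v x) {B : ℝ} (hvB : ∀ x, v x ≤ B)
    {ξ : Euc N → ℝ} (hξ : ∀ x, ξ x = bdist Ω x ^ γ * v x) {ξ' : Euc N → ℝ≥0∞}
    (hξ' : ∀ x, ξ' x = ENNReal.ofReal (ξ x)) :
    (∀ x ∈ Ω, Integrable (fun y => G x y * ξ y) (volume.restrict (Ω : Set (Euc N)))) ∧
    (IntegrableOn (fun x => u x * ξ x) (Ω : Set (Euc N)) ∧
      ∫⁻ x in (Ω : Set (Euc N)), ξ' x * U x ≠ ∞ ∧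
      ∫ x in (Ω : Set (Euc N)), u x * ξ x =
        (∫⁻ x in (Ω : Set (Euc N)), ξ' x * U x).toReal) ∧
    (IntegrableOn (fun x => u x ^ p * greenOp Ω G ξ x) (Ω : Set (Euc N)) ∧
      ∫⁻ x in (Ω : Set (Euc N)), ξ' x *
        kerOp (volume.restrict (Ω : Set (Euc N))) g (fun y => U y ^ p) x ≠ ∞ ∧
      ∫ x in (Ω : Set (Euc N)), u x ^ p * greenOp Ω G ξ x =
        (∫⁻ x in (Ω : Set (Euc N)), ξ' x *
          kerOp (volume.restrict (Ω : Set (Euc N))) g (fun y => U y ^ p) x).toReal) ∧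
    (IntegrableOn (fun x => greenOp Ω G ξ x) (Ω : Set (Euc N)) μ ∧
      ∫⁻ x in (Ω : Set (Euc N)), ξ' x * kerPot g (μ.restrict (Ω : Set (Euc N))) x ≠ ∞ ∧
      ∫ x in (Ω : Set (Euc N)), greenOp Ω G ξ x ∂μ =
        (∫⁻ x in (Ω : Set (Euc N)), ξ' x *
          kerPot g (μ.restrict (Ω : Set (Euc N))) x).toReal) := by
  set ν := volume.restrict (Ω : Set (Euc N)) with hν
  set d := bweight Ω γ with hd
  have hp0 : 0 < p := by linarith
  have hg := H.measurable_g
  obtain ⟨K, hK0, hKt, hK⟩ := H.exists_kerOp_weight_le hp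
  have hξ0 : ∀ x, 0 ≤ ξ x := fun x => by
    rw [hξ]; exact mul_nonneg (Real.rpow_nonneg (bdist_nonneg Ω x) γ) (hv0 x)
  have hξm : Measurable ξ := by
    rw [funext hξ]
    exact ((continuous_bdist Ω).measurable.pow_const γ).mul hv
  have hξ'm : Measurable ξ' := by
    rw [funext hξ']; exact hξm.ennreal_ofReal
  have hξe : (fun x => ‖ξ x‖ₑ) = ξ' := by
    ext x; rw [hξ', Real.enorm_eq_ofReal (hξ0 x)]
  have hξd : ∀ x, ξ' x ≤ ENNReal.ofReal B * d x := fun x => by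
    rw [hξ', hξ, mul_comm, ENNReal.ofReal_mul (hv0 x)]
    exact mul_le_mul_left (ENNReal.ofReal_le_ofReal (hvB x)) _
  -- Since `𝔾[δ^γ]` is at most a multiple of `δ^γ`, the dual side is integrable against `u^p` and
  -- against `μ`.
  have hTd : ∀ x, kerOp ν g ξ' x ≤ ENNReal.ofReal B * K * d x := fun x => by
    calc _ ≤ kerOp ν g (fun y => ENNReal.ofReal B * d y) x := kerOp_mono_ae (ae_of_all _ hξd) x
      _ = ENNReal.ofReal B * kerOp ν g d x := kerOp_const_mul hg H.measurable_d _ x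
      _ ≤ ENNReal.ofReal B * (K * d x) := by gcongr; exact hK x
      _ = _ := by ring
  have hBK : ENNReal.ofReal B * K ≠ ∞ := ENNReal.mul_ne_top ENNReal.ofReal_ne_top hKt
  have hTt : ∀ x, kerOp ν g ξ' x ≠ ∞ := fun x =>
    ne_top_of_le_ne_top (ENNReal.mul_ne_top hBK (H.d_ne_top x)) (hTd x)
  have hTm : Measurable (kerOp ν g ξ') := measurable_kerOp hg hξ'm
  have hgreen : ∀ x ∈ Ω, greenOp Ω G ξ x = (kerOp ν g ξ' x).toReal := by
    intro x hx
    have h := kerOp_eq_enorm_greenOp hGpos hgG hg hξm.aestronglyMeasurable hξ0 hx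
      (by rw [hξe]; exact hTt x)
    rw [← hν, hξe] at h
    have h0 : 0 ≤ greenOp Ω G ξ x := by
      refine integral_nonneg_of_ae ?_
      filter_upwards [ae_mem_and_ne x] with y hy
      exact mul_nonneg (hGpos x hx y hy.1 hy.2).le (hξ0 y)
    rw [h, ENNReal.toReal_ofReal h0]
  have hUt := H.ae_ne_top_of_mass hp0 hU.aemeasurable hA
  have hΩae : ∀ π : Measure (Euc N), ∀ᵐ x ∂π.restrict (Ω : Set (Euc N)), x ∈ Ω :=
    fun π => ae_restrict_mem Ω.isOpen.measurableSet
  have hUp : Measurable fun x => U x ^ p := hU.pow_const p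
  have htoReal : ∀ {π : Measure (Euc N)} {F : Euc N → ℝ≥0∞} {w : Euc N → ℝ}, Measurable F →
      ∫⁻ x, F x ∂π ≠ ∞ → w =ᵐ[π] (fun x => (F x).toReal) →
      Integrable w π ∧ ∫ x, w x ∂π = (∫⁻ x, F x ∂π).toReal := by
    intro π F w hF hFt hw
    refine ⟨(integrable_toReal_of_lintegral_ne_top hF.aemeasurable hFt).congr hw.symm, ?_⟩
    rw [integral_congr_ae hw, integral_toReal hF.aemeasurable (ae_lt_top hF hFt)]
  refine ⟨fun x hx => integrable_green_mul hGpos hgG hg hξm.aestronglyMeasurable hx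
    (by rw [← hν, hξe]; exact hTt x), ?_, ?_, ?_⟩
  · have hfin : ∫⁻ x, ξ' x * U x ∂ν ≠ ∞ := by
      refine ne_top_of_le_ne_top (ENNReal.mul_ne_top (ENNReal.ofReal_ne_top (r := B))
        (ENNReal.add_ne_top.2 ⟨hA, H.lintegral_d⟩)) ?_
      rw [← lintegral_add_right _ H.measurable_d, ← lintegral_const_mul' _ _ ENNReal.ofReal_ne_top]
      refine lintegral_mono fun x => ?_
      have h1 : U x ≤ U x ^ p + 1 := by
        rcases le_total (U x) 1 with h | h
        · exact h.trans le_add_self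
        · refine le_trans ?_ le_self_add
          conv_lhs => rw [← ENNReal.rpow_one (U x)]
          exact ENNReal.rpow_le_rpow_of_exponent_le h hp.le
      calc ξ' x * U x ≤ ENNReal.ofReal B * d x * (U x ^ p + 1) := by gcongr; exact hξd x
        _ = _ := by ring
    have h := htoReal (w := fun x => u x * ξ x) (hξ'm.mul hU) hfin (by
      filter_upwards [huU] with x hx
      rw [hx, Pi.mul_apply, ENNReal.toReal_mul, hξ', ENNReal.toReal_ofReal (hξ0 x), mul_comm])
    exact ⟨h.1, hfin, h.2⟩
  · have hsymm : ∫⁻ x, ξ' x * kerOp ν g (fun y => U y ^ p) x ∂ν =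
        ∫⁻ x, U x ^ p * kerOp ν g ξ' x ∂ν :=
      lintegral_mul_kerOp_symm hg H.symm_g hξ'm hUp
    rw [hsymm]
    have hfin : ∫⁻ x, U x ^ p * kerOp ν g ξ' x ∂ν ≠ ∞ := by
      refine ne_top_of_le_ne_top (ENNReal.mul_ne_top hBK hA) ?_
      rw [← lintegral_const_mul' _ _ hBK]
      refine lintegral_mono fun x => ?_
      calc _ ≤ U x ^ p * (ENNReal.ofReal B * K * d x) := by gcongr; exact hTd x
        _ = _ := by ring
    have h := htoReal (w := fun x => u x ^ p * greenOp Ω G ξ x) (hUp.mul hTm) hfin (by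
      filter_upwards [huU, hΩae volume] with x hx hxΩ
      rw [hx, Pi.mul_apply, ENNReal.toReal_mul, hgreen x hxΩ, ENNReal.toReal_rpow])
    exact ⟨h.1, hfin, h.2⟩
  · have hswap : ∫⁻ x, ξ' x * kerPot g (μ.restrict (Ω : Set (Euc N))) x ∂ν =
        ∫⁻ x in (Ω : Set (Euc N)), kerOp ν g ξ' x ∂μ := by
      unfold kerOp
      have hm2 : Measurable (Function.uncurry fun x y => g x y * ξ' y) :=
        hg.mul (hξ'm.comp measurable_snd)
      rw [lintegral_lintegral_swap hm2.aemeasurable]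
      refine lintegral_congr fun y => ?_
      have hgy : Measurable fun x => g x y := hg.of_uncurry_right
      rw [lintegral_mul_const _ hgy, mul_comm, kerPot]
      simp only [H.symm_g y]
    rw [hswap]
    have hfin : ∫⁻ x in (Ω : Set (Euc N)), kerOp ν g ξ' x ∂μ ≠ ∞ := by
      refine ne_top_of_le_ne_top hBK ?_
      calc _ ≤ ∫⁻ x in (Ω : Set (Euc N)), ENNReal.ofReal B * K * d x ∂μ := lintegral_mono hTd
        _ = _ := by rw [lintegral_const_mul' _ _ hBK, hμ, mul_one]
    have h := htoReal (w := fun x => greenOp Ω G ξ x) hTm hfin (by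
      filter_upwards [hΩae μ] with x hxΩ
      rw [hgreen x hxΩ])
    exact ⟨h.1, hfin, h.2⟩

/-- Weak-dual solutions solve the integral equation almost everywhere. -/
theorem IsPositiveWeakDualSolution.exists_eq [NullSingletonClass (volume : Measure (Euc N))]
    (hGpos : ∀ x ∈ Ω, ∀ y ∈ Ω, x ≠ y → 0 < G x y)
    (hgG : ∀ x ∈ Ω, ∀ y ∈ Ω, x ≠ y → g x y = ENNReal.ofReal (G x y))
    (H : IsGreenKernel (volume.restrict (Ω : Set (Euc N))) g k (bweight Ω γ) p m) (hp : 1 < p)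
    [SFinite (μ.restrict (Ω : Set (Euc N)))]
    (hμ : ∫⁻ x in (Ω : Set (Euc N)), bweight Ω γ x ∂μ = 1) {lam : ℝ} (hlam : 0 < lam)
    {u : Euc N → ℝ} (hu : IsPositiveWeakDualSolution Ω γ G μ p lam u) :
    ∃ U : Euc N → ℝ≥0∞, Measurable U ∧
      (∀ᵐ x ∂volume.restrict (Ω : Set (Euc N)), U x = ENNReal.ofReal (u x)) ∧
      ∫⁻ x in (Ω : Set (Euc N)), U x ^ p * bweight Ω γ x ≠ ∞ ∧
      ∀ᵐ x ∂volume.restrict (Ω : Set (Euc N)),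
        U x = kerOp (volume.restrict (Ω : Set (Euc N))) g (fun y => U y ^ p) x +
          ENNReal.ofReal lam * kerPot g (μ.restrict (Ω : Set (Euc N))) x := by
  set ν := volume.restrict (Ω : Set (Euc N)) with hν
  have hp0 : 0 < p := by linarith
  have hg := H.measurable_g
  obtain ⟨u', hu'm, hu'⟩ := hu.aestronglyMeasurable.aemeasurable
  set U : Euc N → ℝ≥0∞ := fun x => ENNReal.ofReal (u' x) with hU
  have hUm : Measurable U := hu'm.ennreal_ofReal
  have hUu : ∀ᵐ x ∂ν, U x = ENNReal.ofReal (u x) := by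
    filter_upwards [hu'] with x hx
    rw [hU, hx]
  have huU : u =ᵐ[ν] fun x => (U x).toReal := by
    filter_upwards [hUu, hu.pos] with x hx hpos
    rw [hx, ENNReal.toReal_ofReal hpos.le]
  have hA : ∫⁻ x, U x ^ p * bweight Ω γ x ∂ν ≠ ∞ := by
    have h := hu.integrable.2
    rw [hasFiniteIntegral_iff_enorm] at h
    refine ne_of_eq_of_ne (lintegral_congr_ae ?_) h.ne
    filter_upwards [hUu, hu.pos] with x hx hpos
    rw [hx, ENNReal.ofReal_rpow_of_pos hpos, bweight, ← ENNReal.ofReal_mul (by positivity),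
      abs_of_pos hpos, Real.enorm_eq_ofReal
        (mul_nonneg (by positivity) (Real.rpow_nonneg (bdist_nonneg Ω x) γ))]
  refine ⟨U, hUm, hUu, hA, ?_⟩
  set h := kerPot g (μ.restrict (Ω : Set (Euc N))) with hh
  have hhm : Measurable h := measurable_kerPot hg
  have hTm : Measurable (kerOp ν g fun y => U y ^ p) := measurable_kerOp hg (hUm.pow_const p)
  have hRm : Measurable fun x => kerOp ν g (fun y => U y ^ p) x + ENNReal.ofReal lam * h x :=
    hTm.add (hhm.const_mul _)
  have hdm := H.measurable_d
  have hae : (fun x => bweight Ω γ x * U x) =ᵐ[ν] fun x => bweight Ω γ x *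
      (kerOp ν g (fun y => U y ^ p) x + ENNReal.ofReal lam * h x) := by
    -- The admissible functions `δ^γ 1_E`, with symmetry of the kernel, identify both sides after
    -- multiplication by `δ^γ`; this factor is positive and finite, and is cancelled at the end.
    refine ae_eq_of_forall_setLIntegral_eq_of_sigmaFinite (hdm.mul hUm) (hdm.mul hRm)
      fun E hE _ => ?_
    set v : Euc N → ℝ := E.indicator fun _ => 1 with hv
    have hvm : Measurable v := measurable_const.indicator hE
    have hv0 : ∀ x, 0 ≤ v x := fun x => indicator_nonneg (fun _ _ => zero_le_one) x
    have hv1 : ∀ x, v x ≤ 1 := fun x => indicator_le_self' (fun _ _ => zero_le_one) x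
    set ξ : Euc N → ℝ := fun x => bdist Ω x ^ γ * v x with hξ
    set ξ' : Euc N → ℝ≥0∞ := fun x => ENNReal.ofReal (ξ x) with hξ'
    have hξE : ∀ x, ξ' x = E.indicator (bweight Ω γ) x := by
      intro x
      by_cases hx : x ∈ E
      · simp [hξ', hξ, hv, indicator_of_mem hx, bweight]
      · simp [hξ', hξ, hv, indicator_of_notMem hx]
    obtain ⟨-, ⟨-, f1, e1⟩, ⟨-, f2, e2⟩, ⟨-, f3, e3⟩⟩ := weakDual_integrals hGpos hgG H hp hμ hUm
      huU hA hvm hv0 hv1 (ξ := ξ) (fun x => rfl) (ξ' := ξ') (fun x => rfl)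
    have heq := hu.eqn ξ ⟨v, memLp_top_of_bound hvm.aestronglyMeasurable 1 (ae_of_all _ fun x => by
      rw [Real.norm_of_nonneg (hv0 x)]; exact hv1 x), fun x _ => rfl⟩
    rw [e1, e2, e3] at heq
    have hle : ENNReal.ofReal lam * ∫⁻ x, ξ' x * h x ∂ν ≠ ∞ :=
      ENNReal.mul_ne_top ENNReal.ofReal_ne_top f3
    have hX : ∫⁻ x, ξ' x * U x ∂ν = ∫⁻ x, ξ' x * kerOp ν g (fun y => U y ^ p) x ∂ν +
        ENNReal.ofReal lam * ∫⁻ x, ξ' x * h x ∂ν := by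
      rw [← ENNReal.toReal_eq_toReal_iff' f1 (ENNReal.add_ne_top.2 ⟨f2, hle⟩),
        ENNReal.toReal_add f2 hle, ENNReal.toReal_mul, ENNReal.toReal_ofReal hlam.le]
      exact heq
    have hind : ∀ F : Euc N → ℝ≥0∞,
        ∫⁻ x in E, bweight Ω γ x * F x ∂ν = ∫⁻ x, ξ' x * F x ∂ν := by
      intro F
      rw [← lintegral_indicator hE]
      refine lintegral_congr fun x => ?_
      rw [hξE]
      by_cases hx : x ∈ E
      · simp [indicator_of_mem hx]
      · simp [indicator_of_notMem hx]
    rw [hind, hind, hX]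
    have hξ'm : Measurable ξ' := by
      rw [funext hξE]; exact hdm.indicator hE
    have hm1 : Measurable fun x => ξ' x * kerOp ν g (fun y => U y ^ p) x := hξ'm.mul hTm
    rw [← lintegral_const_mul' _ _ ENNReal.ofReal_ne_top, ← lintegral_add_left hm1]
    refine lintegral_congr fun x => ?_
    ring
  filter_upwards [hae, H.d_ne_zero] with x hx hd
  exact (ENNReal.mul_right_inj hd (H.d_ne_top x)).1 hx

/-- Solutions of the integral equation of finite weighted mass are weak-dual solutions. -/
theorem isPositiveWeakDualSolution_of_eq [NullSingletonClass (volume : Measure (Euc N))]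
    (hGpos : ∀ x ∈ Ω, ∀ y ∈ Ω, x ≠ y → 0 < G x y)
    (hgG : ∀ x ∈ Ω, ∀ y ∈ Ω, x ≠ y → g x y = ENNReal.ofReal (G x y))
    (H : IsGreenKernel (volume.restrict (Ω : Set (Euc N))) g k (bweight Ω γ) p m) (hp : 1 < p)
    [SFinite (μ.restrict (Ω : Set (Euc N)))]
    (hμ : ∫⁻ x in (Ω : Set (Euc N)), bweight Ω γ x ∂μ = 1) {lam : ℝ} (hlam : 0 < lam)
    {U : Euc N → ℝ≥0∞} (hU : Measurable U)
    (hA : ∫⁻ x in (Ω : Set (Euc N)), U x ^ p * bweight Ω γ x ≠ ∞)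
    (hUe : ∀ᵐ x ∂volume.restrict (Ω : Set (Euc N)),
        U x = kerOp (volume.restrict (Ω : Set (Euc N))) g (fun y => U y ^ p) x +
          ENNReal.ofReal lam * kerPot g (μ.restrict (Ω : Set (Euc N))) x) :
    IsPositiveWeakDualSolution Ω γ G μ p lam fun x => (U x).toReal := by
  set ν := volume.restrict (Ω : Set (Euc N)) with hν
  have hp0 : 0 < p := by linarith
  have hg := H.measurable_g
  have hUt := H.ae_ne_top_of_mass hp0 hU.aemeasurable hA
  set h := kerPot g (μ.restrict (Ω : Set (Euc N))) with hh
  have hhm : Measurable h := measurable_kerPot hg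
  have hTm : Measurable (kerOp ν g fun y => U y ^ p) := measurable_kerOp hg (hU.pow_const p)
  refine ⟨?_, hU.ennreal_toReal.aestronglyMeasurable, ?_, fun ξ hξ => ?_⟩
  · filter_upwards [hUt, hUe, H.kerPot_ne_zero hμ] with x ht he h0
    refine ENNReal.toReal_pos ?_ ht
    rw [he]
    intro hz
    exact mul_ne_zero (by simpa using hlam) h0 (add_eq_zero.1 hz).2
  · have hm : Measurable fun x => U x ^ p * bweight Ω γ x := (hU.pow_const p).mul H.measurable_d
    refine (integrable_toReal_of_lintegral_ne_top hm.aemeasurable hA).congr (ae_of_all _ fun x => ?_)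
    simp only
    rw [abs_of_nonneg ENNReal.toReal_nonneg, ENNReal.toReal_mul, ENNReal.toReal_rpow, bweight,
      ENNReal.toReal_ofReal (Real.rpow_nonneg (bdist_nonneg Ω x) γ)]
  · obtain ⟨v, hv, hξv⟩ := hξ
    -- a bounded measurable representative of `v`
    obtain ⟨v₁, hv₁m, hv₁⟩ := hv.1.aemeasurable
    set B : ℝ := (eLpNorm v ∞ ν).toReal with hB
    have hvB : ∀ᵐ x ∂ν, |v x| ≤ B := by
      have hlt : eLpNormEssSup v ν ≠ ∞ := by
        have := hv.2.ne
        rwa [eLpNorm_exponent_top] at this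
      filter_upwards [enorm_ae_le_eLpNormEssSup v ν] with x hx
      rw [hB, eLpNorm_exponent_top, ← Real.norm_eq_abs, ← toReal_enorm]
      exact ENNReal.toReal_mono hlt hx
    have hB0 : 0 ≤ B := ENNReal.toReal_nonneg
    -- Positive and negative parts are treated separately. Clipping at the essential bound `B` makes
    -- them bounded everywhere and alters them only on a null set.
    set vp : Euc N → ℝ := fun x => min (max (v₁ x) 0) B with hvp
    set vn : Euc N → ℝ := fun x => min (max (-v₁ x) 0) B with hvn
    have hvpm : Measurable vp := (hv₁m.max measurable_const).min measurable_const
    have hvnm : Measurable vn := (hv₁m.neg.max measurable_const).min measurable_const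
    have hvpn : ∀ᵐ x ∂ν, v x = vp x - vn x := by
      filter_upwards [hv₁, hvB] with x hx hxB
      rw [hx, abs_le] at hxB
      simp only [hvp, hvn]
      rw [hx, min_eq_left (max_le hxB.2 hB0), min_eq_left (max_le (by linarith) hB0)]
      rcases le_total (v₁ x) 0 with hs | hs
      · rw [max_eq_right hs, max_eq_left (by linarith)]; ring
      · rw [max_eq_left hs, max_eq_right (by linarith)]; ring
    set ξp : Euc N → ℝ := fun x => bdist Ω x ^ γ * vp x with hξp
    set ξn : Euc N → ℝ := fun x => bdist Ω x ^ γ * vn x with hξn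
    have hξe : ∀ᵐ x ∂ν, ξ x = ξp x - ξn x := by
      filter_upwards [hvpn, ae_restrict_mem Ω.isOpen.measurableSet] with x hx hxΩ
      rw [hξv x hxΩ, hx, hξp, hξn]; ring
    obtain ⟨gp, ⟨ip1, fp1, ep1⟩, ⟨ip2, fp2, ep2⟩, ⟨ip3, fp3, ep3⟩⟩ :=
      weakDual_integrals (u := fun x => (U x).toReal) hGpos hgG H hp hμ hU (ae_of_all _ fun x => rfl)
      hA hvpm (fun x => le_min (le_max_right _ _) hB0) (fun x => min_le_right _ _)
      (ξ := ξp) (fun x => rfl) (fun x => rfl)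
    obtain ⟨gn, ⟨in1, fn1, en1⟩, ⟨in2, fn2, en2⟩, ⟨in3, fn3, en3⟩⟩ :=
      weakDual_integrals (u := fun x => (U x).toReal) hGpos hgG H hp hμ hU (ae_of_all _ fun x => rfl)
      hA hvnm (fun x => le_min (le_max_right _ _) hB0) (fun x => min_le_right _ _)
      (ξ := ξn) (fun x => rfl) (fun x => rfl)
    have hgreen : ∀ x ∈ Ω, greenOp Ω G ξ x = greenOp Ω G ξp x - greenOp Ω G ξn x := by
      intro x hx
      rw [greenOp, greenOp, greenOp, ← integral_sub (gp x hx) (gn x hx)]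
      refine integral_congr_ae (hξe.mono fun y hy => ?_)
      simp only
      rw [hy]; ring
    have hsplit : ∀ ζ : Euc N → ℝ≥0∞, Measurable ζ →
        ∫⁻ x, ζ x * kerOp ν g (fun y => U y ^ p) x ∂ν ≠ ∞ → ∫⁻ x, ζ x * h x ∂ν ≠ ∞ →
        (∫⁻ x, ζ x * U x ∂ν).toReal = (∫⁻ x, ζ x * kerOp ν g (fun y => U y ^ p) x ∂ν).toReal +
          lam * (∫⁻ x, ζ x * h x ∂ν).toReal := by
      intro ζ hζ h2 h3
      have hm1 : Measurable fun x => ζ x * kerOp ν g (fun y => U y ^ p) x := hζ.mul hTm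
      have e : ∫⁻ x, ζ x * U x ∂ν = ∫⁻ x, ζ x * kerOp ν g (fun y => U y ^ p) x ∂ν +
          ENNReal.ofReal lam * ∫⁻ x, ζ x * h x ∂ν := by
        rw [← lintegral_const_mul' _ _ ENNReal.ofReal_ne_top, ← lintegral_add_left hm1]
        refine lintegral_congr_ae (hUe.mono fun x hx => ?_)
        simp only
        conv_lhs => rw [hx]
        ring
      rw [e, ENNReal.toReal_add h2 (ENNReal.mul_ne_top ENNReal.ofReal_ne_top h3),
        ENNReal.toReal_mul, ENNReal.toReal_ofReal hlam.le]
    have hbm : Measurable fun x : Euc N => bdist Ω x ^ γ :=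
      (continuous_bdist Ω).measurable.pow_const γ
    have hpm : Measurable fun x => ENNReal.ofReal (ξp x) := (hbm.mul hvpm).ennreal_ofReal
    have hnm : Measurable fun x => ENNReal.ofReal (ξn x) := (hbm.mul hvnm).ennreal_ofReal
    have hsub : ∀ a b c a' b' c' : ℝ, a = b + lam * c → a' = b' + lam * c' →
        a - a' = b - b' + lam * (c - c') := by
      intros; linarith
    have E1 : ∫ x, (U x).toReal * ξ x ∂ν =
        ∫ x, (U x).toReal * ξp x ∂ν - ∫ x, (U x).toReal * ξn x ∂ν := by
      rw [← integral_sub ip1 in1]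
      refine integral_congr_ae (hξe.mono fun x hx => ?_)
      simp only
      rw [hx]; ring
    have E2 : ∫ x, (U x).toReal ^ p * greenOp Ω G ξ x ∂ν =
        ∫ x, (U x).toReal ^ p * greenOp Ω G ξp x ∂ν -
          ∫ x, (U x).toReal ^ p * greenOp Ω G ξn x ∂ν := by
      rw [← integral_sub ip2 in2]
      refine setIntegral_congr_fun Ω.isOpen.measurableSet fun x hx => ?_
      rw [hgreen x hx]; ring
    have E3 : ∫ x in (Ω : Set (Euc N)), greenOp Ω G ξ x ∂μ =
        ∫ x in (Ω : Set (Euc N)), greenOp Ω G ξp x ∂μ -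
          ∫ x in (Ω : Set (Euc N)), greenOp Ω G ξn x ∂μ := by
      rw [← integral_sub ip3 in3]
      exact setIntegral_congr_fun Ω.isOpen.measurableSet fun x hx => hgreen x hx
    rw [E1, E2, E3, ep1, ep2, ep3, en1, en2, en3]
    exact hsub _ _ _ _ _ _ (hsplit _ hpm fp2 fp3) (hsplit _ hnm fn2 fn3)

end WeakDual

/-! ### The extremal parameter -/

section Extremal

variable {N : ℕ} {Ω : Opens (Euc N)} {G : Euc N → Euc N → ℝ} {s γ p : ℝ}
  {g k : Euc N → Euc N → ℝ≥0∞} {m : ℕ} {μ : Measure (Euc N)}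

/-- Any solution dominates `minSol` and so bounds its mass; conversely `minSol` of finite mass is
itself a solution. Since `minSol` is monotone in the parameter, solvability passes to smaller
positive parameters. -/
theorem mem_solvableParams_iff [NullSingletonClass (volume : Measure (Euc N))]
    (hGpos : ∀ x ∈ Ω, ∀ y ∈ Ω, x ≠ y → 0 < G x y)
    (hgG : ∀ x ∈ Ω, ∀ y ∈ Ω, x ≠ y → g x y = ENNReal.ofReal (G x y))
    (H : IsGreenKernel (volume.restrict (Ω : Set (Euc N))) g k (bweight Ω γ) p m) (hp : 1 < p)
    [SFinite (μ.restrict (Ω : Set (Euc N)))]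
    (hμ : ∫⁻ x in (Ω : Set (Euc N)), bweight Ω γ x ∂μ = 1) {lam : ℝ} :
    lam ∈ solvableParams Ω γ G μ p ↔ 0 < lam ∧
      ∫⁻ x in (Ω : Set (Euc N)), minSol (volume.restrict (Ω : Set (Euc N))) g p
        (kerPot g (μ.restrict (Ω : Set (Euc N)))) (ENNReal.ofReal lam) x ^ p * bweight Ω γ x ≠ ∞ := by
  have hp0 : 0 < p := by linarith
  have hh : Measurable (kerPot g (μ.restrict (Ω : Set (Euc N)))) := measurable_kerPot H.measurable_g
  constructor
  · rintro ⟨hlam, u, hu⟩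
    obtain ⟨U, -, -, hA, hUe⟩ := hu.exists_eq hGpos hgG H hp hμ hlam
    refine ⟨hlam, ne_top_of_le_ne_top hA (lintegral_mono_ae ?_)⟩
    filter_upwards [minSol_le_of_super hp0.le (hUe.mono fun x hx => hx.ge)] with x hx
    exact mul_le_mul_left (ENNReal.rpow_le_rpow hx hp0.le) _
  · rintro ⟨hlam, hA⟩
    exact ⟨hlam, _, isPositiveWeakDualSolution_of_eq hGpos hgG H hp hμ hlam
      (measurable_minSol H.measurable_g hh _) hA
      (ae_of_all _ fun x => minSol_eq H.measurable_g hh hp0 _ x)⟩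

/-- Small parameters are solvable by the invariant mass bound, and the a priori estimate for
supersolutions caps all solvable ones. -/
theorem exists_isLUB_solvableParams [NullSingletonClass (volume : Measure (Euc N))]
    (hGpos : ∀ x ∈ Ω, ∀ y ∈ Ω, x ≠ y → 0 < G x y)
    (hgG : ∀ x ∈ Ω, ∀ y ∈ Ω, x ≠ y → g x y = ENNReal.ofReal (G x y))
    (H : IsGreenKernel (volume.restrict (Ω : Set (Euc N))) g k (bweight Ω γ) p m) (hp : 1 < p)
    [SFinite (μ.restrict (Ω : Set (Euc N)))]
    (hμ : ∫⁻ x in (Ω : Set (Euc N)), bweight Ω γ x ∂μ = 1) :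
    ∃ lamStar : ℝ, 0 < lamStar ∧ IsLUB (solvableParams Ω γ G μ p) lamStar := by
  have hmem := fun lam : ℝ => mem_solvableParams_iff (lam := lam) hGpos hgG H hp hμ
  obtain ⟨l, hl0, hlt, hA⟩ := H.exists_mass_minSol_lt_top hp hμ
  obtain ⟨B, hBt, hB⟩ := H.mass_le_of_super hp hμ
  have hl : l.toReal ∈ solvableParams Ω γ G μ p :=
    (hmem _).2 ⟨ENNReal.toReal_pos hl0 hlt, by rwa [ENNReal.ofReal_toReal hlt]⟩
  have hbdd : BddAbove (solvableParams Ω γ G μ p) := by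
    refine ⟨B.toReal, fun lam hlam => ?_⟩
    have h := hB (ENNReal.ofReal lam) _ ENNReal.ofReal_ne_top (ae_of_all _ fun x =>
      (minSol_eq H.measurable_g (measurable_kerPot H.measurable_g) (by linarith) _ x).ge)
      ((hmem lam).1 hlam).2
    exact (ENNReal.ofReal_le_iff_le_toReal hBt).1 (le_add_self.trans h)
  have hlub := isLUB_csSup ⟨_, hl⟩ hbdd
  exact ⟨_, hl.1.trans_le (hlub.1 hl), hlub⟩

/-- Approximation of the extremal parameter from below. -/
theorem exists_strictMono_iSup_eq [NullSingletonClass (volume : Measure (Euc N))]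
    (hGpos : ∀ x ∈ Ω, ∀ y ∈ Ω, x ≠ y → 0 < G x y)
    (hgG : ∀ x ∈ Ω, ∀ y ∈ Ω, x ≠ y → g x y = ENNReal.ofReal (G x y))
    (H : IsGreenKernel (volume.restrict (Ω : Set (Euc N))) g k (bweight Ω γ) p m) (hp : 1 < p)
    [SFinite (μ.restrict (Ω : Set (Euc N)))]
    (hμ : ∫⁻ x in (Ω : Set (Euc N)), bweight Ω γ x ∂μ = 1)
    {lamStar : ℝ} (h0 : 0 < lamStar) (hlub : IsLUB (solvableParams Ω γ G μ p) lamStar) :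
    ∃ l : ℕ → ℝ≥0∞, StrictMono l ∧ (∀ n, l n ≠ 0) ∧ (∀ n, l n ≠ ∞) ∧
      ⨆ n, l n = ENNReal.ofReal lamStar ∧
      ∀ n, ∫⁻ x in (Ω : Set (Euc N)), minSol (volume.restrict (Ω : Set (Euc N))) g p
        (kerPot g (μ.restrict (Ω : Set (Euc N)))) (l n) x ^ p * bweight Ω γ x ≠ ∞ := by
  have hp0 : 0 < p := by linarith
  obtain ⟨r, hr, hr0, hrt⟩ := exists_seq_strictMono_tendsto' h0
  have hlm : StrictMono fun n => ENNReal.ofReal (r n) := fun i j hij =>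
    (ENNReal.ofReal_lt_ofReal_iff (hr0 j).1).2 (hr hij)
  refine ⟨fun n => ENNReal.ofReal (r n), hlm,
    fun n => (ENNReal.ofReal_pos.2 (hr0 n).1).ne', fun n => ENNReal.ofReal_ne_top,
    iSup_eq_of_tendsto hlm.monotone (ENNReal.tendsto_ofReal hrt), fun n => ?_⟩
  -- A solvable parameter lies above `r n`; monotonicity of `minSol` transfers the finite mass down.
  obtain ⟨lam, hlam, hlt, -⟩ := hlub.exists_between (hr0 n).2
  have hA := ((mem_solvableParams_iff hGpos hgG H hp hμ).1 hlam).2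
  refine ne_top_of_le_ne_top hA (lintegral_mono fun x => ?_)
  exact mul_le_mul_left (ENNReal.rpow_le_rpow
    (minSol_mono hp0.le (ENNReal.ofReal_le_ofReal hlt.le) x) hp0.le) _

end Extremal

/-! ### Semi-stability and the weighted eigenvalue. -/

section Stability

variable {N : ℕ} {Ω : Opens (Euc N)} {L : TestOperator Ω} {p : ℝ} {u : Euc N → ℝ}
  {U : Euc N → ℝ≥0∞}

theorem toReal_weight_mul_enorm_sq (hp : 1 < p) {t : ℝ} {T : ℝ≥0∞} (ht : t = T.toReal) (z : ℝ) :
    (ENNReal.ofReal p * T ^ (p - 1) * ‖z‖ₑ ^ 2).toReal = p * t ^ (p - 1) * z ^ 2 := by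
  rw [ENNReal.toReal_mul, ENNReal.toReal_mul, ENNReal.toReal_ofReal (by linarith),
    ENNReal.toReal_pow, toReal_enorm, ← ENNReal.toReal_rpow, ht, Real.norm_eq_abs, sq_abs]

theorem integral_weight_mul_sq (hp : 1 < p) (hU : Measurable U)
    (huU : ∀ᵐ x ∂volume.restrict (Ω : Set (Euc N)), u x = (U x).toReal)
    (ξ : L2 Ω)
    (hfin : ∫⁻ x in (Ω : Set (Euc N)), ENNReal.ofReal p * U x ^ (p - 1) * ‖ξ x‖ₑ ^ 2 ≠ ∞) :
    IntegrableOn (fun x => p * u x ^ (p - 1) * ξ x ^ 2) (Ω : Set (Euc N)) ∧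
    ∫ x in (Ω : Set (Euc N)), p * u x ^ (p - 1) * ξ x ^ 2 =
      (∫⁻ x in (Ω : Set (Euc N)), ENNReal.ofReal p * U x ^ (p - 1) * ‖ξ x‖ₑ ^ 2).toReal := by
  have hm : AEMeasurable (fun x => ENNReal.ofReal p * U x ^ (p - 1) * ‖ξ x‖ₑ ^ 2)
      (volume.restrict (Ω : Set (Euc N))) :=
    ((hU.pow_const (p - 1)).const_mul _).aemeasurable.mul
      ((Lp.aestronglyMeasurable ξ).enorm.pow_const 2)
  have he : (fun x => (ENNReal.ofReal p * U x ^ (p - 1) * ‖ξ x‖ₑ ^ 2).toReal)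
      =ᵐ[volume.restrict (Ω : Set (Euc N))] fun x => p * u x ^ (p - 1) * ξ x ^ 2 :=
    huU.mono fun x hx => toReal_weight_mul_enorm_sq hp hx (ξ x)
  refine ⟨(integrable_toReal_of_lintegral_ne_top hm hfin).congr he, ?_⟩
  rw [← integral_congr_ae he, integral_toReal hm (ae_lt_top' hm hfin)]

theorem lintegral_weight_mul_enorm_sq_ne_zero {V : Euc N → ℝ≥0∞} (hV : Measurable V)
    (hV0 : ∀ᵐ x ∂volume.restrict (Ω : Set (Euc N)), V x ≠ 0) {ξ : L2 Ω} (hξ : ξ ≠ 0) :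
    ∫⁻ x in (Ω : Set (Euc N)), V x * ‖ξ x‖ₑ ^ 2 ≠ 0 := by
  intro h
  have hm : AEMeasurable (fun x => V x * ‖ξ x‖ₑ ^ 2) (volume.restrict (Ω : Set (Euc N))) :=
    hV.aemeasurable.mul ((Lp.aestronglyMeasurable ξ).enorm.pow_const 2)
  rw [lintegral_eq_zero_iff' hm] at h
  refine hξ ((Lp.eq_zero_iff_ae_eq_zero).2 ?_)
  filter_upwards [h, hV0] with x hx hx0
  simpa [hx0] using hx

theorem lintegral_weight_mul_enorm_sq_zero (V : Euc N → ℝ≥0∞) :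
    ∫⁻ x in (Ω : Set (Euc N)), V x * ‖(0 : L2 Ω) x‖ₑ ^ 2 = 0 := by
  refine (lintegral_congr_ae ?_).trans lintegral_zero
  filter_upwards [Lp.coeFn_zero ℝ 2 (volume.restrict (Ω : Set (Euc N)))] with x hx
  rw [hx]
  simp only [Pi.zero_apply, enorm_zero, ne_eq, OfNat.ofNat_ne_zero, not_false_eq_true, zero_pow,
    mul_zero]

/-- The stability inequality with optimal constant, in terms of the weight
`V = p U^(p-1)`. -/
theorem isSemistable_and_weightedEigenvalue_eq_one (hp : 1 < p) (hU : Measurable U)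
    (huU : ∀ᵐ x ∂volume.restrict (Ω : Set (Euc N)), u x = (U x).toReal)
    (hU0 : ∀ᵐ x ∂volume.restrict (Ω : Set (Euc N)), U x ≠ 0)
    (hle : ∀ ξ ∈ formDomain L,
      ∫⁻ x in (Ω : Set (Euc N)), ENNReal.ofReal p * U x ^ (p - 1) * ‖ξ x‖ₑ ^ 2 ≤
        ENNReal.ofReal (energy L ξ))
    (hopt : ∀ θ : ℝ≥0∞, θ < 1 → ¬ ∀ ξ ∈ formDomain L,
      ∫⁻ x in (Ω : Set (Euc N)), ENNReal.ofReal p * U x ^ (p - 1) * ‖ξ x‖ₑ ^ 2 ≤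
        θ * ENNReal.ofReal (energy L ξ)) :
    IsSemistable L p u ∧ weightedEigenvalue L p u = 1 := by
  set J : L2 Ω → ℝ≥0∞ := fun ξ =>
    ∫⁻ x in (Ω : Set (Euc N)), ENNReal.ofReal p * U x ^ (p - 1) * ‖ξ x‖ₑ ^ 2 with hJ
  have hp0 : 0 < p := by linarith
  have hp1 : 0 < p - 1 := by linarith
  have hJt : ∀ ξ ∈ formDomain L, J ξ ≠ ∞ := fun ξ hξ =>
    ne_top_of_le_ne_top ENNReal.ofReal_ne_top (hle ξ hξ)
  have hJ0 : ∀ ξ : L2 Ω, ξ ≠ 0 → J ξ ≠ 0 := fun ξ hξ => by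
    refine lintegral_weight_mul_enorm_sq_ne_zero ((hU.pow_const (p - 1)).const_mul _) ?_ hξ
    filter_upwards [hU0] with x hx
    refine mul_ne_zero (ENNReal.ofReal_pos.2 hp0).ne' fun h => ?_
    rcases ENNReal.rpow_eq_zero_iff.1 h with h | h
    · exact hx h.1
    · linarith [h.2]
  have hint := fun ξ hξ => integral_weight_mul_sq hp hU huU ξ (hJt ξ hξ)
  have hJE : ∀ ξ ∈ formDomain L, ξ ≠ 0 → 0 < (J ξ).toReal ∧ (J ξ).toReal ≤ energy L ξ := by
    intro ξ hξ hne
    have hE : 0 < energy L ξ :=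
      ENNReal.ofReal_pos.1 ((pos_iff_ne_zero.2 (hJ0 ξ hne)).trans_le (hle ξ hξ))
    exact ⟨ENNReal.toReal_pos (hJ0 ξ hne) (hJt ξ hξ),
      ENNReal.toReal_le_of_le_ofReal hE.le (hle ξ hξ)⟩
  refine ⟨fun ξ hξ hne => ⟨?_, ?_⟩, ?_⟩
  · have h := (hint ξ hξ).1.const_mul p⁻¹
    refine h.congr (ae_of_all _ fun x => ?_)
    change p⁻¹ * (p * u x ^ (p - 1) * ξ x ^ 2) = u x ^ (p - 1) * ξ x ^ 2
    rw [mul_assoc, inv_mul_cancel_left₀ hp0.ne']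
  · rw [← integral_const_mul]
    simp only [← mul_assoc]
    rw [(hint ξ hξ).2]
    exact (hJE ξ hξ hne).2
  · set T : Set ℝ := {t : ℝ | ∃ ξ ∈ formDomain L, ξ ≠ 0 ∧
      t = energy L ξ / ∫ x in (Ω : Set (Euc N)), p * u x ^ (p - 1) * ξ x ^ 2} with hT
    have h1 : ∀ t ∈ T, 1 ≤ t := by
      rintro t ⟨ξ, hξ, hne, rfl⟩
      rw [(hint ξ hξ).2, le_div_iff₀ (hJE ξ hξ hne).1, one_mul]
      exact (hJE ξ hξ hne).2
    have hJz : J 0 = 0 := lintegral_weight_mul_enorm_sq_zero _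
    -- Were the energy space trivial, the inequality would hold with `θ = 0`, against `hopt`. This
    -- excludes the default value `sInf ∅ = 0`.
    have hne : T.Nonempty := by
      by_contra hT0
      refine hopt 0 zero_lt_one fun ξ hξ => ?_
      have : ξ = 0 := by
        by_contra h
        exact hT0 ⟨_, ξ, hξ, h, rfl⟩
      rw [this]
      exact hJz.le.trans zero_le
    -- If the infimum `σ` exceeded `1`, the inequality would hold with the better constant `θ =
    -- 1/σ`.
    refine le_antisymm (not_lt.1 fun hlt => ?_) (le_csInf hne h1)
    set σ := sInf T with hσ
    have hσ0 : 0 < σ := zero_lt_one.trans hlt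
    refine hopt (ENNReal.ofReal σ⁻¹) ?_ fun ξ hξ => ?_
    · rw [ENNReal.ofReal_lt_one]
      exact inv_lt_one_of_one_lt₀ hlt
    · by_cases h : ξ = 0
      · rw [h]
        exact hJz.le.trans zero_le
      · have hmem : σ ≤ energy L ξ / (J ξ).toReal :=
          csInf_le ⟨1, h1⟩ ⟨ξ, hξ, h, by rw [(hint ξ hξ).2]⟩
        rw [le_div_iff₀ (hJE ξ hξ h).1] at hmem
        change J ξ ≤ _
        rw [← ENNReal.ofReal_mul (inv_pos.2 hσ0).le, ← ENNReal.ofReal_toReal (hJt ξ hξ)]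
        refine ENNReal.ofReal_le_ofReal ?_
        rwa [le_inv_mul_iff₀ hσ0]

end Stability

/-! ### The extremal solution and its optimal stability. -/

theorem proposition7p4
    {N : ℕ} {s γ p : ℝ} (hs : 0 < s) (hs1 : s ≤ 1) (hγ : 0 < γ) (hγ1 : γ ≤ 1)
    (hN : 2 * s < (N : ℝ)) (hγs : s - 1 / 2 ≤ γ)
    {Ω : Opens (Euc N)} (hΩ : IsBoundedC2Domain Ω)
    (L : TestOperator Ω) (G : Euc N → Euc N → ℝ)
    (hG : IsGreenFunction L s γ G)
    (hL : IsPositiveSymmetric L)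
    (hH : formDomain L = Hs00 Ω s)
    (hNs : dimBound s γ ≤ (N : ℝ))
    (hp : 1 < p) (hp' : p < critExp N s γ)
    (μ : Measure (Euc N))
    (hμ : ∫⁻ x in (Ω : Set (Euc N)), ENNReal.ofReal (bdist Ω x ^ γ) ∂μ = 1) :
    ∃ lamStar : ℝ, 0 < lamStar ∧ IsLUB (solvableParams Ω γ G μ p) lamStar ∧
      (∃ u : Euc N → ℝ, IsMinimalSolution Ω γ G μ p lamStar u) ∧
      ∀ u : Euc N → ℝ, IsMinimalSolution Ω γ G μ p lamStar u →
        IsSemistable L p u ∧ weightedEigenvalue L p u = 1 := by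
  have hN0 : N ≠ 0 := by
    rintro rfl
    norm_num at hN
    linarith
  have hFin : Nonempty (Fin N) := ⟨⟨0, Nat.pos_of_ne_zero hN0⟩⟩
  have hp0 : 0 < p := by linarith
  have hp1 : 0 < p - 1 := by linarith
  obtain ⟨g, k, m, hm, H, hgG⟩ :=
    hG.exists_isGreenKernel hs hγ hN hΩ.connected.nonempty hΩ.bounded hp hp'
  have hf := frontier_nonempty_of_isBounded hN0 hΩ.connected.nonempty hΩ.bounded
  have hμ' : ∫⁻ x in (Ω : Set (Euc N)), bweight Ω γ x ∂μ = 1 := hμ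
  have hSF : SFinite (μ.restrict (Ω : Set (Euc N))) := sFinite_restrict_of_weight hf hμ'
  have hg := H.measurable_g
  have hhm : Measurable (kerPot g (μ.restrict (Ω : Set (Euc N)))) := measurable_kerPot hg
  obtain ⟨lamStar, h0, hlub⟩ := exists_isLUB_solvableParams hG.pos hgG H hp hμ'
  obtain ⟨l, hlmono, hl0, hlt, hlsup, hlA⟩ :=
    exists_strictMono_iSup_eq hG.pos hgG H hp hμ' h0 hlub
  set ν := volume.restrict (Ω : Set (Euc N)) with hν
  set h := kerPot g (μ.restrict (Ω : Set (Euc N))) with hh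
  obtain ⟨hWe, hWA, hWmin⟩ := H.iSup_minSol hp hμ' hlmono.monotone hlt hlA
  set W : Euc N → ℝ≥0∞ := fun x => ⨆ n, minSol ν g p h (l n) x with hW
  have hWm : Measurable W := Measurable.iSup fun n => measurable_minSol hg hhm (l n)
  rw [hlsup] at hWe hWmin
  have hWt : ∀ᵐ x ∂ν, W x ≠ ∞ := H.ae_ne_top_of_mass hp0 hWm.aemeasurable hWA
  have hl00 : ENNReal.ofReal lamStar ≠ 0 := (ENNReal.ofReal_pos.2 h0).ne'
  have hW0 : ∀ᵐ x ∂ν, W x ≠ 0 := by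
    filter_upwards [H.kerPot_ne_zero hμ'] with x hx hx0
    have := hWe x
    rw [show (⨆ n, minSol ν g p h (l n) x) = 0 from hx0] at this
    exact mul_ne_zero hl00 hx (add_eq_zero.1 this.symm).2
  have hsol : IsPositiveWeakDualSolution Ω γ G μ p lamStar fun x => (W x).toReal :=
    isPositiveWeakDualSolution_of_eq hG.pos hgG H hp hμ' h0 hWm hWA (ae_of_all _ hWe)
  have hmin : ∀ v, IsPositiveWeakDualSolution Ω γ G μ p lamStar v →
      ∀ᵐ x ∂ν, (W x).toReal ≤ v x := by
    intro v hv
    obtain ⟨U, hUm, hUv, hUA, hUe⟩ := hv.exists_eq hG.pos hgG H hp hμ' h0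
    filter_upwards [hWmin U (hUe.mono fun x hx => hx.ge), hUv, hv.pos] with x h1 h2 h3
    rw [h2] at h1
    exact ENNReal.toReal_le_of_le_ofReal h3.le h1
  refine ⟨lamStar, h0, hlub, ⟨_, hsol, hmin⟩, fun u hu => ?_⟩
  -- Two minimal solutions bound each other, so only the constructed one has to be studied.
  have huW : ∀ᵐ x ∂ν, u x = (W x).toReal := by
    filter_upwards [hmin u hu.1, hu.2 _ hsol] with x h1 h2
    exact le_antisymm h2 h1
  have hVm : Measurable fun x => ENNReal.ofReal p * W x ^ (p - 1) :=
    (hWm.pow_const (p - 1)).const_mul _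
  have hVt : ∀ᵐ x ∂ν, ENNReal.ofReal p * W x ^ (p - 1) ≠ ∞ := hWt.mono fun x hx =>
    ENNReal.mul_ne_top ENNReal.ofReal_ne_top (ENNReal.rpow_ne_top_of_nonneg hp1.le hx)
  have hV0 : ∀ᵐ x ∂ν, ENNReal.ofReal p * W x ^ (p - 1) ≠ 0 := by
    filter_upwards [hW0] with x hx
    refine mul_ne_zero (ENNReal.ofReal_pos.2 hp0).ne' fun h => ?_
    rcases ENNReal.rpow_eq_zero_iff.1 h with h | h
    · exact hx h.1
    · linarith [h.2]
  refine isSemistable_and_weightedEigenvalue_eq_one hp hWm huW hW0 (fun ξ hξ => ?_)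
    fun θ hθ hc => ?_
  -- Stability at `l n` uses the solution at `l (n + 1)` as comparison. At `λ^*` no larger parameter
  -- is available, so the inequality is reached only in the limit.
  · have hVn : ∀ n, ∫⁻ x, ENNReal.ofReal p * minSol ν g p h (l n) x ^ (p - 1) * ‖ξ x‖ₑ ^ 2 ∂ν ≤
        ENNReal.ofReal (energy L ξ) := by
      intro n
      have hVt' : ∀ᵐ x ∂ν, ENNReal.ofReal p * minSol ν g p h (l n) x ^ (p - 1) ≠ ∞ := by
        filter_upwards [hWt] with x hx
        exact ENNReal.mul_ne_top ENNReal.ofReal_ne_top (ENNReal.rpow_ne_top_of_nonneg hp1.le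
          (ne_top_of_le_ne_top hx (le_iSup (fun n => minSol ν g p h (l n) x) n)))
      exact lintegral_mul_enorm_sq_le_energy hΩ.bounded hL hG hgG H hp
        (((measurable_minSol hg hhm (l n)).pow_const (p - 1)).const_mul _) hVt'
        (fun f hf => H.lintegral_mul_kerOp_self_le_of_lt hp hμ' (hlmono n.lt_succ_self) (hl0 n)
          (hlA (n + 1)) hf) hξ
    have e : ∀ x, ENNReal.ofReal p * W x ^ (p - 1) * ‖ξ x‖ₑ ^ 2 =
        ⨆ n, ENNReal.ofReal p * minSol ν g p h (l n) x ^ (p - 1) * ‖ξ x‖ₑ ^ 2 := by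
      intro x
      rw [hW, rpow_iSup_nat hp1, ENNReal.mul_iSup, ENNReal.iSup_mul]
    simp only [e]
    rw [lintegral_iSup']
    · exact iSup_le hVn
    · exact fun n => (((measurable_minSol hg hhm (l n)).pow_const (p - 1)).const_mul
        _).aemeasurable.mul ((Lp.aestronglyMeasurable ξ).enorm.pow_const 2)
    · refine ae_of_all _ fun x i j hij => ?_
      exact mul_le_mul_left (mul_le_mul_right (ENNReal.rpow_le_rpow
        (minSol_mono hp0.le (hlmono.monotone hij) x) hp1.le) _) _
  -- A constant `θ < 1` makes the linearization at `W` a strict contraction, which yields a solvable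
  -- parameter beyond `λ^*`.
  · obtain ⟨lam', hlt', hlt'', hA'⟩ := H.exists_mass_minSol_lt_top_of_contraction hm hp hμ' hl00
      ENNReal.ofReal_ne_top hWm hWe hWA hθ fun f hf =>
        lintegral_mul_kerOp_sq_le_of_energy hΩ.bounded hL hG hgG H hp hVm hV0 hVt
          (hθ.trans ENNReal.one_lt_top).ne hc hf
    have hlt : lamStar < lam'.toReal := (ENNReal.ofReal_lt_iff_lt_toReal h0.le hlt'').1 hlt'
    refine absurd (hlub.1 ((mem_solvableParams_iff hG.pos hgG H hp hμ').2
      ⟨h0.trans hlt, ?_⟩)) (not_le.2 hlt)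
    rwa [ENNReal.ofReal_toReal hlt'']
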